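/- Let $p\ge 1$ be an integer, $g\in\mathbb R$ with $|g|\le 1$, $d\lambda_0=\frac{d\theta}{2\pi}$ and $d\lambda_g=(1-g\cos\theta)\,d\lambda_0$ on the circle $\mathbb T$. Let $\mu$ be a $p\times p$ matrix measure on $\mathbb T$ which is Hermitian, nonnegative, normalized by $\mu(\mathbb T)=\mathbf 1$, and non-trivial, i.e. $\operatorname{tr}\int f(e^{i\theta})^\dagger d\mu(\theta) f(e^{i\theta})>0$ for every non-zero $p\times p$ matrix polynomial $f$. Put $\langle\langle f,h\rangle\rangle_R=\int f^\dagger d\mu\, h$ and $\langle\langle f,h\rangle\rangle_L=\int h\,d\mu\, f^\dagger$. Let $\Phi^R_k$, $\Phi^L_k$ be the monic orthogonal matrix polynomials of degree $k$ for these two products, and let $\varphi^R_k=\Phi^R_k\kappa^R_k$, $\varphi^L_k=\kappa^L_k\Phi^L_k$ be the orthonormal ones with $\kappa_0^R=\kappa_0^L=\mathbf 1$, $(\kappa^R_k)^{-1}\kappa^R_{k+1}>0$ and $\kappa^L_{k+1}(\kappa^L_k)^{-1}>0$. The Verblunsky coefficients $\alpha_k$ ($k\ge0$) of $\mu$ are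 the $p\times p$ matrices with $\alpha_k\alpha_k^\dagger\le\mathbf 1$ such that $$z\varphi^L_k-(\mathbf 1-\alpha_k^\dagger\alpha_k)^{1/2}\varphi^L_{k+1}=\alpha_k^\dagger(\varphi^R_k)^*,\qquad z\varphi^R_k-\varphi^R_{k+1}(\mathbf 1-\alpha_k\alpha_k^\dagger)^{1/2}=(\varphi^L_k)^*\alpha_k^\dagger,$$ where $P^*(z)=z^kP(1/\bar z)^\dagger$ for $P$ of degree $k$. For a probability measure $\sigma$ on $\mathbb T$ and a matrix measure $\nu$ with Lebesgue decomposition $d\nu=h\,d\sigma+d\nu_s$ define $\mathcal K(\mathbf 1\cdot\sigma\,|\,\nu)=-\int\log\det h\,d\sigma\in(-\infty,+\infty]$, where $\log 0=-\infty$; let $\Lambda_0=\mathbf 1\cdot\lambda_0$ and $\Lambda_g=\mathbf 1\cdot\lambda_g$. For $N\ge0$ put $$L_N=\sum_{k=0}^{N-1}\log\det(\mathbf 1-\alpha_k\alpha_k^\dagger),\qquad T_N=\operatorname{Re}\operatorname{tr}\Big(\alpha_0-\sum_{k=0}^{N-1}\alpha_k\alpha_{k+1}^\dagger\Big).$$ Theorem.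 Let $d\mu=w\,d\lambda_0+d\mu_s$ be the Lebesgue decomposition of $\mu$. Then, as an identity in $[-\infty,\infty)$, $$\int_0^{2\pi}(1-g\cos\theta)\log\det w(\theta)\,d\lambda_0(\theta)=\sum_{k=0}^\infty\log\det(\mathbf 1-\alpha_k\alpha_k^\dagger)-g\,\operatorname{Re}\operatorname{tr}\Big(\alpha_0-\sum_{k=0}^\infty\alpha_k\alpha_{k+1}^\dagger\Big),$$ where the right-hand side denotes $\lim_{N\to\infty}(L_N-gT_N)$, which exists in $[-\infty,\infty)$. Equivalently, $$\mathcal K(\Lambda_g\,|\,\mu)=\mathcal K(\Lambda_g\,|\,\Lambda_0)-\sum_{k=0}^\infty\log\det(\mathbf 1-\alpha_k\alpha_k^\dagger)+g\,\operatorname{Re}\operatorname{tr}\Big(\alpha_0-\sum_{k=0}^\infty\alpha_k\alpha_{k+1}^\dagger\Big),$$ with the right-hand side read as $\lim_{N\to\infty}\big(\mathcal K(\Lambda_g|\Lambda_0)-L_N+gT_N\big)$. Here $\mathcal K(\Lambda_g\,|\,\Lambda_0)=p\,\mathcal K(\lambda_g\,|\,\lambda_0)$, with $\mathcal K(\lambda_g\,|\,\lambda_0)$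 the Kullback–Leibler divergence. Both sides are nonnegative, and they may be $+\infty$ simultaneously. -/

import Mathlib

open MeasureTheory Filter Topology Polynomial
open scoped Real ENNReal Matrix MatrixOrder ComplexOrder

noncomputable section

namespace MatrixOPUC

instance fact_two_pi_pos : Fact (0 < 2 * π) := ⟨Real.two_pi_pos⟩

/-- The circle, as the angle variable `θ` modulo `2π`. -/
abbrev Torus : Type := AddCircle (2 * π)

/-- The point `e^{iθ}` of the complex unit circle. -/
def expi (θ : Torus) : ℂ := (AddCircle.toCircle θ : ℂ)

theorem expi_coe (x : ℝ) : expi (x : Torus) = Complex.exp (x * Complex.I) := by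
  simp [expi, AddCircle.toCircle_apply_mk, Circle.coe_exp]

/-- `cos θ`. -/
def cosT (θ : Torus) : ℝ := (expi θ).re

/-- Normalized Lebesgue measure `dλ₀ = dθ / 2π`. -/
def lam0 : Measure Torus := AddCircle.haarAddCircle

instance : IsProbabilityMeasure lam0 :=
  inferInstanceAs (IsProbabilityMeasure (AddCircle.haarAddCircle (T := 2 * π)))

/-- `dλ_g = (1 - g cos θ) dλ₀`. -/
def lamg (g : ℝ) : Measure Torus :=
  lam0.withDensity fun θ => ENNReal.ofReal (1 - g * cosT θ)

/-- A normalized, nonnegative Hermitian `p × p` matrix measure on the circle: a matrix of complex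
measures whose value on each measurable set is positive semidefinite, and which has total
mass `1`. -/
structure MatrixMeasure (p : ℕ) where
  entry : Fin p → Fin p → ComplexMeasure Torus
  posSemidef : ∀ A : Set Torus, MeasurableSet A →
    (Matrix.of fun i j => entry i j A).PosSemidef
  normalized : (Matrix.of fun i j => entry i j Set.univ) = 1

/-- The quasi-scalar measure `1 · σ`, where `σ` is a probability measure. -/
def quasiScalar (p : ℕ) (σ : Measure Torus) [IsProbabilityMeasure σ] : MatrixMeasure p where
  entry i j := if i = j then σ.toSignedMeasure.toComplexMeasure 0 else 0
  posSemidef A hA := by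
    have h : (Matrix.of fun i j : Fin p =>
        (if i = j then σ.toSignedMeasure.toComplexMeasure 0 else 0 : ComplexMeasure Torus) A)
          = Matrix.diagonal fun _ => ((σ.real A : ℝ) : ℂ) := by
      ext i j
      by_cases hij : i = j
      · subst hij
        apply Complex.ext <;>
          simp [SignedMeasure.toComplexMeasure_apply, Measure.toSignedMeasure_apply, hA]
      · simp [hij]
    rw [h, Matrix.posSemidef_diagonal_iff]
    intro i
    exact_mod_cast measureReal_nonneg
  normalized := by
    ext i j
    by_cases hij : i = j
    · subst hij
      apply Complex.ext <;>
        simp [SignedMeasure.toComplexMeasure_apply, Measure.toSignedMeasure_apply]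
    · simp [hij]

variable {p : ℕ}

/-- The value `f(e^{iθ})` of a matrix polynomial. -/
def evalT (f : (Matrix (Fin p) (Fin p) ℂ)[X]) (θ : Torus) : Matrix (Fin p) (Fin p) ℂ :=
  f.eval (Matrix.scalar (Fin p) (expi θ))

namespace MatrixMeasure

/-- The integral `∫ h dμ_{kl}` of a complex function against an entry of `μ`. -/
def integralEntry (μ : MatrixMeasure p) (k l : Fin p) (h : Torus → ℂ) : ℂ :=
  (μ.entry k l).integral h (ContinuousLinearMap.mul ℝ ℂ)

/-- `⟨⟨f, g⟩⟩_R = ∫ f(e^{iθ})† dμ(θ) g(e^{iθ})`. -/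
def innerR (μ : MatrixMeasure p) (f g : (Matrix (Fin p) (Fin p) ℂ)[X]) :
    Matrix (Fin p) (Fin p) ℂ :=
  Matrix.of fun i j => ∑ k, ∑ l,
    μ.integralEntry k l fun θ => (evalT f θ)ᴴ i k * evalT g θ l j

/-- `⟨⟨f, g⟩⟩_L = ∫ g(e^{iθ}) dμ(θ) f(e^{iθ})†`. -/
def innerL (μ : MatrixMeasure p) (f g : (Matrix (Fin p) (Fin p) ℂ)[X]) :
    Matrix (Fin p) (Fin p) ℂ :=
  Matrix.of fun i j => ∑ k, ∑ l,
    μ.integralEntry k l fun θ => evalT g θ i k * (evalT f θ)ᴴ l j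

/-- `μ` is non-trivial if `tr ⟨⟨f, f⟩⟩_R > 0` for every non-zero matrix polynomial `f`. -/
def Nontrivial (μ : MatrixMeasure p) : Prop :=
  ∀ f : (Matrix (Fin p) (Fin p) ℂ)[X], f ≠ 0 → 0 < (μ.innerR f f).trace.re

/-- The matrix density of the absolutely continuous part of `μ` with respect to `σ`, that is `h` in
the Lebesgue decomposition `dμ = h dσ + dμ_s`. -/
def density (μ : MatrixMeasure p) (σ : Measure Torus) (θ : Torus) : Matrix (Fin p) (Fin p) ℂ :=
  Matrix.of fun i j => (μ.entry i j).rnDeriv σ θ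

end MatrixMeasure

/-- For a matrix polynomial `P` of degree `k`, the reversed polynomial
`P^*(z) = z^k P(1 / conj z)†`: coefficient `j` of `P` is conjugated and moved to place `k - j`. -/
def rev (k : ℕ) (P : (Matrix (Fin p) (Fin p) ℂ)[X]) : (Matrix (Fin p) (Fin p) ℂ)[X] :=
  ∑ j ∈ Finset.range (k + 1), monomial (k - j) (P.coeff j)ᴴ

/-- The right defect matrix `(1 - αα†)^{1/2}`. -/
def rhoR (α : Matrix (Fin p) (Fin p) ℂ) : Matrix (Fin p) (Fin p) ℂ := CFC.sqrt (1 - α * αᴴ)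

/-- The left defect matrix `(1 - α†α)^{1/2}`. -/
def rhoL (α : Matrix (Fin p) (Fin p) ℂ) : Matrix (Fin p) (Fin p) ℂ := CFC.sqrt (1 - αᴴ * α)

/-- `Φ` is the sequence of right monic orthogonal polynomials of `μ` and `φ k = Φ k * κ k` is the
sequence of normalized ones, with `κ_k⁻¹ κ_{k+1} > 0`. -/
structure IsRightOPS (μ : MatrixMeasure p) (Φ φ : ℕ → (Matrix (Fin p) (Fin p) ℂ)[X])
    (κ : ℕ → Matrix (Fin p) (Fin p) ℂ) : Prop where
  natDegree_le : ∀ k, (Φ k).natDegree ≤ k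
  coeff_self : ∀ k, (Φ k).coeff k = 1
  orthogonal : ∀ k, ∀ j < k, μ.innerR (X ^ j) (Φ k) = 0
  kappa_zero : κ 0 = 1
  kappa_pos : ∀ k, ((κ k)⁻¹ * κ (k + 1)).PosDef
  eq_mul : ∀ k, φ k = Φ k * C (κ k)
  orthonormal : ∀ i j, μ.innerR (φ i) (φ j) = if i = j then 1 else 0

/-- `Φ` is the sequence of left monic orthogonal polynomials of `μ` and `φ k = κ k * Φ k` is the
sequence of normalized ones, with `κ_{k+1} κ_k⁻¹ > 0`. -/
structure IsLeftOPS (μ : MatrixMeasure p) (Φ φ : ℕ → (Matrix (Fin p) (Fin p) ℂ)[X])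
    (κ : ℕ → Matrix (Fin p) (Fin p) ℂ) : Prop where
  natDegree_le : ∀ k, (Φ k).natDegree ≤ k
  coeff_self : ∀ k, (Φ k).coeff k = 1
  orthogonal : ∀ k, ∀ j < k, μ.innerL (X ^ j) (Φ k) = 0
  kappa_zero : κ 0 = 1
  kappa_pos : ∀ k, (κ (k + 1) * (κ k)⁻¹).PosDef
  eq_mul : ∀ k, φ k = C (κ k) * Φ k
  orthonormal : ∀ i j, μ.innerL (φ i) (φ j) = if i = j then 1 else 0

/-- `α` is a sequence of Verblunsky coefficients of `μ`: matrices of the closed unit ball for which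
the orthonormal polynomials of `μ` satisfy the two matrix Szegő recursions. -/
def IsVerblunsky (μ : MatrixMeasure p) (α : ℕ → Matrix (Fin p) (Fin p) ℂ) : Prop :=
  ∃ (ΦR ΦL φR φL : ℕ → (Matrix (Fin p) (Fin p) ℂ)[X]) (κR κL : ℕ → Matrix (Fin p) (Fin p) ℂ),
    IsRightOPS μ ΦR φR κR ∧ IsLeftOPS μ ΦL φL κL ∧
    ∀ k, (1 - α k * (α k)ᴴ).PosSemidef ∧
      X * φL k - C (rhoL (α k)) * φL (k + 1) = C (α k)ᴴ * rev k (φR k) ∧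
      X * φR k - φR (k + 1) * C (rhoR (α k)) = rev k (φL k) * C (α k)ᴴ

open scoped Classical in
/-- The Verblunsky coefficients `α_k(μ)`. (A non-trivial measure has exactly one such sequence; the
value is `0` by convention if there is none.) -/
def verblunsky (μ : MatrixMeasure p) : ℕ → Matrix (Fin p) (Fin p) ℂ :=
  if h : ∃ α, IsVerblunsky μ α then h.choose else 0

/-- The extended-real integral: integral of the positive part minus integral of the negative part.
It is used only for functions whose positive part has a finite integral. -/
def eintegral (σ : Measure Torus) (f : Torus → EReal) : EReal :=
  ((∫⁻ θ, (f θ).toENNReal ∂σ : ℝ≥0∞) : EReal) - ((∫⁻ θ, (-f θ).toENNReal ∂σ : ℝ≥0∞) : EReal)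

/-- `log det A ∈ [-∞, ∞)` for a positive semidefinite matrix `A`, with `log 0 = -∞`. -/
def logDet (A : Matrix (Fin p) (Fin p) ℂ) : EReal := ENNReal.log (ENNReal.ofReal A.det.re)

/-- The relative entropy `K(1·σ | μ) = -∫ log det h dσ`, where `dμ = h dσ + dμ_s`. -/
def relEntropy (σ : Measure Torus) (μ : MatrixMeasure p) : EReal :=
  -eintegral σ fun θ => logDet (μ.density σ θ)

/-- The constant `K(Λ_g | Λ₀)`, where `Λ_g = 1·λ_g` and `Λ₀ = 1·λ₀`. -/
def relEntropyRef (p : ℕ) (g : ℝ) : EReal := relEntropy (lamg g) (quasiScalar p lam0)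

/-- `∑_{k<N} log det (1 - α_k α_k†)`. -/
def logDetSum (α : ℕ → Matrix (Fin p) (Fin p) ℂ) (N : ℕ) : ℝ :=
  ∑ k ∈ Finset.range N, Real.log (1 - α k * (α k)ᴴ).det.re

/-- `Re tr (α_0 - ∑_{k<N} α_k α_{k+1}†)`. -/
def TSum (α : ℕ → Matrix (Fin p) (Fin p) ℂ) (N : ℕ) : ℝ :=
  (α 0 - ∑ k ∈ Finset.range N, α k * (α (k + 1))ᴴ).trace.re

end MatrixOPUC

end

/-! ## Positive semidefinite matrices -/

noncomputable section

namespace MatrixOPUC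

section MatrixInequalities

variable {n : Type*} [Fintype n] [DecidableEq n]

/-! Write `S_N = L_N - g T_N`, let `P` be the right orthonormal polynomial of degree `N + 1`, `P^*`
its reversal and `w` the Lebesgue density of `μ`. The proof traps `S_N` between entropy integrals by
applying `log x ≤ x - 1` to eigenvalues in two different ways.

The exact input is Jensen's formula. Since `det P^*` has no zero in the closed disc
(`det_evalZ_rev_ne_zero`), the mean of `log |det P|²` against `1 - g cos θ` involves only the first
two Taylor coefficients of `det P^*`, and the Szegő recursions turn these into Verblunsky
coefficients: the mean is `-(L_{N+1} - g T_N)` (`integral_weight_mul_log_det`).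

Lower bound for `S_N`: integrate `log det (P† w P) ≤ tr (P† w P) - p`. Because `⟨⟨P, zP⟩⟩_R = -α_N
α_{N+1}†`, the result is that the entropy integral is at most `S_{N+1}`, without error term
(`integral_log_det_le`).

Upper bound: the Bernstein–Szegő density `W = (P P†)⁻¹` has the moments of `μ` up to order `N + 1`
(`moment_bsDensity`). Hence `log det f + log det W ≤ tr (f W) - p` with `f = q† q + δ` bounds
`L_{N+1} - g T_N` by a quantity free of `N` as soon as `q` has degree at most `N`
(`logDetSum_sub_le`). Letting `q† q` approximate `(w + ε)⁻¹` on a set that carries `λ₀` and is null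
for the singular part, and `0` off this set, gives the integral of `(1 - g cos θ) log det (w + ε)`
up to a small error (`eventually_le`).

As `ε → 0` these integrals converge to the entropy integral if it is finite, and are unbounded below
otherwise. The two bounds differ by `g Re tr (α_N α_{N+1}†)`. If the entropy is finite, `S_N` is
bounded below and `sub_le_sub_sum_sq` makes `tr α_k α_k†` square summable, so this correction tends
to `0`; otherwise its boundedness is enough. Passing from `λ₀` to `λ_g` only adds the constant `p ∫
(1 - g cos θ) log (1 - g cos θ) dλ₀`. -/

theorem PosDef.det_re_pos {A : Matrix n n ℂ} (hA : A.PosDef) : 0 < A.det.re :=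
  (Complex.pos_iff.mp hA.det_pos).1

theorem PosSemidef.det_re_nonneg {A : Matrix n n ℂ} (hA : A.PosSemidef) : 0 ≤ A.det.re :=
  (Complex.nonneg_iff.mp hA.det_nonneg).1

omit [DecidableEq n] in
theorem PosSemidef.trace_re_nonneg {A : Matrix n n ℂ} (hA : A.PosSemidef) : 0 ≤ A.trace.re :=
  (Complex.nonneg_iff.mp hA.trace_nonneg).1

theorem PosSemidef.ofReal_det_re {A : Matrix n n ℂ} (hA : A.PosSemidef) :
    ((A.det.re : ℝ) : ℂ) = A.det := by
  apply Complex.ext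
  · simp
  · simpa using (Complex.nonneg_iff.mp hA.det_nonneg).2

theorem PosDef.log_det_eq_sum {A : Matrix n n ℂ} (hA : A.PosDef) :
    Real.log A.det.re = ∑ i, Real.log (hA.1.eigenvalues i) := by
  have h : A.det.re = ∏ i, hA.1.eigenvalues i := by
    rw [hA.1.det_eq_prod_eigenvalues]
    simp only [Complex.coe_algebraMap, ← Complex.ofReal_prod, Complex.ofReal_re]
  rw [h, Real.log_prod]
  exact fun i _ => (hA.eigenvalues_pos i).ne'

theorem IsHermitian.trace_re_eq_sum {A : Matrix n n ℂ} (hA : A.IsHermitian) :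
    A.trace.re = ∑ i, hA.eigenvalues i := by
  rw [hA.trace_eq_sum_eigenvalues]
  simp

/-- Apply `log x ≤ x - 1` to each eigenvalue. This inequality drives both halves of the theorem. -/
theorem PosDef.log_det_le_trace_sub {A : Matrix n n ℂ} (hA : A.PosDef) :
    Real.log A.det.re ≤ A.trace.re - Fintype.card n := by
  rw [PosDef.log_det_eq_sum hA, IsHermitian.trace_re_eq_sum hA.1]
  have : (Fintype.card n : ℝ) = ∑ _i : n, (1 : ℝ) := by simp
  rw [this, ← Finset.sum_sub_distrib]
  exact Finset.sum_le_sum fun i _ => Real.log_le_sub_one_of_pos (hA.eigenvalues_pos i)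

theorem PosSemidef.exists_hermitian_sq {A : Matrix n n ℂ} (hA : A.PosSemidef) :
    ∃ S : Matrix n n ℂ, S.PosSemidef ∧ S * S = A :=
  ⟨CFC.sqrt A, Matrix.nonneg_iff_posSemidef.mp (CFC.sqrt_nonneg A),
    CFC.sqrt_mul_sqrt_self A (Matrix.nonneg_iff_posSemidef.mpr hA)⟩

/-- Reduce to the one-matrix inequality for `A^{1/2} B A^{1/2}`, which is Hermitian although `A B`
need not be, and has the determinant and trace of `A B`. -/
theorem PosDef.log_det_add_log_det_le {A B : Matrix n n ℂ} (hA : A.PosDef) (hB : B.PosDef) :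
    Real.log A.det.re + Real.log B.det.re ≤ (A * B).trace.re - Fintype.card n := by
  obtain ⟨S, hS, hSS⟩ := PosSemidef.exists_hermitian_sq hA.posSemidef
  have hdet : S.det * S.det = A.det := by rw [← Matrix.det_mul, hSS]
  have hunit : IsUnit S := by
    rw [Matrix.isUnit_iff_isUnit_det, isUnit_iff_ne_zero]
    intro h0
    rw [h0, zero_mul] at hdet
    exact hA.det_pos.ne hdet
  have hX : (S * B * Sᴴ).PosDef := hB.mul_mul_conjTranspose_same
    (Matrix.vecMul_injective_of_isUnit hunit)
  rw [hS.1.eq] at hX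
  have h1 := PosDef.log_det_le_trace_sub hX
  have h2 : (S * B * S).det = ((A.det.re * B.det.re : ℝ) : ℂ) := by
    rw [Complex.ofReal_mul, PosSemidef.ofReal_det_re hA.posSemidef,
      PosSemidef.ofReal_det_re hB.posSemidef, Matrix.det_mul, Matrix.det_mul, ← hdet]
    ring
  have h3 : (S * B * S).trace = (A * B).trace := by
    rw [Matrix.trace_mul_comm, ← Matrix.mul_assoc, hSS]
  rw [h2, h3, Complex.ofReal_re, Real.log_mul (PosDef.det_re_pos hA).ne'
    (PosDef.det_re_pos hB).ne'] at h1
  exact h1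

theorem PosSemidef.trace_mul_re_nonneg {A B : Matrix n n ℂ} (hA : A.PosSemidef)
    (hB : B.PosSemidef) : 0 ≤ (A * B).trace.re := by
  obtain ⟨S, hS, hSS⟩ := PosSemidef.exists_hermitian_sq hA
  have h := PosSemidef.trace_re_nonneg (hB.mul_mul_conjTranspose_same S)
  rwa [hS.1.eq, Matrix.trace_mul_comm, ← Matrix.mul_assoc, hSS] at h

/-- With `A = S²` and `S` Hermitian, the entries are inner products of columns of `S`, and `2xy ≤ x²
+ y²` bounds them by diagonal entries. -/
theorem PosSemidef.norm_apply_le_trace {A : Matrix n n ℂ} (hA : A.PosSemidef) (i j : n) :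
    ‖A i j‖ ≤ A.trace.re := by
  obtain ⟨S, hS, hSS⟩ := PosSemidef.exists_hermitian_sq hA
  have hsym : ∀ k l, ‖S k l‖ = ‖S l k‖ := fun k l => by
    rw [← hS.1.apply k l, norm_star]
  have hnorm : ∀ k, (A k k).re = ∑ l, ‖S l k‖ ^ 2 := by
    intro k
    rw [← hSS, Matrix.mul_apply, Complex.re_sum]
    refine Finset.sum_congr rfl fun l _ => ?_
    rw [← hS.1.apply k l, ← Complex.normSq_eq_norm_sq]
    simp [Complex.normSq_apply]
  have htr : A.trace.re = ∑ k, (A k k).re := by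
    simp [Matrix.trace, Matrix.diag]
  have hle : ‖A i j‖ ≤ ((A i i).re + (A j j).re) / 2 := by
    rw [hnorm, hnorm, ← Finset.sum_add_distrib, Finset.sum_div, ← hSS, Matrix.mul_apply]
    refine (norm_sum_le _ _).trans (Finset.sum_le_sum fun l _ => ?_)
    rw [norm_mul, hsym i l]
    nlinarith [sq_nonneg (‖S l i‖ - ‖S l j‖)]
  have hd : ∀ k, (A k k).re ≤ A.trace.re := fun k => by
    rw [htr]
    exact Finset.single_le_sum (f := fun k => (A k k).re)
      (fun k _ => (Complex.nonneg_iff.mp hA.diag_nonneg).1) (Finset.mem_univ k)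
  linarith [hd i, hd j]

/-- All terms of the series of `-log (1 - x)` at `x = 1 - y` are nonnegative, so it may be cut after
the second. -/
theorem log_le_sub_one_sub_sq {y : ℝ} (h0 : 0 < y) (h1 : y ≤ 1) :
    Real.log y ≤ (y - 1) - (1 - y) ^ 2 / 2 := by
  have h := Real.hasSum_pow_div_log_of_abs_lt_one (x := 1 - y)
    (by rw [abs_of_nonneg (by linarith)]; linarith)
  have h2 := sum_le_hasSum (Finset.range 2)
    (fun n _ => div_nonneg (pow_nonneg (sub_nonneg.mpr h1) _) (by positivity)) h
  rw [Finset.sum_range_succ, Finset.sum_range_one] at h2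
  norm_num at h2
  linarith

/-- The quadratic gain over `log_det_le_trace_sub` is what later makes `tr α_k α_k†` square
summable. Cauchy–Schwarz passes from the sum of the squares of `1 - y_i`, with `y_i` the
eigenvalues, to the square of their sum, at the cost of the dimension. -/
theorem PosDef.log_det_le_of_le_one {Y : Matrix n n ℂ} (hY : Y.PosDef)
    (h1 : (1 - Y).PosSemidef) :
    Real.log Y.det.re ≤ -(1 - Y).trace.re - (1 - Y).trace.re ^ 2 / (2 * Fintype.card n) := by
  have hle : ∀ i, hY.1.eigenvalues i ≤ 1 := by
    intro i
    have h := h1.re_dotProduct_nonneg (hY.1.eigenvectorBasis i)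
    rw [Matrix.sub_mulVec, Matrix.one_mulVec, dotProduct_sub, map_sub,
      ← hY.1.eigenvalues_eq i] at h
    have h2 : RCLike.re (star (hY.1.eigenvectorBasis i).ofLp ⬝ᵥ (hY.1.eigenvectorBasis i).ofLp)
        = 1 := by
      have := hY.1.eigenvectorBasis.orthonormal.1 i
      rw [EuclideanSpace.norm_eq, Real.sqrt_eq_one] at this
      rw [← this]
      simp [dotProduct, ← Complex.normSq_eq_norm_sq, Complex.normSq_apply]
    linarith
  have htr : (1 - Y).trace.re = ∑ i, (1 - hY.1.eigenvalues i) := by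
    rw [Matrix.trace_sub, Complex.sub_re, IsHermitian.trace_re_eq_sum hY.1]
    simp
  rw [PosDef.log_det_eq_sum hY, htr]
  have hs : ∑ i, Real.log (hY.1.eigenvalues i)
      ≤ -∑ i, (1 - hY.1.eigenvalues i) - (∑ i, (1 - hY.1.eigenvalues i) ^ 2) / 2 := by
    rw [← Finset.sum_neg_distrib, Finset.sum_div, ← Finset.sum_sub_distrib]
    refine Finset.sum_le_sum fun i _ => ?_
    have := log_le_sub_one_sub_sq (hY.eigenvalues_pos i) (hle i)
    linarith
  have hcs : (∑ i, (1 - hY.1.eigenvalues i)) ^ 2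
      ≤ Fintype.card n * ∑ i, (1 - hY.1.eigenvalues i) ^ 2 := by
    simpa using sq_sum_le_card_mul_sum_sq (s := Finset.univ)
      (f := fun i => 1 - hY.1.eigenvalues i)
  have hdiv : (∑ i, (1 - hY.1.eigenvalues i)) ^ 2 / (2 * Fintype.card n)
      ≤ (∑ i, (1 - hY.1.eigenvalues i) ^ 2) / 2 := by
    -- In dimension zero the quotient on the left has the default value `0`.
    rcases Nat.eq_zero_or_pos (Fintype.card n) with h0 | h0
    · rw [h0]; simp; positivity
    · rw [div_le_div_iff₀ (by positivity) (by positivity)]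
      linarith
  linarith

/-- Multiplying by `Y†` and taking traces equates the nonnegative `tr (Y† P Y)` with minus the
nonnegative `tr (Y Q Y†)`, so both vanish. -/
theorem sylvester_eq_zero {P Q Y : Matrix n n ℂ} (hP : P.PosDef) (hQ : Q.PosDef)
    (h : P * Y + Y * Q = 0) : Y = 0 := by
  have h1 : 0 ≤ (Yᴴ * P * Y).trace.re :=
    PosSemidef.trace_re_nonneg (hP.posSemidef.conjTranspose_mul_mul_same Y)
  have h2 : Yᴴ * P * Y = -(Yᴴ * Y * Q) := by
    rw [Matrix.mul_assoc, eq_neg_of_add_eq_zero_left h]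
    simp [Matrix.mul_assoc]
  have h3 : (Y * Q * Yᴴ).trace = (Yᴴ * Y * Q).trace := by
    rw [Matrix.trace_mul_comm, ← Matrix.mul_assoc]
  have hpsd := hQ.posSemidef.mul_mul_conjTranspose_same Y
  have h4 : (Y * Q * Yᴴ).trace = 0 := by
    have h5 := Complex.nonneg_iff.mp hpsd.trace_nonneg
    have h6 : (Yᴴ * P * Y).trace.re = -(Y * Q * Yᴴ).trace.re := by
      rw [h2, h3, Matrix.trace_neg, Complex.neg_re]
    apply Complex.ext
    · simpa using le_antisymm (by linarith) h5.1
    · simpa using h5.2.symm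
  have h5 : Y * Q * Yᴴ = 0 := hpsd.trace_eq_zero_iff.mp h4
  obtain ⟨S, hS, hSS⟩ := PosSemidef.exists_hermitian_sq hQ.posSemidef
  have h6 : (Y * S) * (Y * S)ᴴ = 0 := by
    rw [Matrix.conjTranspose_mul, hS.1.eq, ← h5, ← hSS]
    simp [Matrix.mul_assoc]
  have h7 : Y * S = 0 := Matrix.self_mul_conjTranspose_eq_zero.mp h6
  have h8 : Y * Q = 0 := by rw [← hSS, ← Matrix.mul_assoc, h7, Matrix.zero_mul]
  have := congrArg (· * Q⁻¹) h8
  simpa [Matrix.mul_assoc, Matrix.mul_nonsing_inv Q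
    ((Matrix.isUnit_iff_isUnit_det _).mp hQ.isUnit)] using this

end MatrixInequalities

/-! ### Defect matrices of a contraction. -/

section Defect

variable {p : ℕ} {α : Matrix (Fin p) (Fin p) ℂ}

theorem rhoR_mul_self (h : (1 - α * αᴴ).PosSemidef) : rhoR α * rhoR α = 1 - α * αᴴ :=
  CFC.sqrt_mul_sqrt_self _ (Matrix.nonneg_iff_posSemidef.mpr h)

theorem rhoL_mul_self (h : (1 - αᴴ * α).PosSemidef) : rhoL α * rhoL α = 1 - αᴴ * α :=
  CFC.sqrt_mul_sqrt_self _ (Matrix.nonneg_iff_posSemidef.mpr h)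

theorem rhoR_posSemidef : (rhoR α).PosSemidef :=
  Matrix.nonneg_iff_posSemidef.mp (CFC.sqrt_nonneg _)

theorem rhoL_posSemidef : (rhoL α).PosSemidef :=
  Matrix.nonneg_iff_posSemidef.mp (CFC.sqrt_nonneg _)

theorem rhoR_posDef (h : (1 - α * αᴴ).PosDef) : (rhoR α).PosDef := by
  rw [rhoR_posSemidef.posDef_iff_det_ne_zero]
  intro h0
  have h1 := congrArg Matrix.det (rhoR_mul_self h.posSemidef)
  rw [Matrix.det_mul, h0, zero_mul] at h1
  exact h.det_pos.ne h1

theorem rhoL_posDef (h : (1 - αᴴ * α).PosDef) : (rhoL α).PosDef := by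
  rw [rhoL_posSemidef.posDef_iff_det_ne_zero]
  intro h0
  have h1 := congrArg Matrix.det (rhoL_mul_self h.posSemidef)
  rw [Matrix.det_mul, h0, zero_mul] at h1
  exact h.det_pos.ne h1

/-- The difference `Y` of the two sides solves `ρ^R Y + Y ρ^L = (1 - αα†) α - α (1 - α†α) = 0`, a
Sylvester equation with positive definite coefficients. -/
theorem rhoR_mul_eq (hR : (1 - α * αᴴ).PosDef) (hL : (1 - αᴴ * α).PosDef) :
    rhoR α * α = α * rhoL α := by
  rw [← sub_eq_zero]
  refine sylvester_eq_zero (rhoR_posDef hR) (rhoL_posDef hL) ?_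
  have h1 : rhoR α * (rhoR α * α - α * rhoL α) + (rhoR α * α - α * rhoL α) * rhoL α
      = (rhoR α * rhoR α) * α - α * (rhoL α * rhoL α) := by noncomm_ring
  rw [h1, rhoR_mul_self hR.posSemidef, rhoL_mul_self hL.posSemidef]
  noncomm_ring

end Defect

end MatrixOPUC

end

/-! ## Densities of vector measures -/

noncomputable section

namespace MatrixOPUC

section Densities

variable {X : Type*} [MeasurableSpace X]

theorem integrable_rnDeriv_mul {τ σ : Measure X} [IsFiniteMeasure τ] [IsFiniteMeasure σ]
    {E : Type*} [NormedAddCommGroup E] [NormedSpace ℝ E] {f : X → E} (hf : Integrable f τ) :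
    Integrable (fun x => (τ.rnDeriv σ x).toReal • f x) σ := by
  have h : Integrable f (σ.withDensity (τ.rnDeriv σ)) :=
    hf.mono_measure (Measure.withDensity_rnDeriv_le τ σ)
  rwa [integrable_withDensity_iff_integrable_smul' (Measure.measurable_rnDeriv τ σ)
    (Measure.rnDeriv_lt_top τ σ)] at h

theorem setIntegral_eq_singularPart_add {τ σ : Measure X} [IsFiniteMeasure τ] [IsFiniteMeasure σ]
    {E : Type*} [NormedAddCommGroup E] [NormedSpace ℝ E] {f : X → E} (hf : Integrable f τ)
    {A : Set X} (hA : MeasurableSet A) :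
    ∫ x in A, f x ∂τ = ∫ x in A, f x ∂(τ.singularPart σ)
      + ∫ x in A, (τ.rnDeriv σ x).toReal • f x ∂σ := by
  conv_lhs => rw [τ.haveLebesgueDecomposition_add σ]
  rw [Measure.restrict_add, integral_add_measure]
  · congr 1
    exact setIntegral_withDensity_eq_setIntegral_toReal_smul (Measure.measurable_rnDeriv τ σ)
      (ae_restrict_of_ae (Measure.rnDeriv_lt_top τ σ)) _ hA
  · exact (hf.mono_measure (Measure.singularPart_le τ σ)).integrableOn
  · exact (hf.mono_measure (Measure.withDensity_rnDeriv_le τ σ)).integrableOn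

/-- The Lebesgue decomposition of `τ`, multiplied by `f`, is a Lebesgue decomposition of `s`;
uniqueness does the rest. -/
theorem signedMeasure_rnDeriv_withDensity {τ σ : Measure X} [IsFiniteMeasure τ]
    [IsFiniteMeasure σ] {f : X → ℝ} (hf : Integrable f τ) {s : SignedMeasure X}
    (hs : s = τ.withDensityᵥ f) :
    s.rnDeriv σ =ᵐ[σ] fun x => (τ.rnDeriv σ x).toReal * f x := by
  have hfs : Integrable f (τ.singularPart σ) := hf.mono_measure (Measure.singularPart_le τ σ)
  have hfr := integrable_rnDeriv_mul (σ := σ) hf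
  refine (SignedMeasure.eq_rnDeriv ((τ.singularPart σ).withDensityᵥ f) _ hfr ?_ ?_).symm
  · obtain ⟨S, hS, h1, h2⟩ := Measure.mutuallySingular_singularPart τ σ
    refine VectorMeasure.MutuallySingular.mk S hS (fun t ht hmt => ?_) (fun t ht hmt => ?_)
    · rw [withDensityᵥ_apply hfs hmt]
      exact setIntegral_measure_zero _ (measure_mono_null ht h1)
    · rw [Measure.toENNRealVectorMeasure_apply_measurable hmt]
      exact measure_mono_null ht h2
  · rw [hs]
    ext A hA
    rw [add_apply, withDensityᵥ_apply hf hA, withDensityᵥ_apply hfs hA,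
      withDensityᵥ_apply hfr hA]
    exact setIntegral_eq_singularPart_add hf hA

theorem complexMeasure_re_apply (c : ComplexMeasure X) (A : Set X) :
    ComplexMeasure.re c A = (c A).re := rfl

theorem complexMeasure_im_apply (c : ComplexMeasure X) (A : Set X) :
    ComplexMeasure.im c A = (c A).im := rfl

theorem complexMeasure_re_withDensity {τ : Measure X} {f : X → ℂ} (hf : Integrable f τ) :
    ComplexMeasure.re (τ.withDensityᵥ f) = τ.withDensityᵥ fun x => (f x).re := by
  ext A hA
  rw [complexMeasure_re_apply, withDensityᵥ_apply hf hA]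
  exact (integral_re hf.integrableOn).symm.trans (withDensityᵥ_apply hf.re hA).symm

theorem complexMeasure_im_withDensity {τ : Measure X} {f : X → ℂ} (hf : Integrable f τ) :
    ComplexMeasure.im (τ.withDensityᵥ f) = τ.withDensityᵥ fun x => (f x).im := by
  ext A hA
  rw [complexMeasure_im_apply, withDensityᵥ_apply hf hA]
  exact (integral_im hf.integrableOn).symm.trans (withDensityᵥ_apply hf.im hA).symm

theorem complexMeasure_rnDeriv_withDensity {τ σ : Measure X} [IsFiniteMeasure τ]
    [IsFiniteMeasure σ] {f : X → ℂ} (hf : Integrable f τ) {c : ComplexMeasure X}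
    (hc : c = τ.withDensityᵥ f) :
    c.rnDeriv σ =ᵐ[σ] fun x => (τ.rnDeriv σ x).toReal * f x := by
  have h1 := signedMeasure_rnDeriv_withDensity (σ := σ) hf.re
    (s := ComplexMeasure.re c) (by rw [hc]; exact complexMeasure_re_withDensity hf)
  have h2 := signedMeasure_rnDeriv_withDensity (σ := σ) hf.im
    (s := ComplexMeasure.im c) (by rw [hc]; exact complexMeasure_im_withDensity hf)
  filter_upwards [h1, h2] with x hx1 hx2
  apply Complex.ext
  · simpa [ComplexMeasure.rnDeriv] using hx1
  · simpa [ComplexMeasure.rnDeriv] using hx2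

/-- Domination by `τ` makes the real and imaginary parts absolutely continuous, so neither has a
singular part. -/
theorem withDensity_rnDeriv_of_norm_le {τ : Measure X} [IsFiniteMeasure τ] {c : ComplexMeasure X}
    (hc : ∀ A, MeasurableSet A → ‖c A‖ ≤ τ.real A) : c = τ.withDensityᵥ (c.rnDeriv τ) := by
  have hzero : ∀ A, MeasurableSet A → τ.toENNRealVectorMeasure A = 0 → c A = 0 := by
    intro A hA h0
    rw [Measure.toENNRealVectorMeasure_apply_measurable hA] at h0
    have := hc A hA
    rw [measureReal_def, h0] at this
    simpa using this
  have hre : ComplexMeasure.re c ≪ᵥ τ.toENNRealVectorMeasure :=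
    VectorMeasure.AbsolutelyContinuous.mk fun A hA h0 => by
      rw [complexMeasure_re_apply, hzero A hA h0, Complex.zero_re]
  have him : ComplexMeasure.im c ≪ᵥ τ.toENNRealVectorMeasure :=
    VectorMeasure.AbsolutelyContinuous.mk fun A hA h0 => by
      rw [complexMeasure_im_apply, hzero A hA h0, Complex.zero_im]
  rw [SignedMeasure.absolutelyContinuous_iff_withDensityᵥ_rnDeriv_eq] at hre him
  have hi := ComplexMeasure.integrable_rnDeriv c τ
  refine ComplexMeasure.equivSignedMeasure.injective (Prod.ext ?_ ?_)
  · exact hre.symm.trans (complexMeasure_re_withDensity hi).symm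
  · exact him.symm.trans (complexMeasure_im_withDensity hi).symm

/-- The bound on `m` puts the variation of `c` below `τ`, so the vector integral is a continuous
functional on `L¹(τ)`. It agrees with the right-hand side on indicators, hence everywhere. This
turns the integrals in the matrix inner products into ordinary ones. -/
theorem vectorMeasure_integral_eq {τ : Measure X} [IsFiniteMeasure τ] {c : ComplexMeasure X}
    {m : X → ℂ} (hm : Measurable m) (hm1 : ∀ x, ‖m x‖ ≤ 1) (hc : c = τ.withDensityᵥ m)
    {h : X → ℂ} (hh : Integrable h τ) :
    c.integral h (ContinuousLinearMap.mul ℝ ℂ) = ∫ x, h x * m x ∂τ := by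
  have hmi : Integrable m τ :=
    (integrable_const (1 : ℝ)).mono' hm.aestronglyMeasurable (ae_of_all _ hm1)
  have hmul : ∀ {f : X → ℂ}, Integrable f τ → Integrable (fun x => f x * m x) τ := fun hf =>
    hf.mul_bdd (c := 1) hm.aestronglyMeasurable (ae_of_all _ hm1)
  have hvar : c.variation ≤ τ := by
    refine VectorMeasure.variation_le_of_forall_enorm_le fun A hA => ?_
    rw [hc, withDensityᵥ_apply hmi hA]
    refine (enorm_integral_le_lintegral_enorm _).trans ?_
    calc ∫⁻ x in A, ‖m x‖ₑ ∂τ ≤ ∫⁻ _ in A, 1 ∂τ := by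
          refine lintegral_mono fun x => ?_
          rw [← ofReal_norm]
          exact ENNReal.ofReal_le_one.mpr (hm1 x)
      _ = τ A := by simp
  have hT := dominatedFinMeasAdditive_cbmApplyMeasure c (ContinuousLinearMap.mul ℝ ℂ)
  have hT' := hT.of_measure_le hvar (norm_nonneg (ContinuousLinearMap.mul ℝ ℂ))
  have hswap : ∀ f : X → ℂ, Integrable f τ → c.integral f (ContinuousLinearMap.mul ℝ ℂ)
      = setToFun τ (c.transpose (ContinuousLinearMap.mul ℝ ℂ)) hT' f := fun f hf =>
    (setToFun_congr_measure_of_integrable 1 (by simp) (by simpa using hvar) hT' hT f hf).symm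
  rw [hswap h hh]
  refine hh.induction (P := fun f => setToFun τ (c.transpose (ContinuousLinearMap.mul ℝ ℂ)) hT' f
    = ∫ x, f x * m x ∂τ) ?_ ?_ ?_ ?_
  · intro a s hs hsf
    rw [setToFun_indicator_const hT' hs hsf.ne]
    change a * c s = _
    rw [hc, withDensityᵥ_apply hmi hs, ← integral_const_mul, ← integral_indicator hs]
    congr 1
    ext x
    by_cases hx : x ∈ s <;> simp [hx]
  · intro f g _ hf hg hf' hg'
    rw [setToFun_add hT' hf hg, hf', hg']
    simp only [Pi.add_apply, add_mul]
    rw [integral_add (hmul hf) (hmul hg)]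
  · refine isClosed_eq (continuous_setToFun hT') ?_
    have hlip : LipschitzWith 1 fun f : X →₁[τ] ℂ => ∫ x, f x * m x ∂τ := by
      intro f g
      rw [edist_eq_enorm_sub, ← integral_sub (hmul (L1.integrable_coeFn f))
        (hmul (L1.integrable_coeFn g)), L1.edist_def, ENNReal.coe_one, one_mul]
      refine (enorm_integral_le_lintegral_enorm _).trans (lintegral_mono fun x => ?_)
      rw [← sub_mul, enorm_mul, edist_eq_enorm_sub]
      refine mul_le_of_le_one_right' ?_
      rw [← ofReal_norm]
      exact ENNReal.ofReal_le_one.mpr (hm1 x)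
    exact hlip.continuous
  · intro f g hfg hf hP
    rw [← setToFun_congr_ae hT' hfg, hP]
    exact integral_congr_ae (hfg.mono fun x hx => by simp only [hx])

end Densities

end MatrixOPUC

end

/-! ## The density of a matrix measure with respect to its trace -/

noncomputable section

namespace MatrixOPUC

variable {p : ℕ}

/-- `dμ = M dτ` with a finite measure `τ` and a bounded measurable positive semidefinite `M`. -/
structure MatrixMeasure.IsDensity (μ : MatrixMeasure p) (τ : Measure Torus)
    (M : Torus → Matrix (Fin p) (Fin p) ℂ) : Prop where
  finite : IsFiniteMeasure τ
  measurable : ∀ i j, Measurable fun θ => M θ i j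
  posSemidef : ∀ θ, (M θ).PosSemidef
  norm_le : ∀ θ i j, ‖M θ i j‖ ≤ 1
  eq_withDensity : ∀ i j, μ.entry i j = τ.withDensityᵥ fun θ => M θ i j

namespace MatrixMeasure

/-- The scalar trace measure of a matrix measure. -/
def traceMeasure (μ : MatrixMeasure p) : Measure Torus :=
  ∑ i, (ComplexMeasure.re (μ.entry i i)).toMeasureOfZeroLE Set.univ MeasurableSet.univ
    (VectorMeasure.restrict_le_restrict_of_subset_le _ _ fun A hA _ => by
      have h := (μ.posSemidef A hA).diag_nonneg (i := i)
      exact (Complex.nonneg_iff.mp h).1)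

instance (μ : MatrixMeasure p) : IsFiniteMeasure μ.traceMeasure := by
  unfold traceMeasure
  infer_instance

theorem traceMeasure_real_apply (μ : MatrixMeasure p) {A : Set Torus} (hA : MeasurableSet A) :
    μ.traceMeasure.real A = (Matrix.of fun i j => μ.entry i j A).trace.re := by
  simp only [traceMeasure, measureReal_def, Measure.finsetSum_apply]
  rw [ENNReal.toReal_sum (fun i _ => measure_ne_top _ _)]
  simp only [Matrix.trace, Matrix.diag, Matrix.of_apply, Complex.re_sum]
  refine Finset.sum_congr rfl fun i _ => ?_
  rw [← measureReal_def, SignedMeasure.toMeasureOfZeroLE_real_apply _ _ _ hA, Set.univ_inter,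
    complexMeasure_re_apply]

theorem norm_entry_le (μ : MatrixMeasure p) (i j : Fin p) {A : Set Torus} (hA : MeasurableSet A) :
    ‖μ.entry i j A‖ ≤ μ.traceMeasure.real A := by
  rw [traceMeasure_real_apply μ hA]
  exact PosSemidef.norm_apply_le_trace (μ.posSemidef A hA) i j

theorem measurable_complex_rnDeriv (c : ComplexMeasure Torus) (τ : Measure Torus) :
    Measurable (c.rnDeriv τ) :=
  _root_.measurable_of_re_im (𝕜 := ℂ) (SignedMeasure.measurable_rnDeriv _ _)
    (SignedMeasure.measurable_rnDeriv _ _)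

/-- Hermitian symmetry, and nonnegativity of the quadratic form at a fixed vector, hold almost
everywhere because they hold after integration over every set. A countable dense set of vectors
gives one null set for all vectors. -/
theorem ae_posSemidef_density (μ : MatrixMeasure p) :
    ∀ᵐ θ ∂μ.traceMeasure, (μ.density μ.traceMeasure θ).PosSemidef := by
  set τ := μ.traceMeasure
  have hint : ∀ i j, Integrable (fun θ => μ.density τ θ i j) τ := fun i j =>
    ComplexMeasure.integrable_rnDeriv _ _
  have heq : ∀ i j, μ.entry i j = τ.withDensityᵥ fun θ => μ.density τ θ i j := fun i j =>
    withDensity_rnDeriv_of_norm_le fun A hA => μ.norm_entry_le i j hA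
  have hset : ∀ i j A, MeasurableSet A → ∫ θ in A, μ.density τ θ i j ∂τ = μ.entry i j A := by
    intro i j A hA
    conv_rhs => rw [heq]
    rw [withDensityᵥ_apply (hint i j) hA]
  have hherm : ∀ i j, ∀ᵐ θ ∂τ, star (μ.density τ θ j i) = μ.density τ θ i j := by
    intro i j
    refine Integrable.ae_eq_of_forall_setIntegral_eq _ _ ?_ (hint i j) fun A hA _ => ?_
    · exact (Complex.conjLIE.integrable_comp_iff).mpr (hint j i)
    · rw [hset i j A hA]
      have h1 := integral_conj (μ := τ.restrict A) (f := fun θ => μ.density τ θ j i)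
      rw [hset j i A hA] at h1
      refine h1.trans ?_
      exact (μ.posSemidef A hA).1.apply i j
  have hquad : ∀ v : Fin p → ℂ, ∀ᵐ θ ∂τ, 0 ≤ (star v ⬝ᵥ (μ.density τ θ *ᵥ v)).re := by
    intro v
    have hexp : ∀ B : Matrix (Fin p) (Fin p) ℂ, star v ⬝ᵥ (B *ᵥ v)
        = ∑ i, ∑ j, (star (v i) * v j) * B i j := by
      intro B
      simp only [dotProduct, Matrix.mulVec, Finset.mul_sum, Pi.star_apply]
      exact Finset.sum_congr rfl fun i _ => Finset.sum_congr rfl fun j _ => by ring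
    have hvi : Integrable (fun θ => star v ⬝ᵥ (μ.density τ θ *ᵥ v)) τ := by
      simp only [hexp]
      exact integrable_finsetSum _ fun i _ => integrable_finsetSum _ fun j _ =>
        (hint i j).const_mul _
    refine ae_nonneg_of_forall_setIntegral_nonneg hvi.re fun A hA _ => ?_
    have h1 : ∫ θ in A, star v ⬝ᵥ (μ.density τ θ *ᵥ v) ∂τ
        = star v ⬝ᵥ ((Matrix.of fun i j => μ.entry i j A) *ᵥ v) := by
      simp only [hexp]
      rw [integral_finsetSum _ fun i _ => (integrable_finsetSum _ fun j _ =>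
        (hint i j).const_mul _).integrableOn]
      refine Finset.sum_congr rfl fun i _ => ?_
      rw [integral_finsetSum _ fun j _ => ((hint i j).const_mul _).integrableOn]
      refine Finset.sum_congr rfl fun j _ => ?_
      rw [integral_const_mul, hset i j A hA, Matrix.of_apply]
    have h2 := (μ.posSemidef A hA).re_dotProduct_nonneg v
    rw [← h1] at h2
    exact h2.trans_eq (integral_re hvi.integrableOn).symm
  have hall : ∀ᵐ θ ∂τ, ∀ k : ℕ, 0 ≤ (star (TopologicalSpace.denseSeq (Fin p → ℂ) k) ⬝ᵥ
      (μ.density τ θ *ᵥ TopologicalSpace.denseSeq (Fin p → ℂ) k)).re :=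
    ae_all_iff.mpr fun k => hquad _
  filter_upwards [hall, ae_all_iff.mpr fun i => ae_all_iff.mpr fun j => hherm i j] with θ h1 h2
  have hH : (μ.density τ θ).IsHermitian := by
    ext i j
    exact h2 i j
  refine Matrix.PosSemidef.of_dotProduct_mulVec_nonneg hH fun v => ?_
  have hre : 0 ≤ (star v ⬝ᵥ (μ.density τ θ *ᵥ v)).re := by
    refine (TopologicalSpace.denseRange_denseSeq (Fin p → ℂ)).induction_on
      (p := fun v => 0 ≤ (star v ⬝ᵥ (μ.density τ θ *ᵥ v)).re) v ?_ h1
    refine isClosed_le continuous_const (Complex.continuous_re.comp ?_)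
    fun_prop
  refine Complex.nonneg_iff.mpr ⟨hre, ?_⟩
  exact (hH.im_star_dotProduct_mulVec_self v).symm

/-- Relative to the trace measure the density has trace one almost everywhere, which bounds its
entries by one. -/
theorem exists_isDensity (μ : MatrixMeasure p) :
    ∃ (τ : Measure Torus) (M : Torus → Matrix (Fin p) (Fin p) ℂ), μ.IsDensity τ M := by
  classical
  set τ := μ.traceMeasure with hτ
  have hint : ∀ i j, Integrable (fun θ => μ.density τ θ i j) τ := fun i j =>
    ComplexMeasure.integrable_rnDeriv _ _
  have heq : ∀ i j, μ.entry i j = τ.withDensityᵥ fun θ => μ.density τ θ i j := fun i j =>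
    withDensity_rnDeriv_of_norm_le fun A hA => μ.norm_entry_le i j hA
  have htr : ∀ᵐ θ ∂τ, (μ.density τ θ).trace = 1 := by
    refine Integrable.ae_eq_of_forall_setIntegral_eq _ _ ?_ (integrable_const 1) fun A hA _ => ?_
    · exact integrable_finsetSum _ fun i _ => hint i i
    · simp only [Matrix.trace, Matrix.diag]
      rw [integral_finsetSum _ fun i _ => (hint i i).integrableOn]
      have h1 : ∀ i, ∫ θ in A, μ.density τ θ i i ∂τ = ((μ.entry i i A).re : ℂ) := by
        intro i
        rw [← withDensityᵥ_apply (hint i i) hA, ← heq]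
        have := (Complex.nonneg_iff.mp ((μ.posSemidef A hA).diag_nonneg (i := i))).2
        apply Complex.ext
        · simp
        · simpa using this.symm
      simp only [h1]
      rw [← Complex.ofReal_sum, setIntegral_const, Complex.real_smul, mul_one, hτ,
        traceMeasure_real_apply μ hA]
      simp [Matrix.trace, Matrix.diag]
  -- Despite its name, `good` is the exceptional set: a measurable null set containing all points
  -- where the density is not positive semidefinite of trace one. The density is replaced by `0`
  -- there, so that the required properties hold at every point.
  set good : Set Torus := toMeasurable τ
    {θ | ¬ ((μ.density τ θ).PosSemidef ∧ (μ.density τ θ).trace = 1)} with hgood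
  have hnull : τ good = 0 := by
    rw [hgood, measure_toMeasurable]
    exact (μ.ae_posSemidef_density).and htr
  have hmem : ∀ θ, θ ∉ good → (μ.density τ θ).PosSemidef ∧ (μ.density τ θ).trace = 1 := by
    intro θ hθ
    by_contra h
    exact hθ (subset_toMeasurable _ _ h)
  refine ⟨τ, fun θ => if θ ∈ good then 0 else μ.density τ θ, inferInstance, ?_, ?_, ?_, ?_⟩
  · intro i j
    have : (fun θ => (if θ ∈ good then 0 else μ.density τ θ : Matrix (Fin p) (Fin p) ℂ) i j)
        = fun θ => if θ ∈ good then 0 else μ.density τ θ i j := by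
      ext θ
      split_ifs <;> rfl
    rw [this]
    exact Measurable.ite (measurableSet_toMeasurable _ _) measurable_const
      (measurable_complex_rnDeriv _ _)
  · intro θ
    by_cases h : θ ∈ good
    · simp only [h, if_true]
      exact Matrix.PosSemidef.zero
    · simp only [h, if_false]
      exact (hmem θ h).1
  · intro θ i j
    by_cases h : θ ∈ good
    · simp [h]
    · simp only [h, if_false]
      refine (PosSemidef.norm_apply_le_trace (hmem θ h).1 i j).trans ?_
      rw [(hmem θ h).2]
      simp
  · intro i j
    rw [heq]
    refine WithDensityᵥEq.congr_ae ?_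
    filter_upwards [measure_eq_zero_iff_ae_notMem.mp hnull] with θ hθ
    simp [hθ]

end MatrixMeasure

end MatrixOPUC

end

/-! ## Values of matrix polynomials and matrix integrals -/

noncomputable section

namespace MatrixOPUC

/-- Complex `p × p` matrices. -/
abbrev Mat (p : ℕ) : Type := Matrix (Fin p) (Fin p) ℂ

variable {p : ℕ}

section Eval

theorem continuous_expi : Continuous expi := by
  unfold expi
  exact continuous_subtype_val.comp AddCircle.continuous_toCircle

theorem norm_expi (θ : Torus) : ‖expi θ‖ = 1 := by
  unfold expi
  exact Circle.norm_coe _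

theorem expi_ne_zero (θ : Torus) : expi θ ≠ 0 := by
  intro h
  have := norm_expi θ
  rw [h, norm_zero] at this
  exact zero_ne_one this

theorem star_expi (θ : Torus) : star (expi θ) = (expi θ)⁻¹ := by
  rw [Complex.inv_def, Complex.normSq_eq_norm_sq, norm_expi]
  simp

theorem mul_scalar_eq_smul (A : Mat p) (c : ℂ) : A * Matrix.scalar (Fin p) c = c • A :=
  (Matrix.smul_eq_mul_diagonal A c).symm

theorem scalar_mul_eq_smul (A : Mat p) (c : ℂ) : Matrix.scalar (Fin p) c * A = c • A :=
  (Matrix.smul_eq_diagonal_mul A c).symm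

theorem evalT_eq_sum (f : (Mat p)[X]) {k : ℕ} (hf : f.natDegree ≤ k) (θ : Torus) :
    evalT f θ = ∑ j ∈ Finset.range (k + 1), expi θ ^ j • f.coeff j := by
  unfold evalT
  rw [eval_eq_sum_range' (Nat.lt_succ_of_le hf)]
  refine Finset.sum_congr rfl fun j _ => ?_
  rw [← map_pow, mul_scalar_eq_smul]

theorem continuous_evalT (f : (Mat p)[X]) : Continuous (evalT f) := by
  have : evalT f = fun θ => ∑ j ∈ Finset.range (f.natDegree + 1), expi θ ^ j • f.coeff j :=
    funext fun θ => evalT_eq_sum f le_rfl θ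
  rw [this]
  exact continuous_finsetSum _ fun j _ => (continuous_expi.pow j).smul continuous_const

/-- Scalar matrices are central, so evaluation is multiplicative although the coefficients do not
commute. -/
theorem evalT_mul (f g : (Mat p)[X]) (θ : Torus) : evalT (f * g) θ = evalT f θ * evalT g θ := by
  unfold evalT
  rw [eval, eval₂_mul_noncomm]
  · rfl
  · intro k
    exact (Matrix.scalar_commute _ (fun r => Commute.all _ _) _).symm

@[simp] theorem evalT_C (A : Mat p) (θ : Torus) : evalT (C A) θ = A := eval_C

@[simp] theorem evalT_one (θ : Torus) : evalT (1 : (Mat p)[X]) θ = 1 := eval_one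

theorem evalT_add (f g : (Mat p)[X]) (θ : Torus) : evalT (f + g) θ = evalT f θ + evalT g θ :=
  eval_add

theorem evalT_sub (f g : (Mat p)[X]) (θ : Torus) : evalT (f - g) θ = evalT f θ - evalT g θ :=
  eval_sub _ _ _

theorem evalT_X_mul (f : (Mat p)[X]) (θ : Torus) : evalT (X * f) θ = expi θ • evalT f θ := by
  rw [evalT_mul]
  unfold evalT
  rw [eval_X, scalar_mul_eq_smul]

theorem evalT_X_pow_mul (k : ℕ) (f : (Mat p)[X]) (θ : Torus) :
    evalT (X ^ k * f) θ = expi θ ^ k • evalT f θ := by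
  induction k with
  | zero => simp
  | succ k ih => rw [pow_succ', mul_assoc, evalT_X_mul, ih, smul_smul, pow_succ']

/-- On the circle `1 / conj z = z`. The duality between right and left objects rests on this
description of reversal as an adjoint up to a unimodular factor. -/
theorem evalT_rev {k : ℕ} {f : (Mat p)[X]} (hf : f.natDegree ≤ k) (θ : Torus) :
    evalT (rev k f) θ = expi θ ^ k • (evalT f θ)ᴴ := by
  rw [evalT_eq_sum f hf, Matrix.conjTranspose_sum, Finset.smul_sum]
  unfold rev evalT
  rw [eval_finsetSum]
  refine Finset.sum_congr rfl fun j hj => ?_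
  have hjk : j ≤ k := Nat.lt_succ_iff.mp (Finset.mem_range.mp hj)
  rw [eval_monomial, ← map_pow, mul_scalar_eq_smul,
    Matrix.conjTranspose_smul, smul_smul, star_pow, star_expi]
  congr 1
  rw [inv_pow, ← div_eq_mul_inv, eq_div_iff (pow_ne_zero _ (expi_ne_zero θ)), ← pow_add,
    Nat.sub_add_cancel hjk]

end Eval

section Rev

theorem coeff_rev {k : ℕ} (f : (Mat p)[X]) (j : ℕ) :
    (rev k f).coeff j = if j ≤ k then (f.coeff (k - j))ᴴ else 0 := by
  unfold rev
  rw [finsetSum_coeff]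
  simp only [coeff_monomial]
  split_ifs with h
  · rw [Finset.sum_eq_single (k - j)]
    · rw [if_pos (by omega)]
    · intro i hi hne
      have := Finset.mem_range.mp hi
      rw [if_neg (by omega)]
    · intro hn
      exact absurd (Finset.mem_range.mpr (by omega)) hn
  · refine Finset.sum_eq_zero fun i hi => ?_
    rw [if_neg (by omega)]

theorem natDegree_rev_le (k : ℕ) (f : (Mat p)[X]) : (rev k f).natDegree ≤ k := by
  rw [natDegree_le_iff_coeff_eq_zero]
  intro j hj
  rw [coeff_rev, if_neg (by omega)]

theorem rev_rev {k : ℕ} {f : (Mat p)[X]} (hf : f.natDegree ≤ k) : rev k (rev k f) = f := by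
  ext1 j
  rw [coeff_rev]
  split_ifs with h
  · rw [coeff_rev, if_pos (by omega), Matrix.conjTranspose_conjTranspose]
    congr 1
    omega
  · rw [coeff_eq_zero_of_natDegree_lt (by omega)]

theorem rev_X_pow {k j : ℕ} (h : j ≤ k) : rev k (X ^ j : (Mat p)[X]) = X ^ (k - j) := by
  ext1 i
  rw [coeff_rev, coeff_X_pow, coeff_X_pow]
  by_cases hi : i ≤ k
  · rw [if_pos hi]
    by_cases h2 : k - i = j
    · rw [if_pos h2, if_pos (by omega), Matrix.conjTranspose_one]
    · rw [if_neg h2, if_neg (by omega), Matrix.conjTranspose_zero]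
  · rw [if_neg hi, if_neg (by omega)]

end Rev

/-! ### Integrals of matrix functions. -/

section MatrixIntegral

open scoped Matrix.Norms.L2Operator

theorem integrable_matrix {τ : Measure Torus} {F : Torus → Mat p}
    (h : ∀ i j, Integrable (fun θ => F θ i j) τ) : Integrable F τ := by
  have : F = fun θ => ∑ i, ∑ j, F θ i j • Matrix.single i j (1 : ℂ) := by
    funext θ
    conv_lhs => rw [Matrix.matrix_eq_sum_single (F θ)]
    simp [Matrix.smul_single]
  rw [this]
  exact integrable_finsetSum _ fun i _ => integrable_finsetSum _ fun j _ => (h i j).smul_const _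

theorem Integrable.matrix_apply {τ : Measure Torus} {F : Torus → Mat p} (h : Integrable F τ)
    (i j : Fin p) : Integrable (fun θ => F θ i j) τ :=
  ((Matrix.entryLinearMap ℂ ℂ i j).toContinuousLinearMap : Mat p →L[ℂ] ℂ).integrable_comp h

theorem integral_matrix_apply {τ : Measure Torus} {F : Torus → Mat p} (h : Integrable F τ)
    (i j : Fin p) : (∫ θ, F θ ∂τ) i j = ∫ θ, F θ i j ∂τ :=
  (((Matrix.entryLinearMap ℂ ℂ i j).toContinuousLinearMap : Mat p →L[ℂ] ℂ).integral_comp_comm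
    h).symm

theorem integral_matrix_conjTranspose {τ : Measure Torus} {F : Torus → Mat p}
    (h : Integrable F τ) : (∫ θ, F θ ∂τ)ᴴ = ∫ θ, (F θ)ᴴ ∂τ := by
  have h2 : Integrable (fun θ => (F θ)ᴴ) τ := integrable_matrix fun i j =>
    (Complex.conjLIE.integrable_comp_iff).mpr (Integrable.matrix_apply h j i)
  ext i j
  rw [integral_matrix_apply h2, Matrix.conjTranspose_apply, integral_matrix_apply h]
  exact (integral_conj).symm

theorem integral_matrix_trace {τ : Measure Torus} {F : Torus → Mat p}
    (h : Integrable F τ) : (∫ θ, F θ ∂τ).trace = ∫ θ, (F θ).trace ∂τ := by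
  simp only [Matrix.trace, Matrix.diag, integral_matrix_apply h]
  rw [integral_finsetSum _ fun i _ => Integrable.matrix_apply h i i]

/-- The quadratic form at `v` is a trace against a rank-one matrix and therefore commutes with the
integral. -/
theorem posSemidef_integral {τ : Measure Torus} {F : Torus → Mat p} (h : Integrable F τ)
    (hF : ∀ θ, (F θ).PosSemidef) : (∫ θ, F θ ∂τ).PosSemidef := by
  have hH : (∫ θ, F θ ∂τ).IsHermitian := by
    rw [Matrix.IsHermitian, integral_matrix_conjTranspose h]
    simp only [(hF _).1.eq]
  refine Matrix.PosSemidef.of_dotProduct_mulVec_nonneg hH fun v => ?_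
  refine Complex.nonneg_iff.mpr ⟨?_, (hH.im_star_dotProduct_mulVec_self v).symm⟩
  have hlin : ∀ A : Mat p, star v ⬝ᵥ A *ᵥ v = (A * Matrix.vecMulVec v (star v)).trace := by
    intro A
    rw [Matrix.mul_vecMulVec, Matrix.trace_vecMulVec, dotProduct_comm]
  rw [hlin, ← integral_mul_const_of_integrable h,
    integral_matrix_trace (h.mul_const _)]
  have : Integrable (fun θ => (F θ * Matrix.vecMulVec v (star v)).trace) τ :=
    integrable_finsetSum _ fun i _ => Integrable.matrix_apply (h.mul_const _) i i
  refine le_of_le_of_eq ?_ (integral_re this)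
  refine integral_nonneg fun θ => ?_
  change 0 ≤ ((F θ * Matrix.vecMulVec v (star v)).trace).re
  rw [← hlin]
  exact (hF θ).re_dotProduct_nonneg v

end MatrixIntegral

end MatrixOPUC

end

/-! ## The matrix inner products -/

noncomputable section

namespace MatrixOPUC

variable {p : ℕ}

section Integration

open scoped Matrix.Norms.L2Operator

variable {μ : MatrixMeasure p} {τ : Measure Torus} {M : Torus → Mat p}

theorem Continuous.integrable_torus {E : Type*} [NormedAddCommGroup E] {f : Torus → E}
    (hf : Continuous f) (τ : Measure Torus) [IsFiniteMeasure τ] : Integrable f τ :=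
  hf.integrable_of_hasCompactSupport (HasCompactSupport.of_compactSpace f)

theorem Continuous.matrix_apply {F : Torus → Mat p} (hF : Continuous F) (i j : Fin p) :
    Continuous fun θ => F θ i j :=
  (continuous_apply_apply i j).comp hF

namespace MatrixMeasure.IsDensity

theorem integrable_mul_entry (h : μ.IsDensity τ M) {f : Torus → ℂ} (hf : Integrable f τ)
    (k l : Fin p) : Integrable (fun θ => f θ * M θ k l) τ :=
  hf.mul_bdd (c := 1) (h.measurable k l).aestronglyMeasurable
    (ae_of_all _ fun θ => h.norm_le θ k l)

theorem integralEntry_eq (h : μ.IsDensity τ M) {f : Torus → ℂ} (hf : Integrable f τ)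
    (k l : Fin p) : μ.integralEntry k l f = ∫ θ, f θ * M θ k l ∂τ :=
  have := h.finite
  vectorMeasure_integral_eq (h.measurable k l) (fun θ => h.norm_le θ k l)
    (h.eq_withDensity k l) hf

theorem mul_mul_apply (F A G : Mat p) (i j : Fin p) :
    (F * A * G) i j = ∑ k, ∑ l, F i k * G l j * A k l := by
  simp only [Matrix.mul_apply, Finset.sum_mul]
  rw [Finset.sum_comm]
  exact Finset.sum_congr rfl fun k _ => Finset.sum_congr rfl fun l _ => by ring

theorem integrable (h : μ.IsDensity τ M) {F G : Torus → Mat p} (hF : Continuous F)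
    (hG : Continuous G) : Integrable (fun θ => F θ * M θ * G θ) τ := by
  have := h.finite
  refine integrable_matrix fun i j => ?_
  simp only [mul_mul_apply]
  exact integrable_finsetSum _ fun k _ => integrable_finsetSum _ fun l _ =>
    h.integrable_mul_entry (Continuous.integrable_torus
      ((Continuous.matrix_apply hF i k).mul (Continuous.matrix_apply hG l j)) τ) k l

theorem sum_integralEntry_eq (h : μ.IsDensity τ M) {F G : Torus → Mat p} (hF : Continuous F)
    (hG : Continuous G) :
    (Matrix.of fun i j => ∑ k, ∑ l, μ.integralEntry k l fun θ => F θ i k * G θ l j)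
      = ∫ θ, F θ * M θ * G θ ∂τ := by
  have := h.finite
  have hi : ∀ i j k l, Integrable (fun θ => F θ i k * G θ l j) τ := fun i j k l =>
    Continuous.integrable_torus
      ((Continuous.matrix_apply hF i k).mul (Continuous.matrix_apply hG l j)) τ
  ext i j
  rw [integral_matrix_apply (h.integrable hF hG), Matrix.of_apply]
  simp only [mul_mul_apply]
  rw [integral_finsetSum _ fun k _ => integrable_finsetSum _ fun l _ =>
    h.integrable_mul_entry (hi i j k l) k l]
  refine Finset.sum_congr rfl fun k _ => ?_
  rw [integral_finsetSum _ fun l _ => h.integrable_mul_entry (hi i j k l) k l]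
  exact Finset.sum_congr rfl fun l _ => h.integralEntry_eq (hi i j k l) k l

theorem innerR_eq (h : μ.IsDensity τ M) (f g : (Mat p)[X]) :
    μ.innerR f g = ∫ θ, (evalT f θ)ᴴ * M θ * evalT g θ ∂τ :=
  h.sum_integralEntry_eq (continuous_evalT f).matrix_conjTranspose (continuous_evalT g)

theorem innerL_eq (h : μ.IsDensity τ M) (f g : (Mat p)[X]) :
    μ.innerL f g = ∫ θ, evalT g θ * M θ * (evalT f θ)ᴴ ∂τ :=
  h.sum_integralEntry_eq (continuous_evalT g) (continuous_evalT f).matrix_conjTranspose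

theorem integrable_innerR (h : μ.IsDensity τ M) (f g : (Mat p)[X]) :
    Integrable (fun θ => (evalT f θ)ᴴ * M θ * evalT g θ) τ :=
  h.integrable (continuous_evalT f).matrix_conjTranspose (continuous_evalT g)

theorem integrable_innerL (h : μ.IsDensity τ M) (f g : (Mat p)[X]) :
    Integrable (fun θ => evalT g θ * M θ * (evalT f θ)ᴴ) τ :=
  h.integrable (continuous_evalT g) (continuous_evalT f).matrix_conjTranspose

end MatrixMeasure.IsDensity

end Integration

namespace MatrixMeasure

open scoped Matrix.Norms.L2Operator

variable (μ : MatrixMeasure p)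

theorem innerR_conjTranspose (f g : (Mat p)[X]) : (μ.innerR f g)ᴴ = μ.innerR g f := by
  obtain ⟨τ, M, h⟩ := μ.exists_isDensity
  rw [h.innerR_eq, h.innerR_eq, integral_matrix_conjTranspose (h.integrable_innerR f g)]
  congr 1 with θ : 1
  simp [Matrix.conjTranspose_mul, (h.posSemidef θ).1.eq, Matrix.mul_assoc]

theorem innerR_add_right (f g g' : (Mat p)[X]) :
    μ.innerR f (g + g') = μ.innerR f g + μ.innerR f g' := by
  obtain ⟨τ, M, h⟩ := μ.exists_isDensity
  rw [h.innerR_eq, h.innerR_eq, h.innerR_eq, ← integral_add (h.integrable_innerR f g)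
    (h.integrable_innerR f g')]
  simp only [evalT_add, mul_add]

theorem innerR_mul_C (f g : (Mat p)[X]) (A : Mat p) :
    μ.innerR f (g * C A) = μ.innerR f g * A := by
  obtain ⟨τ, M, h⟩ := μ.exists_isDensity
  rw [h.innerR_eq, h.innerR_eq, ← integral_mul_const_of_integrable (h.integrable_innerR f g)]
  simp only [evalT_mul, evalT_C, Matrix.mul_assoc]

theorem innerR_sub_right (f g g' : (Mat p)[X]) :
    μ.innerR f (g - g') = μ.innerR f g - μ.innerR f g' := by
  have h := μ.innerR_add_right f (g - g') g'
  rw [sub_add_cancel] at h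
  rw [h, add_sub_cancel_right]

theorem innerR_add_left (f f' g : (Mat p)[X]) :
    μ.innerR (f + f') g = μ.innerR f g + μ.innerR f' g := by
  rw [← innerR_conjTranspose, innerR_add_right, Matrix.conjTranspose_add, innerR_conjTranspose,
    innerR_conjTranspose]

theorem innerR_sub_left (f f' g : (Mat p)[X]) :
    μ.innerR (f - f') g = μ.innerR f g - μ.innerR f' g := by
  rw [← innerR_conjTranspose, innerR_sub_right, Matrix.conjTranspose_sub, innerR_conjTranspose,
    innerR_conjTranspose]

theorem innerR_C_left (f g : (Mat p)[X]) (A : Mat p) :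
    μ.innerR (f * C A) g = Aᴴ * μ.innerR f g := by
  rw [← innerR_conjTranspose, innerR_mul_C, Matrix.conjTranspose_mul, innerR_conjTranspose]

theorem innerR_zero_left (g : (Mat p)[X]) : μ.innerR 0 g = 0 := by
  have := μ.innerR_C_left 0 g 0
  simpa using this

theorem innerR_sum_left {ι : Type*} (s : Finset ι) (f : ι → (Mat p)[X]) (g : (Mat p)[X]) :
    μ.innerR (∑ i ∈ s, f i) g = ∑ i ∈ s, μ.innerR (f i) g := by
  classical
  induction s using Finset.induction_on with
  | empty => simp [innerR_zero_left]
  | insert i s hi ih => rw [Finset.sum_insert hi, Finset.sum_insert hi, innerR_add_left, ih]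

theorem smul_mul_mul_smul_of_inv {z : ℂ} (hz : ‖z‖ = 1) (A B D : Mat p) :
    (z • A)ᴴ * B * (z • D) = Aᴴ * B * D := by
  have : star z * z = 1 := by
    have := Complex.normSq_eq_conj_mul_self (z := z)
    rw [Complex.normSq_eq_norm_sq, hz] at this
    simpa using this.symm
  rw [Matrix.conjTranspose_smul, Matrix.smul_mul, Matrix.smul_mul, Matrix.mul_smul, smul_smul,
    this, one_smul]

theorem innerR_X_mul (f g : (Mat p)[X]) : μ.innerR (X * f) (X * g) = μ.innerR f g := by
  obtain ⟨τ, M, h⟩ := μ.exists_isDensity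
  rw [h.innerR_eq, h.innerR_eq]
  simp only [evalT_X_mul, smul_mul_mul_smul_of_inv (norm_expi _)]

/-- The unimodular factors cancel, so reversal exchanges the two inner products; several facts about
the left product are deduced from the right one in this way. -/
theorem innerR_rev_rev {k : ℕ} {f g : (Mat p)[X]} (hf : f.natDegree ≤ k) (hg : g.natDegree ≤ k) :
    μ.innerR (rev k f) (rev k g) = μ.innerL g f := by
  obtain ⟨τ, M, h⟩ := μ.exists_isDensity
  rw [h.innerR_eq, h.innerL_eq]
  simp only [evalT_rev hf, evalT_rev hg]
  congr 1 with θ : 1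
  rw [smul_mul_mul_smul_of_inv (by rw [norm_pow, norm_expi, one_pow]),
    Matrix.conjTranspose_conjTranspose]

theorem innerL_rev_rev {k : ℕ} {f g : (Mat p)[X]} (hf : f.natDegree ≤ k) (hg : g.natDegree ≤ k) :
    μ.innerL (rev k f) (rev k g) = μ.innerR g f := by
  rw [← innerR_rev_rev μ (natDegree_rev_le k g) (natDegree_rev_le k f), rev_rev hf, rev_rev hg]

/-- The two integrands coincide. This is why one and the same coefficient serves the right and the
left recursion. -/
theorem innerL_rev_X_mul {k : ℕ} {f g : (Mat p)[X]} (hf : f.natDegree ≤ k)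
    (hg : g.natDegree ≤ k) : μ.innerL (rev k f) (X * g) = μ.innerR (rev k g) (X * f) := by
  obtain ⟨τ, M, h⟩ := μ.exists_isDensity
  rw [h.innerR_eq, h.innerL_eq]
  congr 1 with θ : 1
  simp only [evalT_X_mul, evalT_rev hf, evalT_rev hg, Matrix.conjTranspose_smul,
    Matrix.conjTranspose_conjTranspose, Matrix.smul_mul, Matrix.mul_smul, smul_smul]
  congr 1
  ring

theorem innerL_conjTranspose (f g : (Mat p)[X]) : (μ.innerL f g)ᴴ = μ.innerL g f := by
  have hf : f.natDegree ≤ max f.natDegree g.natDegree := le_max_left _ _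
  have hg : g.natDegree ≤ max f.natDegree g.natDegree := le_max_right _ _
  rw [← innerR_rev_rev μ hg hf, innerR_conjTranspose, innerR_rev_rev μ hf hg]

theorem innerL_add_right (f g g' : (Mat p)[X]) :
    μ.innerL f (g + g') = μ.innerL f g + μ.innerL f g' := by
  obtain ⟨τ, M, h⟩ := μ.exists_isDensity
  rw [h.innerL_eq, h.innerL_eq, h.innerL_eq, ← integral_add (h.integrable_innerL f g)
    (h.integrable_innerL f g')]
  simp only [evalT_add, add_mul]

theorem innerL_C_mul (f g : (Mat p)[X]) (A : Mat p) :
    μ.innerL f (C A * g) = A * μ.innerL f g := by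
  obtain ⟨τ, M, h⟩ := μ.exists_isDensity
  rw [h.innerL_eq, h.innerL_eq, ← integral_const_mul_of_integrable (h.integrable_innerL f g)]
  simp only [evalT_mul, evalT_C, Matrix.mul_assoc]

theorem innerL_sub_right (f g g' : (Mat p)[X]) :
    μ.innerL f (g - g') = μ.innerL f g - μ.innerL f g' := by
  have h := μ.innerL_add_right f (g - g') g'
  rw [sub_add_cancel] at h
  rw [h, add_sub_cancel_right]

theorem innerL_add_left (f f' g : (Mat p)[X]) :
    μ.innerL (f + f') g = μ.innerL f g + μ.innerL f' g := by
  rw [← innerL_conjTranspose, innerL_add_right, Matrix.conjTranspose_add, innerL_conjTranspose,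
    innerL_conjTranspose]

theorem innerL_sub_left (f f' g : (Mat p)[X]) :
    μ.innerL (f - f') g = μ.innerL f g - μ.innerL f' g := by
  rw [← innerL_conjTranspose, innerL_sub_right, Matrix.conjTranspose_sub, innerL_conjTranspose,
    innerL_conjTranspose]

theorem innerL_C_left (f g : (Mat p)[X]) (A : Mat p) :
    μ.innerL (C A * f) g = μ.innerL f g * Aᴴ := by
  rw [← innerL_conjTranspose, innerL_C_mul, Matrix.conjTranspose_mul, innerL_conjTranspose]

theorem innerL_zero_left (g : (Mat p)[X]) : μ.innerL 0 g = 0 := by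
  have := μ.innerL_C_left 0 g 0
  simpa using this

theorem innerL_sum_left {ι : Type*} (s : Finset ι) (f : ι → (Mat p)[X]) (g : (Mat p)[X]) :
    μ.innerL (∑ i ∈ s, f i) g = ∑ i ∈ s, μ.innerL (f i) g := by
  classical
  induction s using Finset.induction_on with
  | empty => simp [innerL_zero_left]
  | insert i s hi ih => rw [Finset.sum_insert hi, Finset.sum_insert hi, innerL_add_left, ih]

theorem innerL_X_mul (f g : (Mat p)[X]) : μ.innerL (X * f) (X * g) = μ.innerL f g := by
  obtain ⟨τ, M, h⟩ := μ.exists_isDensity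
  rw [h.innerL_eq, h.innerL_eq]
  congr 1 with θ : 1
  simp only [evalT_X_mul, Matrix.conjTranspose_smul, Matrix.smul_mul, Matrix.mul_smul, smul_smul]
  rw [star_expi, inv_mul_cancel₀ (expi_ne_zero θ), one_smul]

theorem posSemidef_innerR (f : (Mat p)[X]) : (μ.innerR f f).PosSemidef := by
  obtain ⟨τ, M, h⟩ := μ.exists_isDensity
  rw [h.innerR_eq]
  exact posSemidef_integral (h.integrable_innerR f f) fun θ =>
    (h.posSemidef θ).conjTranspose_mul_mul_same _

theorem posSemidef_innerL (f : (Mat p)[X]) : (μ.innerL f f).PosSemidef := by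
  rw [← innerR_rev_rev μ (le_refl f.natDegree) le_rfl]
  exact μ.posSemidef_innerR _

theorem innerR_one_one : μ.innerR 1 1 = 1 := by
  obtain ⟨τ, M, h⟩ := μ.exists_isDensity
  have := h.finite
  rw [h.innerR_eq]
  simp only [evalT_one, Matrix.conjTranspose_one, Matrix.one_mul, Matrix.mul_one]
  have hi : Integrable M τ := by simpa using h.integrable_innerR 1 1
  rw [← μ.normalized]
  ext i j
  rw [integral_matrix_apply hi, Matrix.of_apply, h.eq_withDensity,
    withDensityᵥ_apply (Integrable.matrix_apply hi i j) MeasurableSet.univ, Measure.restrict_univ]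

theorem innerL_one_one : μ.innerL 1 1 = 1 := by
  have h := innerR_rev_rev μ (k := 0) (f := 1) (g := 1) (by simp) (by simp)
  have h1 : rev 0 (1 : (Mat p)[X]) = 1 := by simp [rev]
  rw [← h, h1, innerR_one_one]

variable {μ}

/-- If `P` were singular, the matrix whose columns all equal a kernel vector would violate the
hypothesis. -/
theorem posDef_of_pos_trace {P : Mat p} (hP : P.PosSemidef)
    (h : ∀ A : Mat p, A ≠ 0 → 0 < (Aᴴ * P * A).trace.re) : P.PosDef := by
  rw [hP.posDef_iff_det_ne_zero]
  intro h0
  obtain ⟨v, hv, hPv⟩ := Matrix.exists_mulVec_eq_zero_iff.mpr h0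
  set A : Mat p := Matrix.of fun i _ => v i with hA
  have hA0 : A ≠ 0 := by
    intro hA0
    apply hv
    funext i
    simpa [hA] using congrFun (congrFun hA0 i) i
  have hPA : P * A = 0 := by
    ext i j
    exact congrFun hPv i
  have := h A hA0
  rw [Matrix.mul_assoc, hPA] at this
  simp at this

/-- An invertible coefficient keeps `f A` nonzero for every `A ≠ 0`, so non-triviality applies to
all `f A`. -/
theorem Nontrivial.posDef_innerR (hμ : μ.Nontrivial) {f : (Mat p)[X]} {k : ℕ}
    (hf : IsUnit (f.coeff k)) : (μ.innerR f f).PosDef := by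
  refine posDef_of_pos_trace (μ.posSemidef_innerR f) fun A hA => ?_
  rw [Matrix.mul_assoc, ← innerR_mul_C, ← innerR_C_left]
  refine hμ _ fun h0 => hA ?_
  have := congrArg (fun q => coeff q k) h0
  simp only [coeff_mul_C, coeff_zero] at this
  exact (hf.mul_right_eq_zero).mp this

theorem Nontrivial.posDef_innerL (hμ : μ.Nontrivial) {f : (Mat p)[X]} {k : ℕ}
    (hf : IsUnit (f.coeff k)) : (μ.innerL f f).PosDef := by
  rw [← innerR_rev_rev μ (le_max_left f.natDegree k) (le_max_left f.natDegree k)]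
  refine hμ.posDef_innerR (k := max f.natDegree k - k) ?_
  rw [coeff_rev, if_pos (by omega), Nat.sub_sub_self (le_max_right _ _)]
  exact hf.star

end MatrixMeasure

end MatrixOPUC

end

/-! ## Orthonormal pairs and the Szegő recursion -/

noncomputable section

namespace MatrixOPUC

variable {p : ℕ}

namespace MatrixMeasure

variable (μ : MatrixMeasure p)

theorem innerR_eq_zero_of_natDegree_lt {k : ℕ} {f g : (Mat p)[X]} (hf : f.natDegree < k)
    (hg : ∀ j < k, μ.innerR (X ^ j) g = 0) : μ.innerR f g = 0 := by
  rw [as_sum_range_C_mul_X_pow f, innerR_sum_left]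
  refine Finset.sum_eq_zero fun j hj => ?_
  rw [← X_pow_mul_C, innerR_C_left, hg j (by have := Finset.mem_range.mp hj; omega), mul_zero]

theorem innerL_eq_zero_of_natDegree_lt {k : ℕ} {f g : (Mat p)[X]} (hf : f.natDegree < k)
    (hg : ∀ j < k, μ.innerL (X ^ j) g = 0) : μ.innerL f g = 0 := by
  rw [as_sum_range_C_mul_X_pow f, innerL_sum_left]
  refine Finset.sum_eq_zero fun j hj => ?_
  rw [innerL_C_left, hg j (by have := Finset.mem_range.mp hj; omega), zero_mul]

/-- The pair `(a, b)` consists of a right and a left orthonormal polynomial of degree `k`. -/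
structure IsOrthonormalPair (k : ℕ) (a b : (Mat p)[X]) : Prop where
  natDegree_right : a.natDegree ≤ k
  natDegree_left : b.natDegree ≤ k
  isUnit_right : IsUnit (a.coeff k)
  isUnit_left : IsUnit (b.coeff k)
  orthogonal_right : ∀ j < k, μ.innerR (X ^ j) a = 0
  orthogonal_left : ∀ j < k, μ.innerL (X ^ j) b = 0
  norm_right : μ.innerR a a = 1
  norm_left : μ.innerL b b = 1

/-- The Verblunsky coefficient of a pair of orthonormal polynomials. -/
def szegoCoeff (k : ℕ) (a b : (Mat p)[X]) : Mat p := (μ.innerR (rev k b) (X * a))ᴴ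

/-- The right Szegő recursion. -/
def szegoRight (k : ℕ) (a b : (Mat p)[X]) : (Mat p)[X] :=
  (X * a - rev k b * C (μ.szegoCoeff k a b)ᴴ) * C (rhoR (μ.szegoCoeff k a b))⁻¹

/-- The left Szegő recursion. -/
def szegoLeft (k : ℕ) (a b : (Mat p)[X]) : (Mat p)[X] :=
  C (rhoL (μ.szegoCoeff k a b))⁻¹ * (X * b - C (μ.szegoCoeff k a b)ᴴ * rev k a)

variable {μ} {k : ℕ} {a b : (Mat p)[X]}

theorem coeff_szegoRight_remainder (A : Mat p) :
    (X * a - rev k b * C A).coeff (k + 1) = a.coeff k := by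
  rw [coeff_sub, coeff_X_mul, coeff_mul_C, coeff_rev, if_neg (by omega), zero_mul, sub_zero]

theorem coeff_szegoLeft_remainder (A : Mat p) :
    (X * b - C A * rev k a).coeff (k + 1) = b.coeff k := by
  rw [coeff_sub, coeff_X_mul, coeff_C_mul, coeff_rev, if_neg (by omega), mul_zero, sub_zero]

namespace IsOrthonormalPair

theorem innerR_X_pow_rev (h : μ.IsOrthonormalPair k a b) {j : ℕ} (h1 : 1 ≤ j) (hj : j ≤ k) :
    μ.innerR (X ^ j) (rev k b) = 0 := by
  have h2 : (X ^ j : (Mat p)[X]) = rev k (X ^ (k - j)) := by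
    rw [rev_X_pow (Nat.sub_le k j), Nat.sub_sub_self hj]
  rw [h2, innerR_rev_rev μ ((natDegree_X_pow_le _).trans (Nat.sub_le _ _)) h.natDegree_left,
    ← innerL_conjTranspose, h.orthogonal_left _ (by omega), Matrix.conjTranspose_zero]

theorem innerL_X_pow_rev (h : μ.IsOrthonormalPair k a b) {j : ℕ} (h1 : 1 ≤ j) (hj : j ≤ k) :
    μ.innerL (X ^ j) (rev k a) = 0 := by
  have h2 : (X ^ j : (Mat p)[X]) = rev k (X ^ (k - j)) := by
    rw [rev_X_pow (Nat.sub_le k j), Nat.sub_sub_self hj]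
  rw [h2, innerL_rev_rev μ ((natDegree_X_pow_le _).trans (Nat.sub_le _ _)) h.natDegree_right,
    ← innerR_conjTranspose, h.orthogonal_right _ (by omega), Matrix.conjTranspose_zero]

theorem innerR_rev_rev_left (h : μ.IsOrthonormalPair k a b) :
    μ.innerR (rev k b) (rev k b) = 1 := by
  rw [innerR_rev_rev μ h.natDegree_left h.natDegree_left, h.norm_left]

theorem innerL_rev_rev_right (h : μ.IsOrthonormalPair k a b) :
    μ.innerL (rev k a) (rev k a) = 1 := by
  rw [innerL_rev_rev μ h.natDegree_right h.natDegree_right, h.norm_right]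

theorem innerR_rev_X_mul (a b : (Mat p)[X]) :
    μ.innerR (rev k b) (X * a) = (μ.szegoCoeff k a b)ᴴ := by
  rw [szegoCoeff, Matrix.conjTranspose_conjTranspose]

theorem innerL_rev_X_mul' (h : μ.IsOrthonormalPair k a b) :
    μ.innerL (rev k a) (X * b) = (μ.szegoCoeff k a b)ᴴ := by
  rw [innerL_rev_X_mul μ h.natDegree_right h.natDegree_left, innerR_rev_X_mul]

/-- Orthogonality to `X, …, X^k` is inherited from `a` and `b^*`. The coefficient is chosen to make
the remainder orthogonal to `b^*`; as the constant coefficient of `b^*` is invertible, orthogonality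
to `1` follows. -/
theorem innerR_remainder (h : μ.IsOrthonormalPair k a b) {j : ℕ} (hj : j ≤ k) :
    μ.innerR (X ^ j) (X * a - rev k b * C (μ.szegoCoeff k a b)ᴴ) = 0 := by
  set ψ := X * a - rev k b * C (μ.szegoCoeff k a b)ᴴ with hψ
  have hpos : ∀ j, 1 ≤ j → j ≤ k → μ.innerR (X ^ j) ψ = 0 := by
    intro j h1 hj
    obtain ⟨i, rfl⟩ := Nat.exists_eq_add_of_le' h1
    rw [hψ, innerR_sub_right, innerR_mul_C, h.innerR_X_pow_rev h1 hj, zero_mul, sub_zero,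
      pow_succ', innerR_X_mul, h.orthogonal_right i (by omega)]
  rcases Nat.eq_zero_or_pos j with rfl | h1
  · have h2 : μ.innerR (rev k b) ψ = 0 := by
      rw [hψ, innerR_sub_right, innerR_mul_C, h.innerR_rev_rev_left, one_mul, innerR_rev_X_mul,
        sub_self]
    have h3 : rev k b = ∑ i ∈ Finset.range (k + 1), X ^ i * C ((rev k b).coeff i) := by
      conv_lhs => rw [as_sum_range' (rev k b) (k + 1) (Nat.lt_succ_of_le (natDegree_rev_le k b))]
      simp only [X_pow_mul_C, C_mul_X_pow_eq_monomial]
    rw [h3, innerR_sum_left, Finset.sum_eq_single 0] at h2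
    · rw [innerR_C_left, coeff_rev, if_pos (Nat.zero_le _), Nat.sub_zero,
        Matrix.conjTranspose_conjTranspose] at h2
      exact (h.isUnit_left.mul_right_eq_zero).mp h2
    · intro i hi h0
      have := Finset.mem_range.mp hi
      rw [innerR_C_left, hpos i (by omega) (by omega), mul_zero]
    · simp
  · exact hpos j h1 hj

theorem innerL_remainder (h : μ.IsOrthonormalPair k a b) {j : ℕ} (hj : j ≤ k) :
    μ.innerL (X ^ j) (X * b - C (μ.szegoCoeff k a b)ᴴ * rev k a) = 0 := by
  set ψ := X * b - C (μ.szegoCoeff k a b)ᴴ * rev k a with hψ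
  have hpos : ∀ j, 1 ≤ j → j ≤ k → μ.innerL (X ^ j) ψ = 0 := by
    intro j h1 hj
    obtain ⟨i, rfl⟩ := Nat.exists_eq_add_of_le' h1
    rw [hψ, innerL_sub_right, innerL_C_mul, h.innerL_X_pow_rev h1 hj, mul_zero, sub_zero,
      pow_succ', innerL_X_mul, h.orthogonal_left i (by omega)]
  rcases Nat.eq_zero_or_pos j with rfl | h1
  · have h2 : μ.innerL (rev k a) ψ = 0 := by
      rw [hψ, innerL_sub_right, innerL_C_mul, h.innerL_rev_rev_right, mul_one,
        h.innerL_rev_X_mul', sub_self]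
    have h3 : rev k a = ∑ i ∈ Finset.range (k + 1), C ((rev k a).coeff i) * X ^ i := by
      conv_lhs => rw [as_sum_range' (rev k a) (k + 1) (Nat.lt_succ_of_le (natDegree_rev_le k a))]
      simp only [C_mul_X_pow_eq_monomial]
    rw [h3, innerL_sum_left, Finset.sum_eq_single 0] at h2
    · rw [innerL_C_left, coeff_rev, if_pos (Nat.zero_le _), Nat.sub_zero,
        Matrix.conjTranspose_conjTranspose] at h2
      exact (h.isUnit_right.mul_left_eq_zero).mp h2
    · intro i hi h0
      have := Finset.mem_range.mp hi
      rw [innerL_C_left, hpos i (by omega) (by omega), zero_mul]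
    · simp
  · exact hpos j h1 hj

/-- Pythagoras: removing from `X a` its component along the normalized `b^*` lowers the norm from
`1` by `αα†`. -/
theorem innerR_remainder_self (h : μ.IsOrthonormalPair k a b) :
    μ.innerR (X * a - rev k b * C (μ.szegoCoeff k a b)ᴴ)
      (X * a - rev k b * C (μ.szegoCoeff k a b)ᴴ)
      = 1 - μ.szegoCoeff k a b * (μ.szegoCoeff k a b)ᴴ := by
  have h1 : μ.innerR (X * a) (rev k b) = μ.szegoCoeff k a b := rfl.trans
    (innerR_conjTranspose μ _ _).symm
  rw [innerR_sub_right, innerR_sub_left, innerR_sub_left, innerR_mul_C, innerR_C_left,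
    innerR_C_left, innerR_mul_C, h.innerR_rev_rev_left, innerR_X_mul, h.norm_right,
    innerR_rev_X_mul, h1, Matrix.conjTranspose_conjTranspose]
  noncomm_ring

theorem innerL_remainder_self (h : μ.IsOrthonormalPair k a b) :
    μ.innerL (X * b - C (μ.szegoCoeff k a b)ᴴ * rev k a)
      (X * b - C (μ.szegoCoeff k a b)ᴴ * rev k a)
      = 1 - (μ.szegoCoeff k a b)ᴴ * μ.szegoCoeff k a b := by
  have h1 : μ.innerL (X * b) (rev k a) = μ.szegoCoeff k a b := by
    rw [← innerL_conjTranspose, h.innerL_rev_X_mul', Matrix.conjTranspose_conjTranspose]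
  rw [innerL_sub_right, innerL_sub_left, innerL_sub_left, innerL_C_mul, innerL_C_left,
    innerL_C_left, innerL_C_mul, h.innerL_rev_rev_right, innerL_X_mul, h.norm_left,
    h.innerL_rev_X_mul', h1, Matrix.conjTranspose_conjTranspose]
  noncomm_ring

/-- The remainder keeps the invertible leading coefficient of `a`, so non-triviality makes its norm
positive definite: the coefficient is a strict contraction and the defect matrix can be inverted in
the recursion. -/
theorem posDef_right (hμ : μ.Nontrivial) (h : μ.IsOrthonormalPair k a b) :
    (1 - μ.szegoCoeff k a b * (μ.szegoCoeff k a b)ᴴ).PosDef := by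
  rw [← h.innerR_remainder_self]
  refine hμ.posDef_innerR (k := k + 1) ?_
  rw [coeff_szegoRight_remainder]
  exact h.isUnit_right

theorem posDef_left (hμ : μ.Nontrivial) (h : μ.IsOrthonormalPair k a b) :
    (1 - (μ.szegoCoeff k a b)ᴴ * μ.szegoCoeff k a b).PosDef := by
  rw [← h.innerL_remainder_self]
  refine hμ.posDef_innerL (k := k + 1) ?_
  rw [coeff_szegoLeft_remainder]
  exact h.isUnit_left

end IsOrthonormalPair

theorem inv_mul_sq_mul_inv {S Q : Mat p} (hS : S.PosDef) (h : S * S = Q) :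
    S⁻¹ * Q * S⁻¹ = 1 := by
  have hu := (Matrix.isUnit_iff_isUnit_det _).mp hS.isUnit
  rw [← h, ← Matrix.mul_assoc, Matrix.nonsing_inv_mul _ hu, Matrix.one_mul,
    Matrix.mul_nonsing_inv _ hu]

theorem IsOrthonormalPair.szego (hμ : μ.Nontrivial) (h : μ.IsOrthonormalPair k a b) :
    μ.IsOrthonormalPair (k + 1) (μ.szegoRight k a b) (μ.szegoLeft k a b) := by
  have hR := rhoR_posDef (h.posDef_right hμ)
  have hL := rhoL_posDef (h.posDef_left hμ)
  have hdeg : ∀ {f : (Mat p)[X]}, f.natDegree ≤ k → (X * f).natDegree ≤ k + 1 := fun hf =>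
    natDegree_mul_le.trans (by have := natDegree_X_le (R := Mat p); omega)
  refine ⟨?_, ?_, ?_, ?_, ?_, ?_, ?_, ?_⟩
  · refine (natDegree_mul_C_le _ _).trans ((natDegree_sub_le _ _).trans (max_le
      (hdeg h.natDegree_right) ?_))
    exact (natDegree_mul_C_le _ _).trans ((natDegree_rev_le _ _).trans (Nat.le_succ k))
  · refine (natDegree_C_mul_le _ _).trans ((natDegree_sub_le _ _).trans (max_le
      (hdeg h.natDegree_left) ?_))
    exact (natDegree_C_mul_le _ _).trans ((natDegree_rev_le _ _).trans (Nat.le_succ k))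
  · rw [szegoRight, coeff_mul_C, coeff_szegoRight_remainder]
    exact h.isUnit_right.mul hR.inv.isUnit
  · rw [szegoLeft, coeff_C_mul, coeff_szegoLeft_remainder]
    exact hL.inv.isUnit.mul h.isUnit_left
  · intro j hj
    rw [szegoRight, innerR_mul_C, h.innerR_remainder (by omega), zero_mul]
  · intro j hj
    rw [szegoLeft, innerL_C_mul, h.innerL_remainder (by omega), mul_zero]
  · rw [szegoRight, innerR_mul_C, innerR_C_left, h.innerR_remainder_self, hR.inv.1.eq]
    exact inv_mul_sq_mul_inv hR (rhoR_mul_self (h.posDef_right hμ).posSemidef)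
  · rw [szegoLeft, innerL_C_mul, innerL_C_left, h.innerL_remainder_self, hL.inv.1.eq,
      ← Matrix.mul_assoc]
    exact inv_mul_sq_mul_inv hL (rhoL_mul_self (h.posDef_left hμ).posSemidef)

variable (μ)

/-- The right and left orthonormal polynomials generated by the Szegő recursion. -/
def szegoPair : ℕ → (Mat p)[X] × (Mat p)[X]
  | 0 => (1, 1)
  | k + 1 => (μ.szegoRight k (szegoPair k).1 (szegoPair k).2,
      μ.szegoLeft k (szegoPair k).1 (szegoPair k).2)

variable {μ}

theorem isOrthonormalPair_szegoPair (hμ : μ.Nontrivial) (k : ℕ) :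
    μ.IsOrthonormalPair k (μ.szegoPair k).1 (μ.szegoPair k).2 := by
  induction k with
  | zero =>
    refine ⟨by simp [szegoPair], by simp [szegoPair], by simp [szegoPair], by simp [szegoPair],
      by simp, by simp, ?_, ?_⟩
    · simpa [szegoPair] using μ.innerR_one_one
    · simpa [szegoPair] using μ.innerL_one_one
  | succ k ih => exact ih.szego hμ

theorem IsOrthonormalPair.innerR_of_lt {i j : ℕ} {a a' b b' : (Mat p)[X]}
    (h : μ.IsOrthonormalPair i a b) (h' : μ.IsOrthonormalPair j a' b') (hij : i < j) :
    μ.innerR a a' = 0 :=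
  μ.innerR_eq_zero_of_natDegree_lt (h.natDegree_right.trans_lt hij) h'.orthogonal_right

theorem IsOrthonormalPair.innerL_of_lt {i j : ℕ} {a a' b b' : (Mat p)[X]}
    (h : μ.IsOrthonormalPair i a b) (h' : μ.IsOrthonormalPair j a' b') (hij : i < j) :
    μ.innerL b b' = 0 :=
  μ.innerL_eq_zero_of_natDegree_lt (h.natDegree_left.trans_lt hij) h'.orthogonal_left

theorem Nontrivial.isRightOPS (hμ : μ.Nontrivial) :
    IsRightOPS μ (fun k => (μ.szegoPair k).1 * C ((μ.szegoPair k).1.coeff k)⁻¹)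
      (fun k => (μ.szegoPair k).1) (fun k => (μ.szegoPair k).1.coeff k) where
  natDegree_le k := (natDegree_mul_C_le _ _).trans
    (isOrthonormalPair_szegoPair hμ k).natDegree_right
  coeff_self k := by
    rw [coeff_mul_C, Matrix.mul_nonsing_inv _ ((Matrix.isUnit_iff_isUnit_det _).mp
      (isOrthonormalPair_szegoPair hμ k).isUnit_right)]
  orthogonal k j hj := by
    rw [innerR_mul_C, (isOrthonormalPair_szegoPair hμ k).orthogonal_right j hj, zero_mul]
  kappa_zero := by simp [szegoPair]
  kappa_pos k := by
    have h := isOrthonormalPair_szegoPair hμ k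
    have h1 : (μ.szegoPair (k + 1)).1.coeff (k + 1)
        = (μ.szegoPair k).1.coeff k * (rhoR (μ.szegoCoeff k (μ.szegoPair k).1
          (μ.szegoPair k).2))⁻¹ := by
      change (μ.szegoRight k _ _).coeff (k + 1) = _
      rw [szegoRight, coeff_mul_C, coeff_szegoRight_remainder]
    rw [h1, ← Matrix.mul_assoc, Matrix.nonsing_inv_mul _ ((Matrix.isUnit_iff_isUnit_det _).mp
      h.isUnit_right), Matrix.one_mul]
    exact (rhoR_posDef (h.posDef_right hμ)).inv
  eq_mul k := by
    rw [mul_assoc, ← C_mul, Matrix.nonsing_inv_mul _ ((Matrix.isUnit_iff_isUnit_det _).mp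
      (isOrthonormalPair_szegoPair hμ k).isUnit_right), C_1, mul_one]
  orthonormal i j := by
    have hi := isOrthonormalPair_szegoPair hμ i
    have hj := isOrthonormalPair_szegoPair hμ j
    rcases lt_trichotomy i j with h | h | h
    · rw [if_neg h.ne, hi.innerR_of_lt hj h]
    · subst h
      rw [if_pos rfl, hi.norm_right]
    · rw [if_neg h.ne', ← innerR_conjTranspose, hj.innerR_of_lt hi h, Matrix.conjTranspose_zero]

theorem Nontrivial.isLeftOPS (hμ : μ.Nontrivial) :
    IsLeftOPS μ (fun k => C ((μ.szegoPair k).2.coeff k)⁻¹ * (μ.szegoPair k).2)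
      (fun k => (μ.szegoPair k).2) (fun k => (μ.szegoPair k).2.coeff k) where
  natDegree_le k := (natDegree_C_mul_le _ _).trans
    (isOrthonormalPair_szegoPair hμ k).natDegree_left
  coeff_self k := by
    rw [coeff_C_mul, Matrix.nonsing_inv_mul _ ((Matrix.isUnit_iff_isUnit_det _).mp
      (isOrthonormalPair_szegoPair hμ k).isUnit_left)]
  orthogonal k j hj := by
    rw [innerL_C_mul, (isOrthonormalPair_szegoPair hμ k).orthogonal_left j hj, mul_zero]
  kappa_zero := by simp [szegoPair]
  kappa_pos k := by
    have h := isOrthonormalPair_szegoPair hμ k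
    have h1 : (μ.szegoPair (k + 1)).2.coeff (k + 1)
        = (rhoL (μ.szegoCoeff k (μ.szegoPair k).1 (μ.szegoPair k).2))⁻¹
          * (μ.szegoPair k).2.coeff k := by
      change (μ.szegoLeft k _ _).coeff (k + 1) = _
      rw [szegoLeft, coeff_C_mul, coeff_szegoLeft_remainder]
    rw [h1, Matrix.mul_assoc, Matrix.mul_nonsing_inv _ ((Matrix.isUnit_iff_isUnit_det _).mp
      h.isUnit_left), Matrix.mul_one]
    exact (rhoL_posDef (h.posDef_left hμ)).inv
  eq_mul k := by
    rw [← mul_assoc, ← C_mul, Matrix.mul_nonsing_inv _ ((Matrix.isUnit_iff_isUnit_det _).mp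
      (isOrthonormalPair_szegoPair hμ k).isUnit_left), C_1, one_mul]
  orthonormal i j := by
    have hi := isOrthonormalPair_szegoPair hμ i
    have hj := isOrthonormalPair_szegoPair hμ j
    rcases lt_trichotomy i j with h | h | h
    · rw [if_neg h.ne, hi.innerL_of_lt hj h]
    · subst h
      rw [if_pos rfl, hi.norm_left]
    · rw [if_neg h.ne', ← innerL_conjTranspose, hj.innerL_of_lt hi h, Matrix.conjTranspose_zero]

/-- The Szegő recursion started at `(1, 1)` generates the orthonormal polynomials and the
coefficients together. Hence `verblunsky` is not its default value `0`. -/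
theorem Nontrivial.exists_isVerblunsky (hμ : μ.Nontrivial) : ∃ α, IsVerblunsky μ α := by
  refine ⟨fun k => μ.szegoCoeff k (μ.szegoPair k).1 (μ.szegoPair k).2, _, _, _, _, _, _,
    hμ.isRightOPS, hμ.isLeftOPS, fun k => ?_⟩
  have h := isOrthonormalPair_szegoPair hμ k
  have hR := rhoR_posDef (h.posDef_right hμ)
  have hL := rhoL_posDef (h.posDef_left hμ)
  refine ⟨(h.posDef_right hμ).posSemidef, ?_, ?_⟩
  · change X * (μ.szegoPair k).2 - C (rhoL _) * μ.szegoLeft k _ _ = _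
    rw [szegoLeft, ← mul_assoc, ← C_mul, Matrix.mul_nonsing_inv _
      ((Matrix.isUnit_iff_isUnit_det _).mp hL.isUnit), C_1, one_mul, sub_sub_cancel]
  · change X * (μ.szegoPair k).1 - μ.szegoRight k _ _ * C (rhoR _) = _
    rw [szegoRight, mul_assoc, ← C_mul, Matrix.nonsing_inv_mul _
      ((Matrix.isUnit_iff_isUnit_det _).mp hR.isUnit), C_1, mul_one, sub_sub_cancel]

theorem Nontrivial.isVerblunsky (hμ : μ.Nontrivial) : IsVerblunsky μ (verblunsky μ) := by
  unfold verblunsky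
  rw [dif_pos hμ.exists_isVerblunsky]
  exact hμ.exists_isVerblunsky.choose_spec

end MatrixMeasure

end MatrixOPUC

end

/-! ## Coefficients of the orthonormal polynomials -/

noncomputable section

namespace MatrixOPUC

variable {p : ℕ}

/-- Orthonormal polynomials `a k` (right), `b k` (left) satisfying the Szegő recursions with
coefficients `α k`. -/
structure IsSzegoSystem (μ : MatrixMeasure p) (α : ℕ → Mat p) (a b : ℕ → (Mat p)[X]) : Prop where
  pair : ∀ k, μ.IsOrthonormalPair k (a k) (b k)
  right_zero : a 0 = 1
  left_zero : b 0 = 1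
  posDef_right : ∀ k, (1 - α k * (α k)ᴴ).PosDef
  posDef_left : ∀ k, (1 - (α k)ᴴ * α k).PosDef
  recursion_left : ∀ k, X * b k - C (rhoL (α k)) * b (k + 1) = C (α k)ᴴ * rev k (a k)
  recursion_right : ∀ k, X * a k - a (k + 1) * C (rhoR (α k)) = rev k (b k) * C (α k)ᴴ

/-- Pairing the right recursion with `b^*` identifies `α k` with `szegoCoeff`, which upgrades the
closed condition `αα† ≤ 1` to a strict one. -/
theorem IsVerblunsky.exists_isSzegoSystem {μ : MatrixMeasure p} (hμ : μ.Nontrivial)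
    {α : ℕ → Mat p} (h : IsVerblunsky μ α) : ∃ a b, IsSzegoSystem μ α a b := by
  obtain ⟨ΦR, ΦL, φR, φL, κR, κL, hR, hL, hrec⟩ := h
  have hcR : ∀ k, (φR k).coeff k = κR k := fun k => by
    rw [hR.eq_mul, coeff_mul_C, hR.coeff_self, Matrix.one_mul]
  have hcL : ∀ k, (φL k).coeff k = κL k := fun k => by
    rw [hL.eq_mul, coeff_C_mul, hL.coeff_self, Matrix.mul_one]
  have huR : ∀ k, IsUnit (κR k) := by
    intro k
    induction k with
    | zero => rw [hR.kappa_zero]; exact isUnit_one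
    | succ k ih =>
      have h1 := ih.mul (hR.kappa_pos k).isUnit
      rwa [← Matrix.mul_assoc, Matrix.mul_nonsing_inv _
        ((Matrix.isUnit_iff_isUnit_det _).mp ih), Matrix.one_mul] at h1
  have huL : ∀ k, IsUnit (κL k) := by
    intro k
    induction k with
    | zero => rw [hL.kappa_zero]; exact isUnit_one
    | succ k ih =>
      have h1 := (hL.kappa_pos k).isUnit.mul ih
      rwa [Matrix.mul_assoc, Matrix.nonsing_inv_mul _
        ((Matrix.isUnit_iff_isUnit_det _).mp ih), Matrix.mul_one] at h1
  have hpair : ∀ k, μ.IsOrthonormalPair k (φR k) (φL k) := by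
    intro k
    refine ⟨?_, ?_, ?_, ?_, ?_, ?_, ?_, ?_⟩
    · rw [hR.eq_mul]
      exact (natDegree_mul_C_le _ _).trans (hR.natDegree_le k)
    · rw [hL.eq_mul]
      exact (natDegree_C_mul_le _ _).trans (hL.natDegree_le k)
    · rw [hcR]; exact huR k
    · rw [hcL]; exact huL k
    · intro j hj
      rw [hR.eq_mul, MatrixMeasure.innerR_mul_C, hR.orthogonal k j hj, zero_mul]
    · intro j hj
      rw [hL.eq_mul, MatrixMeasure.innerL_C_mul, hL.orthogonal k j hj, mul_zero]
    · simpa using hR.orthonormal k k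
    · simpa using hL.orthonormal k k
  have hα : ∀ k, α k = μ.szegoCoeff k (φR k) (φL k) := by
    intro k
    have h1 := congrArg (μ.innerR (rev k (φL k))) (hrec k).2.2
    rw [MatrixMeasure.innerR_sub_right, MatrixMeasure.innerR_mul_C, MatrixMeasure.innerR_mul_C,
      (hpair k).innerR_rev_rev_left, Matrix.one_mul,
      μ.innerR_eq_zero_of_natDegree_lt (Nat.lt_succ_of_le (natDegree_rev_le k (φL k)))
        (hpair (k + 1)).orthogonal_right, Matrix.zero_mul, sub_zero] at h1
    rw [MatrixMeasure.szegoCoeff, h1, Matrix.conjTranspose_conjTranspose]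
  refine ⟨φR, φL, hpair, ?_, ?_, ?_, ?_, fun k => (hrec k).2.1, fun k => (hrec k).2.2⟩
  · have h0 := eq_C_of_natDegree_le_zero (hpair 0).natDegree_right
    rwa [hcR, hR.kappa_zero, C_1] at h0
  · have h0 := eq_C_of_natDegree_le_zero (hpair 0).natDegree_left
    rwa [hcL, hL.kappa_zero, C_1] at h0
  · intro k
    rw [hα]
    exact (hpair k).posDef_right hμ
  · intro k
    rw [hα]
    exact (hpair k).posDef_left hμ

namespace IsSzegoSystem

variable {μ : MatrixMeasure p} {α : ℕ → Mat p} {a b : ℕ → (Mat p)[X]}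

theorem isUnit_det (h : IsSzegoSystem μ α a b) (k : ℕ) : IsUnit ((a k).coeff k).det :=
  (Matrix.isUnit_iff_isUnit_det _).mp (h.pair k).isUnit_right

theorem coeff_succ_mul (h : IsSzegoSystem μ α a b) (k : ℕ) :
    (a (k + 1)).coeff (k + 1) * rhoR (α k) = (a k).coeff k := by
  have h1 := congrArg (fun q => coeff q (k + 1)) (h.recursion_right k)
  simp only [coeff_sub, coeff_X_mul, coeff_mul_C] at h1
  rw [coeff_rev, if_neg (by omega), zero_mul, sub_eq_zero] at h1
  exact h1.symm

theorem inv_coeff_succ (h : IsSzegoSystem μ α a b) (k : ℕ) :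
    ((a (k + 1)).coeff (k + 1))⁻¹ = rhoR (α k) * ((a k).coeff k)⁻¹ := by
  refine Matrix.inv_eq_right_inv ?_
  rw [← Matrix.mul_assoc, h.coeff_succ_mul, Matrix.mul_nonsing_inv _ (h.isUnit_det k)]

/-- The leading coefficients satisfy `κ_{k+1} ρ^R_k = κ_k`, so the logarithms of the determinants
telescope. -/
theorem log_normSq_det_coeff (h : IsSzegoSystem μ α a b) (N : ℕ) :
    Real.log (Complex.normSq ((a N).coeff N).det) = -logDetSum α N := by
  induction N with
  | zero => simp [h.right_zero, logDetSum]
  | succ k ih =>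
    have h1 := congrArg (fun A => Complex.normSq (Matrix.det A)) (h.coeff_succ_mul k)
    simp only [Matrix.det_mul, map_mul] at h1
    have h2 : Complex.normSq (rhoR (α k)).det = (1 - α k * (α k)ᴴ).det.re := by
      rw [← rhoR_mul_self (h.posDef_right k).posSemidef, Matrix.det_mul,
        ← PosSemidef.ofReal_det_re rhoR_posSemidef]
      simp [Complex.normSq_apply]
    have h3 : Complex.normSq ((a (k + 1)).coeff (k + 1)).det ≠ 0 := by
      rw [ne_eq, map_eq_zero]
      exact (h.isUnit_det (k + 1)).ne_zero
    rw [h2] at h1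
    have h4 := congrArg Real.log h1
    rw [Real.log_mul h3 (PosDef.det_re_pos (h.posDef_right k)).ne', ih] at h4
    unfold logDetSum at h4 ⊢
    rw [Finset.sum_range_succ]
    linarith

theorem rhoL_mul_coeff_zero (h : IsSzegoSystem μ α a b) (k : ℕ) :
    rhoL (α k) * (b (k + 1)).coeff 0 = -((α k)ᴴ * ((a k).coeff k)ᴴ) := by
  have h1 := congrArg (fun q => coeff q 0) (h.recursion_left k)
  simp only [coeff_sub, coeff_X_mul_zero, coeff_C_mul] at h1
  rw [coeff_rev, if_pos (Nat.zero_le _), Nat.sub_zero, zero_sub] at h1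
  rw [← h1, neg_neg]

/-- Evaluate the left recursion at `z = 0` and move `α_k` across the defect matrices by
`rhoR_mul_eq`. -/
theorem inv_coeff_mul_coeff_zero (h : IsSzegoSystem μ α a b) (k : ℕ) :
    ((a (k + 1)).coeff (k + 1))⁻¹ * ((b (k + 1)).coeff 0)ᴴ = -α k := by
  have h1 := congrArg Matrix.conjTranspose (h.rhoL_mul_coeff_zero k)
  simp only [Matrix.conjTranspose_mul, Matrix.conjTranspose_neg,
    Matrix.conjTranspose_conjTranspose, rhoL_posSemidef.1.eq] at h1
  have hu := (Matrix.isUnit_iff_isUnit_det _).mp (rhoL_posDef (h.posDef_left k)).isUnit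
  have h2 : ((b (k + 1)).coeff 0)ᴴ = -((a k).coeff k * α k) * (rhoL (α k))⁻¹ := by
    rw [← h1, Matrix.mul_assoc, Matrix.mul_nonsing_inv _ hu, Matrix.mul_one]
  have h3 : rhoR (α k) * ((a k).coeff k)⁻¹ * (-((a k).coeff k * α k) * (rhoL (α k))⁻¹)
      = -(rhoR (α k) * ((((a k).coeff k)⁻¹ * (a k).coeff k) * α k) * (rhoL (α k))⁻¹) := by
    noncomm_ring
  rw [h.inv_coeff_succ, h2, h3, Matrix.nonsing_inv_mul _ (h.isUnit_det k), Matrix.one_mul,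
    rhoR_mul_eq (h.posDef_right k) (h.posDef_left k), Matrix.mul_assoc,
    Matrix.mul_nonsing_inv _ hu, Matrix.mul_one]

theorem subleading_succ (h : IsSzegoSystem μ α a b) (k : ℕ) :
    (a (k + 1)).coeff k * ((a (k + 1)).coeff (k + 1))⁻¹
      = ((X * a k).coeff k - ((b k).coeff 0)ᴴ * (α k)ᴴ) * ((a k).coeff k)⁻¹ := by
  have h1 := congrArg (fun q => coeff q k) (h.recursion_right k)
  simp only [coeff_sub, coeff_mul_C] at h1
  rw [coeff_rev, if_pos le_rfl, Nat.sub_self] at h1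
  rw [h.inv_coeff_succ, ← Matrix.mul_assoc, ← h1, sub_sub_cancel]

/-- In trace, the ratio of the two top coefficients grows by `α_k α_{k+1}†` at each recursion step.
It starts from `-α_0†`, whose trace has the real part of that of `-α_0`; this is the separate first
term of `T_N`. -/
theorem re_trace_subleading (h : IsSzegoSystem μ α a b) (N : ℕ) :
    ((a (N + 1)).coeff N * ((a (N + 1)).coeff (N + 1))⁻¹).trace.re = -TSum α N := by
  induction N with
  | zero =>
    rw [h.subleading_succ 0, h.right_zero, h.left_zero]
    simp [TSum]
  | succ k ih =>
    have h1 : (((b (k + 1)).coeff 0)ᴴ * (α (k + 1))ᴴ * ((a (k + 1)).coeff (k + 1))⁻¹).trace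
        = -(α k * (α (k + 1))ᴴ).trace := by
      rw [Matrix.trace_mul_comm, ← Matrix.mul_assoc, h.inv_coeff_mul_coeff_zero, Matrix.neg_mul,
        Matrix.trace_neg]
    rw [h.subleading_succ (k + 1), coeff_X_mul, Matrix.sub_mul, Matrix.trace_sub, h1,
      Complex.sub_re, ih]
    unfold TSum
    rw [Finset.sum_range_succ]
    simp only [Matrix.trace_sub, Matrix.trace_add, Complex.sub_re, Complex.add_re, Complex.neg_re]
    ring

/-- A diagonal block of multiplication by `z` in the orthonormal basis. Its trace supplies the
increment of `T_N` needed in `integral_log_det_le`. -/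
theorem innerR_X_mul_self (h : IsSzegoSystem μ α a b) (k : ℕ) :
    μ.innerR (a (k + 1)) (X * a (k + 1)) = -(α k * (α (k + 1))ᴴ) := by
  have hlead : μ.innerR (a (k + 1)) (rev (k + 1) (b (k + 1))) = -α k := by
    -- `E` matches the leading coefficients of `b^*` and `a E`, so their difference has lower degree
    -- and is orthogonal to `a`.
    set E := ((a (k + 1)).coeff (k + 1))⁻¹ * ((b (k + 1)).coeff 0)ᴴ with hE
    have hdeg : (rev (k + 1) (b (k + 1)) - a (k + 1) * C E).natDegree < k + 1 := by
      refine Nat.lt_succ_of_le (natDegree_le_iff_coeff_eq_zero.mpr fun j hj => ?_)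
      rw [coeff_sub, coeff_mul_C]
      rcases eq_or_lt_of_le (Nat.succ_le_of_lt hj) with h1 | h1
      · rw [← h1, coeff_rev, if_pos le_rfl, Nat.succ_eq_add_one, Nat.sub_self, hE,
          ← Matrix.mul_assoc, Matrix.mul_nonsing_inv _ (h.isUnit_det (k + 1)), Matrix.one_mul,
          sub_self]
      · rw [coeff_rev, if_neg (by omega), coeff_eq_zero_of_natDegree_lt
          ((h.pair (k + 1)).natDegree_right.trans_lt h1), zero_mul, sub_zero]
    have h0 := μ.innerR_eq_zero_of_natDegree_lt hdeg (h.pair (k + 1)).orthogonal_right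
    have h1 := congrArg Matrix.conjTranspose h0
    rw [MatrixMeasure.innerR_conjTranspose, Matrix.conjTranspose_zero,
      MatrixMeasure.innerR_sub_right, MatrixMeasure.innerR_mul_C, (h.pair (k + 1)).norm_right,
      Matrix.one_mul, sub_eq_zero] at h1
    rw [h1, hE, h.inv_coeff_mul_coeff_zero]
  have h2 := congrArg (μ.innerR (a (k + 1))) (h.recursion_right (k + 1))
  rw [MatrixMeasure.innerR_sub_right, MatrixMeasure.innerR_mul_C, MatrixMeasure.innerR_mul_C,
    (h.pair (k + 1)).innerR_of_lt (h.pair (k + 1 + 1)) (Nat.lt_succ_self _), Matrix.zero_mul,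
    sub_zero, hlead, Matrix.neg_mul] at h2
  exact h2

end IsSzegoSystem

end MatrixOPUC

end

/-! ## Scalar integrals over the circle -/

noncomputable section

namespace MatrixOPUC

section Circle

theorem integral_expi_eq_circleAverage {E : Type*} [NormedAddCommGroup E] [NormedSpace ℝ E]
    (f : ℂ → E) : ∫ θ, f (expi θ) ∂lam0 = Real.circleAverage f 0 1 := by
  unfold lam0
  rw [AddCircle.integral_haarAddCircle, Real.circleAverage_def,
    ← AddCircle.intervalIntegral_preimage (2 * π) 0, zero_add]
  congr 1
  refine intervalIntegral.integral_congr fun x _ => ?_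
  simp [expi_coe, circleMap]

theorem integral_expi_of_differentiableAt {f : ℂ → ℂ}
    (hf : ∀ z, ‖z‖ ≤ 1 → DifferentiableAt ℂ f z) : ∫ θ, f (expi θ) ∂lam0 = f 0 := by
  rw [integral_expi_eq_circleAverage]
  refine DiffContOnCl.circleAverage (DifferentiableOn.diffContOnCl fun z hz => ?_)
  refine (hf z ?_).differentiableWithinAt
  rw [abs_one] at hz
  simpa using Metric.closure_ball_subset_closedBall hz

/-- Mean value property for `f(z) / z`, extended by `f'(0)` at the origin. -/
theorem integral_expi_inv_mul {f : ℂ → ℂ} (hf : ∀ z, ‖z‖ ≤ 1 → DifferentiableAt ℂ f z)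
    (h0 : f 0 = 0) : ∫ θ, (expi θ)⁻¹ * f (expi θ) ∂lam0 = deriv f 0 := by
  have h1 : ∀ θ, (expi θ)⁻¹ * f (expi θ) = dslope f 0 (expi θ) := fun θ => by
    rw [dslope_of_ne _ (expi_ne_zero θ), slope_def_field, h0, sub_zero, sub_zero, div_eq_inv_mul]
  simp only [h1]
  rw [integral_expi_of_differentiableAt, dslope_same]
  intro z hz
  rcases eq_or_ne z 0 with rfl | hz0
  · have hU : Metric.ball (0 : ℂ) 1 ∈ 𝓝 (0 : ℂ) := Metric.ball_mem_nhds _ one_pos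
    refine ((Complex.differentiableOn_dslope hU).mpr fun w hw => ?_).differentiableAt hU
    exact (hf w (by simpa using (Metric.mem_ball.mp hw).le)).differentiableWithinAt
  · exact (differentiableAt_dslope_of_ne hz0).mpr (hf z hz)

theorem continuous_cosT : Continuous cosT := Complex.continuous_re.comp continuous_expi

theorem cosT_eq (θ : Torus) : (cosT θ : ℂ) = (expi θ + (expi θ)⁻¹) / 2 := by
  rw [← star_expi, cosT, Complex.re_eq_add_conj]
  rfl

/-- The density `1 - g cos θ` of `λ_g`. -/
def weight (g : ℝ) (θ : Torus) : ℝ := 1 - g * cosT θ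

theorem continuous_weight (g : ℝ) : Continuous (weight g) := by
  unfold weight
  exact continuous_const.sub (continuous_const.mul continuous_cosT)

theorem abs_cosT_le (θ : Torus) : |cosT θ| ≤ 1 :=
  (Complex.abs_re_le_norm _).trans (norm_expi θ).le

theorem weight_nonneg {g : ℝ} (hg : |g| ≤ 1) (θ : Torus) : 0 ≤ weight g θ := by
  have h1 : |g * cosT θ| ≤ 1 := by
    rw [abs_mul]
    exact mul_le_one₀ hg (abs_nonneg _) (abs_cosT_le θ)
  have := (abs_le.mp h1).2
  unfold weight
  linarith

theorem weight_le {g : ℝ} (hg : |g| ≤ 1) (θ : Torus) : weight g θ ≤ 2 := by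
  have h1 : |g * cosT θ| ≤ 1 := by
    rw [abs_mul]
    exact mul_le_one₀ hg (abs_nonneg _) (abs_cosT_le θ)
  have := (abs_le.mp h1).1
  unfold weight
  linarith

theorem integral_cosT : ∫ θ, cosT θ ∂lam0 = 0 := by
  have h1 := integral_expi_of_differentiableAt (f := fun z => z) fun z _ => differentiableAt_id
  have h2 := integral_re (Continuous.integrable_torus continuous_expi lam0)
  rw [h1] at h2
  simpa [cosT] using h2

theorem integral_weight (g : ℝ) : ∫ θ, weight g θ ∂lam0 = 1 := by
  unfold weight
  rw [integral_sub (integrable_const _)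
    ((Continuous.integrable_torus continuous_cosT lam0).const_mul _), integral_const_mul,
    integral_cosT]
  simp

/-- Since `cos θ = (z + z⁻¹) / 2` and `f(0) = 0`, both `f` and `z f` have mean zero, and only `z⁻¹
f` contributes, through the first Taylor coefficient. -/
theorem integral_weight_mul_re {f : ℂ → ℂ} (g : ℝ) (hf : ∀ z, ‖z‖ ≤ 1 → DifferentiableAt ℂ f z)
    (h0 : f 0 = 0) :
    ∫ θ, weight g θ * (2 * (f (expi θ)).re) ∂lam0 = -g * (deriv f 0).re := by
  have hc : Continuous fun θ => f (expi θ) := continuous_iff_continuousAt.mpr fun θ =>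
    ContinuousAt.comp (f := expi) (hf _ (norm_expi θ).le).continuousAt
      continuous_expi.continuousAt
  have hi1 : Integrable (fun θ => f (expi θ)) lam0 := Continuous.integrable_torus hc _
  have hi2 : Integrable (fun θ => expi θ * f (expi θ)) lam0 :=
    Continuous.integrable_torus (continuous_expi.mul hc) _
  have hi3 : Integrable (fun θ => (expi θ)⁻¹ * f (expi θ)) lam0 :=
    Continuous.integrable_torus ((continuous_expi.inv₀ expi_ne_zero).mul hc) _
  have hi4 : Integrable (fun θ => expi θ * f (expi θ) + (expi θ)⁻¹ * f (expi θ)) lam0 :=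
    hi2.add hi3
  have h1 := integral_expi_of_differentiableAt hf
  have h2 := integral_expi_of_differentiableAt (f := fun z => z * f z) fun z hz =>
    differentiableAt_id.mul (hf z hz)
  have h3 := integral_expi_inv_mul hf h0
  have h4 : ∫ θ, (2 * f (expi θ) - g * (expi θ * f (expi θ) + (expi θ)⁻¹ * f (expi θ))) ∂lam0
      = -g * deriv f 0 := by
    rw [integral_sub (hi1.const_mul _) (hi4.const_mul _), integral_const_mul,
      integral_const_mul, integral_add hi2 hi3, h1, h2, h3, h0]
    simp
  have h5 := congrArg Complex.re h4
  have h6 := integral_re ((hi1.const_mul 2).sub (hi4.const_mul (g : ℂ)))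
  refine Eq.trans ?_ (h6.trans (h5.trans ?_))
  · refine integral_congr_ae (ae_of_all _ fun θ => ?_)
    have h7 : 2 * f (expi θ) - g * (expi θ * f (expi θ) + (expi θ)⁻¹ * f (expi θ))
        = ((weight g θ * 2 : ℝ) : ℂ) * f (expi θ) := by
      unfold weight
      push_cast
      rw [cosT_eq]
      ring
    change _ = Complex.re (2 * f (expi θ) - g * (expi θ * f (expi θ) + (expi θ)⁻¹ * f (expi θ)))
    rw [h7, Complex.re_ofReal_mul]
    ring
  · rw [← Complex.ofReal_neg, Complex.re_ofReal_mul]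

theorem continuous_log_normSq_eval {d : ℂ[X]} (hd : ∀ z : ℂ, ‖z‖ ≤ 1 → d.eval z ≠ 0) :
    Continuous fun θ : Torus => Real.log (Complex.normSq (d.eval (expi θ))) := by
  refine Continuous.log (Complex.continuous_normSq.comp (d.continuous.comp continuous_expi)) ?_
  intro θ
  simpa using hd _ (norm_expi θ).le

/-- Write `z - r = -r (1 - z / r)`. For `|r| > 1` the principal logarithm of `1 - z / r` is analytic
on the closed disc, vanishes at `0` and has derivative `-1 / r` there. -/
theorem integral_weight_mul_log_linear (g : ℝ) {r : ℂ} (hr : 1 < ‖r‖) :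
    ∫ θ, weight g θ * Real.log (Complex.normSq ((X - C r : ℂ[X]).eval (expi θ))) ∂lam0
      = Real.log (Complex.normSq r) + g * (r⁻¹).re := by
  have hr0 : r ≠ 0 := norm_pos_iff.mp (one_pos.trans hr)
  set f : ℂ → ℂ := fun z => Complex.log (1 + -(z / r)) with hf
  have hlt : ∀ z : ℂ, ‖z‖ ≤ 1 → ‖-(z / r)‖ < 1 := fun z hz => by
    rw [norm_neg, norm_div, div_lt_one (one_pos.trans hr)]
    linarith
  have hlin : ∀ z, HasDerivAt (fun z : ℂ => 1 + -(z / r)) (-(1 / r)) z := fun z =>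
    (((hasDerivAt_id z).div_const r).neg).const_add 1
  have hderiv : ∀ z : ℂ, ‖z‖ ≤ 1 → HasDerivAt f (-(1 / r) / (1 + -(z / r))) z := fun z hz =>
    (hlin z).clog (Complex.mem_slitPlane_of_norm_lt_one (hlt z hz))
  have hf0 : f 0 = 0 := by simp [hf]
  have hmain := integral_weight_mul_re g (fun z hz => (hderiv z hz).differentiableAt) hf0
  have hd0 : deriv f 0 = -r⁻¹ := by
    rw [(hderiv 0 (by simp)).deriv]
    simp
  have hsplit : ∀ θ, weight g θ * Real.log (Complex.normSq ((X - C r : ℂ[X]).eval (expi θ)))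
      = weight g θ * Real.log (Complex.normSq r) + weight g θ * (2 * (f (expi θ)).re) := by
    intro θ
    have h1 : (X - C r : ℂ[X]).eval (expi θ) = -r * (1 + -(expi θ / r)) := by
      simp only [eval_sub, eval_X, eval_C]
      field_simp
      ring
    have h2 : (1 + -(expi θ / r)) ≠ 0 :=
      Complex.slitPlane_ne_zero (Complex.mem_slitPlane_of_norm_lt_one
        (hlt _ (norm_expi θ).le))
    rw [h1, map_mul, Complex.normSq_neg, Real.log_mul (by simpa using hr0) (by simpa using h2),
      mul_add]
    congr 2
    simp only [hf, Complex.log_re]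
    rw [Complex.normSq_eq_norm_sq, Real.log_pow]
    norm_cast
  have hc : Continuous fun θ => weight g θ * (2 * (f (expi θ)).re) := by
    refine (continuous_weight g).mul (continuous_const.mul (Complex.continuous_re.comp ?_))
    exact continuous_iff_continuousAt.mpr fun θ => ContinuousAt.comp (f := expi)
      (hderiv _ (norm_expi θ).le).continuousAt continuous_expi.continuousAt
  simp only [hsplit]
  rw [integral_add ((Continuous.integrable_torus (continuous_weight g) lam0).mul_const _)
    (Continuous.integrable_torus hc lam0), hmain, integral_mul_const, integral_weight, hd0]
  simp

/-- Jensen's formula for a polynomial without zeros in the closed disc, weighted by `1 - g cos`. -/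
theorem integral_weight_mul_log_normSq (g : ℝ) {d : ℂ[X]}
    (hd : ∀ z : ℂ, ‖z‖ ≤ 1 → d.eval z ≠ 0) :
    ∫ θ, weight g θ * Real.log (Complex.normSq (d.eval (expi θ))) ∂lam0
      = Real.log (Complex.normSq (d.coeff 0)) - g * (d.coeff 1 / d.coeff 0).re := by
  have hd0 : d ≠ 0 := by
    rintro rfl
    exact hd 0 (by simp) eval_zero
  have hprod := (IsAlgClosed.splits d).eq_prod_roots
  have hroots : ∀ r ∈ d.roots, 1 < ‖r‖ := by
    intro r hr
    by_contra hcon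
    exact hd r (not_lt.mp hcon) (isRoot_of_mem_roots hr)
  have hlead : d.leadingCoeff ≠ 0 := leadingCoeff_ne_zero.mpr hd0
  rw [hprod]
  generalize d.roots = s at hroots
  generalize d.leadingCoeff = c at hlead
  clear hprod hd0 hd
  -- Both sides send products to sums, the right one because `coeff 1 / coeff 0` is the logarithmic
  -- derivative at `0`. So roots may be added one at a time, the induction also carrying the absence
  -- of zeros in the disc.
  have key : ∀ s : Multiset ℂ, (∀ r ∈ s, 1 < ‖r‖) →
      (∀ z : ℂ, ‖z‖ ≤ 1 → (C c * (s.map fun a => X - C a).prod).eval z ≠ 0) ∧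
      ∫ θ, weight g θ * Real.log (Complex.normSq
        ((C c * (s.map fun a => X - C a).prod).eval (expi θ))) ∂lam0
      = Real.log (Complex.normSq ((C c * (s.map fun a => X - C a).prod).coeff 0))
        - g * ((C c * (s.map fun a => X - C a).prod).coeff 1 /
          (C c * (s.map fun a => X - C a).prod).coeff 0).re := by
    intro s
    induction s using Multiset.induction_on with
    | empty =>
      intro _
      refine ⟨fun z _ => by simpa using hlead, ?_⟩
      simp only [Multiset.map_zero, Multiset.prod_zero, mul_one, eval_C, coeff_C_zero]
      rw [integral_mul_const, integral_weight, coeff_C_of_ne_zero one_ne_zero]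
      simp
    | cons r s ih =>
      intro hs
      obtain ⟨ih1, ih2⟩ := ih fun a ha => hs a (Multiset.mem_cons_of_mem ha)
      have hr := hs r (Multiset.mem_cons_self r s)
      have hr0 : r ≠ 0 := norm_pos_iff.mp (one_pos.trans hr)
      have heq : C c * ((r ::ₘ s).map fun a => X - C a).prod
          = (X - C r) * (C c * (s.map fun a => X - C a).prod) := by
        rw [Multiset.map_cons, Multiset.prod_cons]
        ring
      rw [heq]
      generalize C c * (s.map fun a => X - C a).prod = e at ih1 ih2
      have hlin : ∀ z : ℂ, ‖z‖ ≤ 1 → (X - C r : ℂ[X]).eval z ≠ 0 := fun z hz h => by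
        rw [eval_sub, eval_X, eval_C, sub_eq_zero] at h
        rw [h] at hz
        linarith
      have he0 : e.coeff 0 ≠ 0 := by
        rw [coeff_zero_eq_eval_zero]
        exact ih1 0 (by simp)
      refine ⟨fun z hz => by
        rw [eval_mul]
        exact mul_ne_zero (hlin z hz) (ih1 z hz), ?_⟩
      have hsplit : ∀ θ, weight g θ * Real.log (Complex.normSq (((X - C r) * e).eval (expi θ)))
          = weight g θ * Real.log (Complex.normSq ((X - C r : ℂ[X]).eval (expi θ)))
            + weight g θ * Real.log (Complex.normSq (e.eval (expi θ))) := by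
        intro θ
        rw [eval_mul, map_mul, Real.log_mul (by simpa using hlin _ (norm_expi θ).le)
          (by simpa using ih1 _ (norm_expi θ).le), mul_add]
      simp only [hsplit]
      have hint : ∀ {q : ℂ[X]}, (∀ z : ℂ, ‖z‖ ≤ 1 → q.eval z ≠ 0) → Integrable
          (fun θ => weight g θ * Real.log (Complex.normSq (q.eval (expi θ)))) lam0 := fun hq =>
        Continuous.integrable_torus ((continuous_weight g).mul
          (continuous_log_normSq_eval hq)) lam0
      rw [integral_add (hint hlin) (hint ih1), integral_weight_mul_log_linear g hr, ih2]
      have hc0 : ((X - C r) * e).coeff 0 = -r * e.coeff 0 := by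
        rw [mul_coeff_zero]
        simp
      have hc1 : ((X - C r) * e).coeff 1 = e.coeff 0 - r * e.coeff 1 := by
        rw [sub_mul, coeff_sub, coeff_C_mul, coeff_X_mul]
      rw [hc0, hc1, map_mul, Complex.normSq_neg, Real.log_mul (by simpa using hr0)
        (by simpa using he0)]
      have hq : (e.coeff 0 - r * e.coeff 1) / (-r * e.coeff 0)
          = -r⁻¹ + e.coeff 1 / e.coeff 0 := by
        field_simp
        ring
      rw [hq, Complex.add_re, Complex.neg_re]
      ring
  exact (key s hroots).2

end Circle

end MatrixOPUC

end

/-! ## Zeros of the orthonormal polynomials -/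

noncomputable section

namespace MatrixOPUC

variable {p : ℕ}

/-- The value `f(z)` of a matrix polynomial at a complex number. -/
def evalZ (f : (Mat p)[X]) (z : ℂ) : Mat p := f.eval (Matrix.scalar (Fin p) z)

theorem evalT_eq_evalZ (f : (Mat p)[X]) (θ : Torus) : evalT f θ = evalZ f (expi θ) := rfl

theorem evalZ_zero (f : (Mat p)[X]) : evalZ f 0 = f.coeff 0 := by
  unfold evalZ
  rw [map_zero, ← coeff_zero_eq_eval_zero]

theorem evalZ_eq_map (f : (Mat p)[X]) (z : ℂ) :
    evalZ f z = (evalRingHom z).mapMatrix (matPolyEquiv.symm f) :=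
  (matPolyEquiv_symm_map_eval f z).symm

/-- The determinant of a matrix polynomial, as a scalar polynomial. -/
def detPoly (f : (Mat p)[X]) : ℂ[X] := (matPolyEquiv.symm f).det

theorem eval_detPoly (f : (Mat p)[X]) (z : ℂ) : (detPoly f).eval z = (evalZ f z).det := by
  rw [evalZ_eq_map, ← RingHom.map_det]
  rfl

theorem coeff_zero_detPoly (f : (Mat p)[X]) : (detPoly f).coeff 0 = (f.coeff 0).det := by
  rw [coeff_zero_eq_eval_zero, eval_detPoly, evalZ_zero]

/-- Factor `f = f_0 (1 + X G)` with `G(0) = f_0⁻¹ f_1` and use `det (1 + X G) = 1 + X tr G + O(X²)`.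
-/
theorem coeff_one_detPoly {f : (Mat p)[X]} (hf : IsUnit (f.coeff 0).det) :
    (detPoly f).coeff 1 / (detPoly f).coeff 0 = ((f.coeff 0)⁻¹ * f.coeff 1).trace := by
  set G : (Mat p)[X] := C (f.coeff 0)⁻¹ * f.divX with hG
  have h1 : f = C (f.coeff 0) * (1 + X * G) := by
    conv_lhs => rw [← divX_mul_X_add f]
    rw [mul_add, mul_one, X_mul, hG, ← mul_assoc, ← mul_assoc, ← C_mul,
      Matrix.mul_nonsing_inv _ hf, C_1, one_mul, add_comm]
  have h2 : detPoly f = C (f.coeff 0).det * (1 + (X : ℂ[X]) • matPolyEquiv.symm G).det := by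
    conv_lhs => rw [h1]
    unfold detPoly
    rw [map_mul, map_add, map_mul, map_one, matPolyEquiv_symm_C, matPolyEquiv_symm_X,
      Matrix.det_mul, ← Matrix.smul_eq_diagonal_mul]
    congr 1
    exact (RingHom.map_det (C : ℂ →+* ℂ[X]) _).symm
  have h3 : (detPoly f).coeff 1 = (f.coeff 0).det * ((f.coeff 0)⁻¹ * f.coeff 1).trace := by
    rw [h2, coeff_C_mul, Matrix.det_one_add_smul]
    congr 1
    rw [coeff_add, coeff_add, coeff_one, coeff_mul_X, coeff_mul_X_pow']
    simp only [one_ne_zero, if_false, zero_add, show ¬ (2 ≤ 1) by norm_num, add_zero]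
    simp only [Matrix.trace, Matrix.diag, finsetSum_coeff, matPolyEquiv_symm_apply_coeff]
    rw [hG, coeff_C_mul, coeff_divX]
  rw [coeff_zero_detPoly, h3, mul_div_cancel_left₀ _ hf.ne_zero]

theorem differentiable_evalZ (f : (Mat p)[X]) (i j : Fin p) :
    Differentiable ℂ fun z => evalZ f z i j := by
  have : (fun z => evalZ f z i j) = fun z => (matPolyEquiv.symm f i j).eval z := by
    funext z
    rw [evalZ_eq_map]
    rfl
  rw [this]
  exact (matPolyEquiv.symm f i j).differentiable

theorem differentiableAt_inv_evalZ {f : (Mat p)[X]} {z : ℂ} (hz : (evalZ f z).det ≠ 0)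
    (i j : Fin p) : DifferentiableAt ℂ (fun z => (evalZ f z)⁻¹ i j) z := by
  have : (fun z => (evalZ f z)⁻¹ i j)
      = fun z => ((detPoly f).eval z)⁻¹ * ((matPolyEquiv.symm f).adjugate i j).eval z := by
    funext z
    rw [Matrix.inv_def, Ring.inverse_eq_inv', eval_detPoly, Matrix.smul_apply, smul_eq_mul]
    congr 1
    rw [evalZ_eq_map, ← RingHom.map_adjugate]
    rfl
  rw [this]
  refine DifferentiableAt.mul (DifferentiableAt.inv (detPoly f).differentiable.differentiableAt ?_)
    (Polynomial.differentiable _).differentiableAt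
  rwa [eval_detPoly]

theorem differentiableAt_matrix_mul {F G : ℂ → Mat p} {z : ℂ}
    (hF : ∀ i j, DifferentiableAt ℂ (fun z => F z i j) z)
    (hG : ∀ i j, DifferentiableAt ℂ (fun z => G z i j) z) (i j : Fin p) :
    DifferentiableAt ℂ (fun z => (F z * G z) i j) z := by
  simp only [Matrix.mul_apply]
  exact DifferentiableAt.fun_sum fun k _ => (hF i k).mul (hG k j)

open scoped Matrix.Norms.L2Operator in
theorem integral_matrix_expi {F : ℂ → Mat p}
    (hF : ∀ z, ‖z‖ ≤ 1 → ∀ i j, DifferentiableAt ℂ (fun z => F z i j) z) :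
    ∫ θ, F (expi θ) ∂lam0 = F 0 := by
  have hc : Continuous fun θ => F (expi θ) := continuous_matrix fun i j =>
    continuous_iff_continuousAt.mpr fun θ =>
    ContinuousAt.comp (f := expi) (g := fun z => F z i j) (hF _ (norm_expi θ).le i j).continuousAt
      continuous_expi.continuousAt
  ext i j
  rw [integral_matrix_apply (Continuous.integrable_torus hc lam0)]
  exact integral_expi_of_differentiableAt fun z hz => hF z hz i j

/-- The factor theorem survives noncommuting coefficients because the point is a scalar matrix. -/
theorem exists_eq_mul_X_sub_C {f : (Mat p)[X]} {N : ℕ} (hf : f.natDegree ≤ N) {z : ℂ}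
    (hz : evalZ f z = 0) :
    ∃ q : (Mat p)[X], (X * q).natDegree ≤ N ∧ f = X * q - C (Matrix.scalar (Fin p) z) * q := by
  set s := Matrix.scalar (Fin p) z with hs
  have hcomm : ∀ q : (Mat p)[X], C s * q = q * C s := by
    intro q
    ext1 j
    rw [coeff_C_mul, coeff_mul_C, hs, scalar_mul_eq_smul, mul_scalar_eq_smul]
  set q : (Mat p)[X] := ∑ j ∈ Finset.range (N + 1),
    C (f.coeff j) * ∑ i ∈ Finset.range j, X ^ i * (C s) ^ (j - 1 - i) with hq
  refine ⟨q, ?_, ?_⟩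
  · rw [hq, Finset.mul_sum]
    refine natDegree_sum_le_of_forall_le _ _ fun j hj => ?_
    rw [← mul_assoc, X_mul_C, mul_assoc, Finset.mul_sum, Finset.mul_sum]
    refine natDegree_sum_le_of_forall_le _ _ fun i hi => ?_
    rw [← C_pow, ← mul_assoc, ← mul_assoc, mul_assoc (C _), ← pow_succ']
    refine (natDegree_mul_C_le _ _).trans ((natDegree_C_mul_le _ _).trans
      ((natDegree_X_pow_le _).trans ?_))
    have := Finset.mem_range.mp hi
    have := Finset.mem_range.mp hj
    omega
  · have h1 : q * (X - C s) = ∑ j ∈ Finset.range (N + 1), C (f.coeff j) * (X ^ j - (C s) ^ j) := by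
      rw [hq, Finset.sum_mul]
      refine Finset.sum_congr rfl fun j _ => ?_
      rw [mul_assoc, Commute.geom_sum₂_mul (X_mul (p := C s))]
    have h2 : (∑ j ∈ Finset.range (N + 1), C (f.coeff j) * (C s) ^ j) = 0 := by
      have h3 : evalZ f z = ∑ j ∈ Finset.range (N + 1), f.coeff j * s ^ j := by
        unfold evalZ
        exact eval_eq_sum_range' (Nat.lt_succ_of_le hf) _
      rw [hz] at h3
      have h4 := congrArg (C : Mat p → (Mat p)[X]) h3.symm
      simpa only [map_sum, map_mul, map_pow, map_zero] using h4
    rw [hcomm, X_mul, ← mul_sub, h1]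
    simp only [mul_sub, Finset.sum_sub_distrib, h2, sub_zero]
    exact as_sum_range_C_mul_X_pow' _ (Nat.lt_succ_of_le hf)

variable {μ : MatrixMeasure p}

theorem coeff_zero_rev (N : ℕ) (a : (Mat p)[X]) : (rev N a).coeff 0 = (a.coeff N)ᴴ := by
  rw [coeff_rev, if_pos (Nat.zero_le _), Nat.sub_zero]

namespace MatrixMeasure.IsOrthonormalPair

variable {N : ℕ} {a b : (Mat p)[X]}

theorem det_coeff_ne_zero (h : μ.IsOrthonormalPair N a b) : (a.coeff N).det ≠ 0 :=
  ((Matrix.isUnit_iff_isUnit_det _).mp h.isUnit_right).ne_zero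

/-- A zero `z` would produce a nonzero `f = A a^*` of the form `(X - z) q`. As `a^*` is left
orthogonal to `X, …, X^N`, `f` is orthogonal to `X q`, and Pythagoras for `z q = X q - f` gives
`|z|² ‖q‖² = ‖q‖² + ‖f‖²`, forcing `|z| > 1`. -/
theorem det_evalZ_rev_ne_zero (hμ : μ.Nontrivial) (h : μ.IsOrthonormalPair N a b) {z : ℂ}
    (hz : ‖z‖ ≤ 1) : (evalZ (rev N a) z).det ≠ 0 := by
  intro hdet
  obtain ⟨v, hv, hv0⟩ := Matrix.exists_vecMul_eq_zero_iff.mpr hdet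
  set A : Mat p := Matrix.of fun _ => v with hA
  have hA0 : A ≠ 0 := by
    intro h0
    obtain ⟨i, hi⟩ := Function.ne_iff.mp hv
    exact hi (congrFun (congrFun h0 i) i)
  set f : (Mat p)[X] := C A * rev N a with hf
  have hfz : evalZ f z = 0 := by
    have h1 : evalZ f z = A * evalZ (rev N a) z := by
      unfold evalZ
      rw [hf, eval_C_mul]
    rw [h1]
    ext i j
    have := congrFun hv0 j
    simpa [Matrix.mul_apply, Matrix.vecMul, dotProduct, hA] using this
  have hf0 : f ≠ 0 := by
    intro h0
    have h1 := congrArg (fun q => coeff q 0) h0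
    simp only [hf, coeff_C_mul, coeff_zero_rev, coeff_zero] at h1
    have hu : IsUnit ((a.coeff N)ᴴ) := by
      rw [← Matrix.star_eq_conjTranspose]
      exact h.isUnit_right.star
    exact hA0 ((hu.mul_left_eq_zero).mp h1)
  obtain ⟨q, hqN, hq⟩ := exists_eq_mul_X_sub_C
    ((natDegree_C_mul_le _ _).trans (natDegree_rev_le N a)) hfz
  have horth : μ.innerL f (X * q) = 0 := by
    rw [hf, innerL_C_left, ← rev_rev hqN, innerL_rev_rev μ h.natDegree_right
      (natDegree_rev_le _ _)]
    have hc : (rev N (X * q)).coeff N = 0 := by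
      rw [coeff_rev, if_pos le_rfl, Nat.sub_self, coeff_X_mul_zero, Matrix.conjTranspose_zero]
    by_cases hr : rev N (X * q) = 0
    · rw [hr, innerR_zero_left, zero_mul]
    · rw [innerR_eq_zero_of_natDegree_lt (k := N) μ ?_ h.orthogonal_right, zero_mul]
      refine lt_of_le_of_ne (natDegree_rev_le _ _) fun hN => hr ?_
      rwa [← leadingCoeff_eq_zero, leadingCoeff, hN]
  have horth' : μ.innerL (X * q) f = 0 := by
    rw [← innerL_conjTranspose, horth, Matrix.conjTranspose_zero]
  have hCq : C (Matrix.scalar (Fin p) z) * q = X * q - f := by rw [hf, hq]; abel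
  have hkey : (star z * z) • μ.innerL q q = μ.innerL q q + μ.innerL f f := by
    have h1 : μ.innerL (C (Matrix.scalar (Fin p) z) * q) (C (Matrix.scalar (Fin p) z) * q)
        = (star z * z) • μ.innerL q q := by
      rw [innerL_C_left, innerL_C_mul, scalar_mul_eq_smul]
      have : (Matrix.scalar (Fin p) z)ᴴ = Matrix.scalar (Fin p) (star z) := by
        ext i j
        by_cases hij : i = j
        · subst hij; simp
        · simp [hij, Ne.symm hij]
      rw [this, mul_scalar_eq_smul, smul_smul]
    rw [← h1, hCq, innerL_sub_left, innerL_sub_right, innerL_sub_right, innerL_X_mul, horth,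
      horth']
    abel
  have hs : 0 < (μ.innerL f f).trace.re := by
    rw [← innerR_rev_rev μ (le_refl f.natDegree) le_rfl]
    refine hμ _ fun h0 => hf0 ?_
    rw [← rev_rev (le_refl f.natDegree), h0]
    ext1 j
    rw [coeff_rev]
    simp
  have ht : 0 ≤ (μ.innerL q q).trace.re := PosSemidef.trace_re_nonneg (μ.posSemidef_innerL q)
  have h2 := congrArg (fun B : Mat p => B.trace.re) hkey
  have h3 : star z * z = ((‖z‖ ^ 2 : ℝ) : ℂ) := by
    rw [← Complex.normSq_eq_norm_sq, Complex.normSq_eq_conj_mul_self]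
    rfl
  simp only [h3, Matrix.trace_smul, Matrix.trace_add, Complex.add_re, smul_eq_mul,
    Complex.re_ofReal_mul] at h2
  have h4 : ‖z‖ ^ 2 ≤ 1 := pow_le_one₀ (norm_nonneg z) hz
  nlinarith

end MatrixMeasure.IsOrthonormalPair

theorem normSq_det_evalT_rev {N : ℕ} {a : (Mat p)[X]} (ha : a.natDegree ≤ N) (θ : Torus) :
    Complex.normSq (evalT (rev N a) θ).det = Complex.normSq (evalT a θ).det := by
  rw [evalT_rev ha, Matrix.det_smul, map_mul, map_pow, map_pow, Complex.normSq_eq_norm_sq,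
    norm_expi, Matrix.det_conjTranspose]
  simp [Complex.normSq_conj]

namespace IsSzegoSystem

variable {α : ℕ → Mat p} {a b : ℕ → (Mat p)[X]}

/-- Jensen's formula for the determinant of the reversed polynomial, whose coefficients at `0` and
`1` are the adjoints of the two top coefficients of `a (N + 1)`. The two sums end at different
indices, which is why `tr (α_N α_{N+1}†)` has to be controlled later. -/
theorem integral_weight_mul_log_det (hμ : μ.Nontrivial) (h : IsSzegoSystem μ α a b) (g : ℝ)
    (N : ℕ) : ∫ θ, weight g θ * Real.log (Complex.normSq (evalT (a (N + 1)) θ).det) ∂lam0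
      = -(logDetSum α (N + 1) - g * TSum α N) := by
  have hP := h.pair (N + 1)
  have hd : ∀ z : ℂ, ‖z‖ ≤ 1 → (detPoly (rev (N + 1) (a (N + 1)))).eval z ≠ 0 := fun z hz => by
    rw [eval_detPoly]
    exact hP.det_evalZ_rev_ne_zero hμ hz
  have h1 := integral_weight_mul_log_normSq g hd
  simp only [eval_detPoly, ← evalT_eq_evalZ, normSq_det_evalT_rev hP.natDegree_right] at h1
  have h0 : ((a (N + 1)).coeff (N + 1)).det ≠ 0 := hP.det_coeff_ne_zero
  have hu : IsUnit ((rev (N + 1) (a (N + 1))).coeff 0).det := by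
    rw [coeff_zero_rev, Matrix.det_conjTranspose]
    exact (h.isUnit_det (N + 1)).star
  rw [h1, coeff_one_detPoly hu, coeff_zero_detPoly, coeff_zero_rev, coeff_rev,
    if_pos (by omega), Matrix.det_conjTranspose, Nat.add_sub_cancel,
    ← Matrix.conjTranspose_nonsing_inv, ← Matrix.conjTranspose_mul, Matrix.trace_conjTranspose]
  have h2 : ∀ z : ℂ, (star z).re = z.re := fun z => Complex.conj_re z
  have h3 : ∀ z : ℂ, Complex.normSq (star z) = Complex.normSq z := fun z => Complex.normSq_conj z
  rw [h2, h3, h.log_normSq_det_coeff, h.re_trace_subleading]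
  ring

end IsSzegoSystem

end MatrixOPUC

end

/-! ## The Bernstein–Szegő approximation -/

noncomputable section

namespace MatrixOPUC

variable {p : ℕ}

instance : lam0.IsOpenPosMeasure :=
  inferInstanceAs ((AddCircle.haarAddCircle (T := 2 * π)).IsOpenPosMeasure)

instance : Infinite Torus :=
  have : Infinite (Set.Ico (0 : ℝ) (0 + 2 * π)) :=
    (Set.Ico_infinite (by simpa using Real.two_pi_pos)).to_subtype
  Infinite.of_injective _ (AddCircle.equivIco (2 * π) 0).symm.injective

theorem infinite_range_expi : (Set.range expi).Infinite := by
  have h1 : Function.Injective expi :=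
    Subtype.val_injective.comp (AddCircle.injective_toCircle Real.two_pi_pos.ne')
  exact Set.infinite_range_of_injective h1

theorem eq_zero_of_evalT_eq_zero {f : (Mat p)[X]} (h : ∀ θ, evalT f θ = 0) : f = 0 := by
  have h1 : matPolyEquiv.symm f = 0 := by
    ext1 i j
    refine eq_zero_of_infinite_isRoot _ (infinite_range_expi.mono ?_)
    rintro _ ⟨θ, rfl⟩
    have h2 := congrFun (congrFun (h θ) i) j
    rw [evalT_eq_evalZ, evalZ_eq_map] at h2
    exact h2
  simpa using h1

theorem evalT_injective {f g : (Mat p)[X]} (h : ∀ θ, evalT f θ = evalT g θ) : f = g :=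
  sub_eq_zero.mp (eq_zero_of_evalT_eq_zero fun θ => by rw [evalT_sub, h, sub_self])

/-- On the circle reversal is an adjoint, and a matrix polynomial is determined by its values there.
-/
theorem rev_mul {m n : ℕ} {f g : (Mat p)[X]} (hf : f.natDegree ≤ m) (hg : g.natDegree ≤ n) :
    rev (m + n) (f * g) = rev n g * rev m f := by
  refine evalT_injective fun θ => ?_
  rw [evalT_rev (natDegree_mul_le.trans (Nat.add_le_add hf hg)), evalT_mul, evalT_mul,
    evalT_rev hf, evalT_rev hg, Matrix.conjTranspose_mul, Matrix.smul_mul, Matrix.mul_smul,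
    smul_smul, pow_add, mul_comm]

section Trunc

/-- The part of degree less than `N` of a matrix polynomial. -/
def lowPart (N : ℕ) (f : (Mat p)[X]) : (Mat p)[X] :=
  ∑ i ∈ Finset.range N, monomial i (f.coeff i)

theorem coeff_lowPart (N : ℕ) (f : (Mat p)[X]) (j : ℕ) :
    (lowPart N f).coeff j = if j < N then f.coeff j else 0 := by
  unfold lowPart
  simp only [finsetSum_coeff, coeff_monomial]
  split_ifs with h
  · rw [Finset.sum_ite_eq_of_mem' _ _ _ (Finset.mem_range.mpr h)]
  · exact Finset.sum_eq_zero fun i hi => if_neg (by have := Finset.mem_range.mp hi; omega)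

end Trunc

theorem isUnit_det_evalT {N : ℕ} {P : (Mat p)[X]} (hP : P.natDegree ≤ N)
    (hz : ∀ z : ℂ, ‖z‖ ≤ 1 → (evalZ (rev N P) z).det ≠ 0) (θ : Torus) :
    IsUnit (evalT P θ).det := by
  rw [isUnit_iff_ne_zero]
  intro h0
  have h1 := normSq_det_evalT_rev hP θ
  rw [h0, map_zero] at h1
  exact hz _ (norm_expi θ).le (Complex.normSq_eq_zero.mp h1)

theorem inv_evalT_conjTranspose {N : ℕ} {P : (Mat p)[X]} (hP : P.natDegree ≤ N) (θ : Torus) :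
    ((evalT P θ)⁻¹)ᴴ = expi θ ^ N • (evalT (rev N P) θ)⁻¹ := by
  have hN := pow_ne_zero N (expi_ne_zero θ)
  rw [evalT_rev hP, Matrix.conjTranspose_nonsing_inv]
  by_cases hu : IsUnit (evalT P θ)ᴴ.det
  · have hx := Matrix.inv_smul' (A := (evalT P θ)ᴴ) (Units.mk0 _ hN) hu
    rw [Units.smul_def, Units.val_mk0] at hx
    rw [hx, Units.smul_def, Units.val_inv_eq_inv_val, Units.val_mk0, smul_smul,
      mul_inv_cancel₀ hN, one_smul]
  -- If `P` is singular at this point, both inverses have the default value `0`.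
  · have hu' : ¬ IsUnit (expi θ ^ N • (evalT P θ)ᴴ).det := by
      rw [Matrix.det_smul]
      rw [isUnit_iff_ne_zero, not_not] at hu ⊢
      rw [hu, mul_zero]
    rw [Matrix.nonsing_inv_apply_not_isUnit _ hu, Matrix.nonsing_inv_apply_not_isUnit _ hu',
      smul_zero]

theorem continuous_inv_of_isUnit {F : Torus → Mat p} (hF : Continuous F)
    (hu : ∀ θ, IsUnit (F θ).det) : Continuous fun θ => (F θ)⁻¹ := by
  simp only [Matrix.inv_def, Ring.inverse_eq_inv']
  exact (hF.matrix_det.inv₀ fun θ => (hu θ).ne_zero).smul hF.matrix_adjugate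

open scoped Matrix.Norms.L2Operator in
theorem eq_zero_of_integral_conjTranspose_mul_self {H : Torus → Mat p} (hH : Continuous H)
    (h : ∫ θ, (H θ)ᴴ * H θ ∂lam0 = 0) (θ : Torus) : H θ = 0 := by
  have hc : Continuous fun θ => (H θ)ᴴ * H θ := hH.matrix_conjTranspose.mul hH
  have htc : Continuous fun θ => ((H θ)ᴴ * H θ).trace.re :=
    Complex.continuous_re.comp hc.matrix_trace
  have h1 : ∫ θ, ((H θ)ᴴ * H θ).trace.re ∂lam0 = 0 := by
    have h2 := integral_re (Continuous.integrable_torus hc.matrix_trace lam0)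
    rw [← integral_matrix_trace (Continuous.integrable_torus hc lam0), h] at h2
    simpa using h2
  have hnn : ∀ θ, 0 ≤ ((H θ)ᴴ * H θ).trace.re := fun θ =>
    PosSemidef.trace_re_nonneg (Matrix.posSemidef_conjTranspose_mul_self _)
  rw [integral_eq_zero_iff_of_nonneg hnn (Continuous.integrable_torus htc lam0)] at h1
  have h3 := congrFun (htc.ae_eq_iff_eq lam0 continuous_const |>.mp h1) θ
  rw [← Matrix.trace_conjTranspose_mul_self_eq_zero_iff]
  exact Complex.ext h3 ((Complex.nonneg_iff.mp
    (Matrix.posSemidef_conjTranspose_mul_self (H θ)).trace_nonneg).2).symm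

open scoped Matrix.Norms.L2Operator in
/-- If `P^* f = f' P` with `f`, `f'` of degree less than `N` and `P^*` invertible on the closed
disc, then `f = 0`. -/
theorem eq_zero_of_rev_mul_eq_mul {N : ℕ} {P f f' : (Mat p)[X]} (hP : P.natDegree ≤ N)
    (hz : ∀ z : ℂ, ‖z‖ ≤ 1 → (evalZ (rev N P) z).det ≠ 0)
    (hf : ∀ j, N ≤ j → f.coeff j = 0) (h : rev N P * f = f' * P) : f = 0 := by
  cases N with
  | zero => exact Polynomial.ext fun j => by simpa using hf j (Nat.zero_le j)
  | succ n =>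
    have hfn : f.natDegree ≤ n := natDegree_le_iff_coeff_eq_zero.mpr fun j hj => hf j hj
    have hu := isUnit_det_evalT hP hz
    set H : Torus → Mat p := fun θ => evalT f θ * (evalT P θ)⁻¹ with hH
    have hHc : Continuous H := (continuous_evalT f).mul
      (continuous_inv_of_isUnit (continuous_evalT P) hu)
    have hH2 : ∀ θ, H θ = (evalT (rev (n + 1) P) θ)⁻¹ * evalT f' θ := by
      intro θ
      have h1 := congrArg (fun q => evalT q θ) h
      simp only [evalT_mul] at h1
      have hu' : IsUnit (evalT (rev (n + 1) P) θ).det :=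
        isUnit_iff_ne_zero.mpr (hz _ (norm_expi θ).le)
      calc H θ = (evalT (rev (n + 1) P) θ)⁻¹ * (evalT (rev (n + 1) P) θ * evalT f θ)
            * (evalT P θ)⁻¹ := by
            rw [Matrix.nonsing_inv_mul_cancel_left _ _ hu']
        _ = _ := by
            rw [h1, Matrix.mul_assoc, Matrix.mul_nonsing_inv_cancel_right _ _ (hu θ)]
    -- On the circle `H† H = z (P^*)⁻¹ f^* (P^*)⁻¹ f'`. A factor `z` is left over because `f` is
    -- reversed at degree `n` and `P` at degree `n + 1`. The function is analytic on the closed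
    -- disc, so its mean is its value `0` at the origin.
    set F : ℂ → Mat p := fun z => Matrix.scalar (Fin p) z * (((evalZ (rev (n + 1) P) z)⁻¹
      * evalZ (rev n f) z) * ((evalZ (rev (n + 1) P) z)⁻¹ * evalZ f' z)) with hF
    have hint : ∫ θ, (H θ)ᴴ * H θ ∂lam0 = 0 := by
      have h1 : ∀ θ, (H θ)ᴴ * H θ = F (expi θ) := by
        intro θ
        simp only [hF]
        rw [hH2 θ, scalar_mul_eq_smul, ← evalT_eq_evalZ, ← evalT_eq_evalZ, ← evalT_eq_evalZ,
          ← hH2 θ, evalT_rev hfn]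
        have h2 : (H θ)ᴴ = ((evalT P θ)⁻¹)ᴴ * (evalT f θ)ᴴ := by
          simp only [hH, Matrix.conjTranspose_mul]
        rw [h2, inv_evalT_conjTranspose hP, Matrix.mul_smul, Matrix.smul_mul, Matrix.smul_mul,
          Matrix.smul_mul, smul_smul, pow_succ']
      simp only [h1]
      rw [integral_matrix_expi]
      · simp [hF]
      · intro z hzz
        refine differentiableAt_matrix_mul ?_ (differentiableAt_matrix_mul
          (differentiableAt_matrix_mul ?_ ?_) (differentiableAt_matrix_mul ?_ ?_))
        · intro i j
          by_cases hij : i = j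
          · subst hij; simp
          · simp [hij]
        · exact differentiableAt_inv_evalZ (hz z hzz)
        · exact fun i j => (differentiable_evalZ _ i j).differentiableAt
        · exact differentiableAt_inv_evalZ (hz z hzz)
        · exact fun i j => (differentiable_evalZ _ i j).differentiableAt
    refine eq_zero_of_evalT_eq_zero fun θ => ?_
    have h0 := eq_zero_of_integral_conjTranspose_mul_self hHc hint θ
    have h1 := Matrix.nonsing_inv_mul_cancel_right (evalT P θ) (evalT f θ) (hu θ)
    rw [← h1, show evalT f θ * (evalT P θ)⁻¹ = 0 from h0, Matrix.zero_mul]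

/-- The `D m` with `|m| ≤ N` are the coefficients of a self-reversed polynomial `A` of degree at
most `2N`, and the hypothesis says that `R = A P` has no coefficients in degrees `N, …, 2N`. In `P^*
R = R' P` with `R' = P^* A = R^*`, the parts of `R` and `R'` below degree `N` then satisfy the same
equation, and `eq_zero_of_rev_mul_eq_mul` annihilates them. The top of `R` is the reversed bottom of
`R'`, so `R = 0` and `A = 0`. -/
theorem moments_eq_zero {N : ℕ} {P : (Mat p)[X]} (hP : P.natDegree ≤ N)
    (hz : ∀ z : ℂ, ‖z‖ ≤ 1 → (evalZ (rev N P) z).det ≠ 0) {D : ℤ → Mat p}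
    (hD : ∀ m, (D m)ᴴ = D (-m))
    (h : ∀ j ≤ N, ∑ k ∈ Finset.range (N + 1), D (k - j) * P.coeff k = 0) {m : ℤ}
    (hm : |m| ≤ N) : D m = 0 := by
  set A : (Mat p)[X] := ∑ i ∈ Finset.range (2 * N + 1), monomial i (D (N - i)) with hA
  have hAc : ∀ i, A.coeff i = if i ≤ 2 * N then D (N - i) else 0 := by
    intro i
    simp only [hA, finsetSum_coeff, coeff_monomial]
    split_ifs with hi
    · rw [Finset.sum_ite_eq_of_mem' _ _ _ (Finset.mem_range.mpr (Nat.lt_succ_of_le hi))]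
    · exact Finset.sum_eq_zero fun k hk => if_neg (by have := Finset.mem_range.mp hk; omega)
  have hAd : A.natDegree ≤ 2 * N := natDegree_le_iff_coeff_eq_zero.mpr fun i hi => by
    rw [hAc, if_neg (by omega)]
  have hArev : rev (2 * N) A = A := by
    ext1 i
    rw [coeff_rev, hAc, hAc]
    split_ifs with h1 h2
    · rw [hD]
      congr 1
      push_cast [Nat.cast_sub h1]
      ring
    · omega
    · rfl
  set R := A * P with hR
  have hRc : ∀ n, N ≤ n → n ≤ 2 * N → R.coeff n = 0 := by
    intro n h1 h2
    rw [hR, coeff_mul, Finset.Nat.sum_antidiagonal_eq_sum_range_succ (fun i j => A.coeff i * P.coeff j),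
      ← Finset.sum_range_reflect]
    rw [← h (n - N) (by omega)]
    rw [← Finset.sum_subset (Finset.range_subset_range.mpr (show N + 1 ≤ n.succ by omega))]
    · refine Finset.sum_congr rfl fun k hk => ?_
      have := Finset.mem_range.mp hk
      rw [hAc, if_pos (by omega)]
      have e1 : n.succ - 1 - k = n - k := by omega
      have e2 : n - (n.succ - 1 - k) = k := by omega
      rw [e2, e1]
      congr 2
      push_cast [Nat.cast_sub (show k ≤ n by omega), Nat.cast_sub h1]
      ring
    · intro k hk hk'
      rw [Finset.mem_range] at hk hk'
      rw [coeff_eq_zero_of_natDegree_lt (p := P), mul_zero]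
      omega
  set R' := rev N P * A with hR'
  have hR'rev : R' = rev (2 * N + N) R := by
    rw [hR, rev_mul hAd hP, hArev]
  have hR'c : ∀ n, R'.coeff n = if n ≤ 3 * N then (R.coeff (3 * N - n))ᴴ else 0 := by
    intro n
    rw [hR'rev, coeff_rev, show 2 * N + N = 3 * N by ring]
  -- Up to degree `2N` the products see only the low parts, since the middle coefficients vanish;
  -- beyond `2N` both sides are zero by degree.
  have hlow : rev N P * lowPart N R = lowPart N R' * P := by
    ext1 n
    by_cases hn : n ≤ 2 * N
    · have h1 : (rev N P * lowPart N R).coeff n = (rev N P * R).coeff n := by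
        rw [coeff_mul, coeff_mul]
        refine Finset.sum_congr rfl fun ij hij => ?_
        have := Finset.HasAntidiagonal.mem_antidiagonal.mp hij
        rw [coeff_lowPart]
        split_ifs with h2
        · rfl
        · rw [hRc _ (by omega) (by omega)]
      have h2 : (lowPart N R' * P).coeff n = (R' * P).coeff n := by
        rw [coeff_mul, coeff_mul]
        refine Finset.sum_congr rfl fun ij hij => ?_
        have := Finset.HasAntidiagonal.mem_antidiagonal.mp hij
        rw [coeff_lowPart]
        split_ifs with h2
        · rfl
        · rw [hR'c, if_pos (by omega), hRc _ (by omega) (by omega), Matrix.conjTranspose_zero]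
      rw [h1, h2, hR, hR', mul_assoc]
    · have hlowd : ∀ f : (Mat p)[X], (lowPart N f).natDegree ≤ N := fun f =>
        natDegree_le_iff_coeff_eq_zero.mpr fun i hi => by rw [coeff_lowPart, if_neg (by omega)]
      rw [coeff_eq_zero_of_natDegree_lt, coeff_eq_zero_of_natDegree_lt]
      · have := natDegree_mul_le (p := lowPart N R') (q := P)
        have := hlowd R'
        omega
      · have := natDegree_mul_le (p := rev N P) (q := lowPart N R)
        have := hlowd R
        have := natDegree_rev_le N P
        omega
  have hRlow : lowPart N R = 0 := eq_zero_of_rev_mul_eq_mul hP hz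
    (fun j hj => by rw [coeff_lowPart, if_neg (by omega)]) hlow
  have hcancel : ∀ f : (Mat p)[X], f * P = 0 → f = 0 := by
    intro f hf
    refine eq_zero_of_evalT_eq_zero fun θ => ?_
    have h1 := congrArg (fun q => evalT q θ) hf
    simp only [evalT_mul] at h1
    rw [← Matrix.mul_nonsing_inv_cancel_right (evalT P θ) (evalT f θ)
      (isUnit_det_evalT hP hz θ), h1]
    simp [evalT]
  have hR'low : lowPart N R' = 0 := hcancel _ (by rw [← hlow, hRlow, mul_zero])
  have hR0 : R = 0 := by
    ext1 n
    rw [coeff_zero]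
    by_cases h1 : n < N
    · have := congrArg (fun q => coeff q n) hRlow
      simpa [coeff_lowPart, h1] using this
    by_cases h2 : n ≤ 2 * N
    · exact hRc n (by omega) h2
    by_cases h3 : n ≤ 3 * N
    · have := congrArg (fun q => coeff q (3 * N - n)) hR'low
      simp only [coeff_lowPart, coeff_zero] at this
      rw [if_pos (by omega), hR'c, if_pos (by omega), Matrix.conjTranspose_eq_zero] at this
      rwa [show 3 * N - (3 * N - n) = n by omega] at this
    · refine coeff_eq_zero_of_natDegree_lt ?_
      have := natDegree_mul_le (p := A) (q := P)
      rw [← hR] at this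
      omega
  have hA0 : A = 0 := hcancel _ hR0
  have h1 := abs_le.mp hm
  have h2 := hAc (N - m).toNat
  rw [hA0, if_pos (by omega), coeff_zero] at h2
  rw [h2]
  congr 1
  omega

theorem integrable_mul_mul {τ : Measure Torus} {M : Torus → Mat p}
    (hM : ∀ i j, Integrable (fun θ => M θ i j) τ) {F G : Torus → Mat p} (hF : Continuous F)
    (hG : Continuous G) : ∀ i j, Integrable (fun θ => (F θ * M θ * G θ) i j) τ := by
  intro i j
  simp only [MatrixMeasure.IsDensity.mul_mul_apply]
  refine integrable_finsetSum _ fun k _ => integrable_finsetSum _ fun l _ => ?_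
  have hc : Continuous fun θ => F θ i k * G θ l j :=
    (Continuous.matrix_apply hF i k).mul (Continuous.matrix_apply hG l j)
  obtain ⟨c, hc'⟩ := isCompact_univ.exists_bound_of_continuousOn hc.continuousOn
  exact (hM k l).bdd_mul (c := c) hc.aestronglyMeasurable
    (ae_of_all _ fun θ => hc' θ (Set.mem_univ θ))

/-! ### Trigonometric moments of a matrix density. -/

section Moment

open scoped Matrix.Norms.L2Operator

/-- The moments `∫ e^{imθ} M(θ) dτ(θ)`. -/
def moment (τ : Measure Torus) (M : Torus → Mat p) (m : ℤ) : Mat p :=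
  ∫ θ, expi θ ^ m • M θ ∂τ

variable {τ : Measure Torus} {M : Torus → Mat p}

theorem continuous_expi_zpow (m : ℤ) : Continuous fun θ => expi θ ^ m :=
  continuous_expi.zpow₀ m fun θ => Or.inl (expi_ne_zero θ)

theorem integrable_zpow_smul_mul_mul (hM : ∀ i j, Integrable (fun θ => M θ i j) τ) (m : ℤ)
    {F G : Torus → Mat p} (hF : Continuous F) (hG : Continuous G) :
    Integrable (fun θ => expi θ ^ m • (F θ * M θ * G θ)) τ := by
  have := integrable_matrix (integrable_mul_mul hM
    (F := fun θ => expi θ ^ m • F θ) ((continuous_expi_zpow m).smul hF) hG)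
  simpa only [Matrix.smul_mul] using this

theorem integrable_zpow_smul (hM : ∀ i j, Integrable (fun θ => M θ i j) τ) (m : ℤ) :
    Integrable (fun θ => expi θ ^ m • M θ) τ := by
  simpa using integrable_zpow_smul_mul_mul hM m (F := fun _ => 1) (G := fun _ => 1)
    continuous_const continuous_const

theorem moment_conjTranspose (hM : ∀ i j, Integrable (fun θ => M θ i j) τ)
    (hH : ∀ θ, (M θ).IsHermitian) (m : ℤ) : (moment τ M m)ᴴ = moment τ M (-m) := by
  unfold moment
  rw [integral_matrix_conjTranspose (integrable_zpow_smul hM m)]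
  simp only [Matrix.conjTranspose_smul, (hH _).eq, star_zpow₀, star_expi, inv_zpow, zpow_neg]

theorem sum_moment_mul_coeff (hM : ∀ i j, Integrable (fun θ => M θ i j) τ) {N : ℕ}
    {P : (Mat p)[X]} (hP : P.natDegree ≤ N) (m : ℤ) :
    ∑ k ∈ Finset.range (N + 1), moment τ M (k + m) * P.coeff k
      = ∫ θ, expi θ ^ m • (M θ * evalT P θ) ∂τ := by
  have h1 : ∀ k : ℕ, moment τ M (k + m) * P.coeff k
      = ∫ θ, expi θ ^ (k + m) • M θ * P.coeff k ∂τ := fun k =>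
    (integral_mul_const_of_integrable (integrable_zpow_smul hM _)).symm
  simp only [h1]
  rw [← integral_finsetSum _ fun k _ => (integrable_zpow_smul hM _).mul_const _]
  congr 1 with θ : 1
  rw [evalT_eq_sum P hP, Matrix.mul_sum, Finset.smul_sum]
  refine Finset.sum_congr rfl fun k _ => ?_
  rw [Matrix.mul_smul, Matrix.smul_mul, smul_smul, add_comm, zpow_add₀ (expi_ne_zero θ),
    zpow_natCast]

theorem integral_evalT_mul_mul (hM : ∀ i j, Integrable (fun θ => M θ i j) τ) {N : ℕ}
    {q r : (Mat p)[X]} (hq : q.natDegree ≤ N) (hr : r.natDegree ≤ N) :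
    ∫ θ, evalT r θ * M θ * (evalT q θ)ᴴ ∂τ
      = ∑ j ∈ Finset.range (N + 1), ∑ k ∈ Finset.range (N + 1),
        r.coeff j * moment τ M (j - k) * (q.coeff k)ᴴ := by
  have h1 : ∀ j k : ℕ, r.coeff j * moment τ M (j - k) * (q.coeff k)ᴴ
      = ∫ θ, r.coeff j * (expi θ ^ (j - k : ℤ) • M θ) * (q.coeff k)ᴴ ∂τ := fun j k => by
    rw [integral_mul_const_of_integrable ((integrable_zpow_smul hM _).const_mul _),
      integral_const_mul_of_integrable (integrable_zpow_smul hM _), moment]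
  simp only [h1]
  have h2 : ∀ j k : ℕ, Integrable
      (fun θ => r.coeff j * (expi θ ^ (j - k : ℤ) • M θ) * (q.coeff k)ᴴ) τ := fun j k =>
    ((integrable_zpow_smul hM _).const_mul _).mul_const _
  simp_rw [← integral_finsetSum _ fun k _ => h2 _ k]
  rw [← integral_finsetSum _ fun j _ => integrable_finsetSum _ fun k _ => h2 j k]
  congr 1 with θ : 1
  rw [evalT_eq_sum r hr, evalT_eq_sum q hq, Matrix.conjTranspose_sum, Matrix.sum_mul,
    Matrix.sum_mul]
  refine Finset.sum_congr rfl fun j _ => ?_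
  rw [Matrix.mul_sum]
  refine Finset.sum_congr rfl fun k _ => ?_
  rw [Matrix.conjTranspose_smul, Matrix.smul_mul, Matrix.smul_mul, Matrix.mul_smul,
    Matrix.mul_smul, Matrix.smul_mul, smul_smul, star_pow, star_expi, zpow_sub₀ (expi_ne_zero θ),
    zpow_natCast, zpow_natCast, inv_pow, div_eq_mul_inv, mul_comm]

end Moment

/-- The density of the Bernstein–Szegő measure of a matrix polynomial. -/
def bsDensity (P : (Mat p)[X]) (θ : Torus) : Mat p := ((evalT P θ)⁻¹)ᴴ * (evalT P θ)⁻¹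

theorem posSemidef_bsDensity (P : (Mat p)[X]) (θ : Torus) : (bsDensity P θ).PosSemidef :=
  Matrix.posSemidef_conjTranspose_mul_self _

namespace MatrixMeasure.IsOrthonormalPair

open scoped Matrix.Norms.L2Operator

variable {μ : MatrixMeasure p} {N : ℕ} {P b : (Mat p)[X]}

theorem isUnit_det_evalT (hμ : μ.Nontrivial) (h : μ.IsOrthonormalPair N P b) (θ : Torus) :
    IsUnit (evalT P θ).det :=
  MatrixOPUC.isUnit_det_evalT h.natDegree_right (fun _ hz => h.det_evalZ_rev_ne_zero hμ hz) θ

theorem continuous_bsDensity (hμ : μ.Nontrivial) (h : μ.IsOrthonormalPair N P b) :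
    Continuous (bsDensity P) := by
  have hc := continuous_inv_of_isUnit (continuous_evalT P) (h.isUnit_det_evalT hμ)
  exact hc.matrix_conjTranspose.mul hc

/-- With `W` the Bernstein–Szegő density, `W P = (P⁻¹)† = z^N (P^*)⁻¹`. The integrand `z^{N-j}
(P^*)⁻¹` is analytic on the closed disc, and its mean is its value at `0`. -/
theorem integral_zpow_smul_bsDensity (hμ : μ.Nontrivial) (h : μ.IsOrthonormalPair N P b) {j : ℕ}
    (hj : j ≤ N) : ∫ θ, expi θ ^ (-j : ℤ) • (bsDensity P θ * evalT P θ) ∂lam0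
      = if j = N then ((P.coeff N)ᴴ)⁻¹ else 0 := by
  set F : ℂ → Mat p := fun z => Matrix.scalar (Fin p) (z ^ (N - j)) * (evalZ (rev N P) z)⁻¹ with hF
  have h1 : ∀ θ, expi θ ^ (-j : ℤ) • (bsDensity P θ * evalT P θ) = F (expi θ) := by
    intro θ
    unfold bsDensity
    rw [Matrix.nonsing_inv_mul_cancel_right _ _ (h.isUnit_det_evalT hμ θ),
      inv_evalT_conjTranspose h.natDegree_right, smul_smul, zpow_neg, zpow_natCast]
    simp only [hF]
    rw [scalar_mul_eq_smul, ← evalT_eq_evalZ, pow_sub₀ _ (expi_ne_zero θ) hj, mul_comm]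
  simp only [h1]
  rw [integral_matrix_expi]
  · simp only [hF, evalZ_zero, coeff_zero_rev]
    split_ifs with hjN
    · rw [hjN, Nat.sub_self, pow_zero, map_one, one_mul]
    · rw [zero_pow (by omega), map_zero, zero_mul]
  · intro z hz
    refine differentiableAt_matrix_mul ?_ (differentiableAt_inv_evalZ
      (h.det_evalZ_rev_ne_zero hμ hz))
    intro i k
    by_cases hik : i = k
    · subst hik
      simp
    · simp [hik]

/-- The values agree with those of `integral_zpow_smul_bsDensity`. For `j = N`, the polynomials `P`
and `X^N κ` differ by lower degree, so both have product `1` with `P`. -/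
theorem innerR_X_pow (h : μ.IsOrthonormalPair N P b) {j : ℕ} (hj : j ≤ N) :
    μ.innerR (X ^ j) P = if j = N then ((P.coeff N)ᴴ)⁻¹ else 0 := by
  split_ifs with hjN
  · subst hjN
    refine (Matrix.inv_eq_right_inv ?_).symm
    rw [← innerR_C_left]
    have h1 : μ.innerR (P - X ^ j * C (P.coeff j)) P = 0 := by
      by_cases h0 : P - X ^ j * C (P.coeff j) = 0
      · rw [h0, innerR_zero_left]
      · refine innerR_eq_zero_of_natDegree_lt (k := j) μ ?_ h.orthogonal_right
        have hd : (P - X ^ j * C (P.coeff j)).natDegree ≤ j :=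
          (natDegree_sub_le _ _).trans (max_le h.natDegree_right
            ((natDegree_mul_C_le _ _).trans (natDegree_X_pow_le _)))
        refine lt_of_le_of_ne hd fun hj => h0 ?_
        rw [← leadingCoeff_eq_zero, leadingCoeff, hj, coeff_sub, coeff_mul_C, coeff_X_pow,
          if_pos rfl, one_mul, sub_self]
    rw [innerR_sub_left, h.norm_right, sub_eq_zero] at h1
    exact h1.symm
  · exact h.orthogonal_right j (by omega)

/-- Both measures give `P` the same products with `1, …, X^N`, so the differences of the moments
solve the homogeneous system of `moments_eq_zero`. -/
theorem moment_bsDensity {τ : Measure Torus} {M : Torus → Mat p} (hμ : μ.Nontrivial)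
    (h : μ.IsOrthonormalPair N P b) (hM : μ.IsDensity τ M) {m : ℤ} (hm : |m| ≤ N) :
    moment lam0 (bsDensity P) m = moment τ M m := by
  have hiM : ∀ i j, Integrable (fun θ => M θ i j) τ := fun i j =>
    have := hM.finite
    Integrable.of_bound (hM.measurable i j).aestronglyMeasurable 1
      (ae_of_all _ fun θ => hM.norm_le θ i j)
  have hiW : ∀ i j, Integrable (fun θ => bsDensity P θ i j) lam0 := fun i j =>
    Continuous.integrable_torus (Continuous.matrix_apply (h.continuous_bsDensity hμ) i j) _
  refine (sub_eq_zero.mp (moments_eq_zero (D := fun m => moment lam0 (bsDensity P) m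
    - moment τ M m) h.natDegree_right (fun _ hz => h.det_evalZ_rev_ne_zero hμ hz) ?_ ?_ hm))
  · intro m
    rw [Matrix.conjTranspose_sub, moment_conjTranspose hiW fun θ => (posSemidef_bsDensity P θ).1,
      moment_conjTranspose hiM fun θ => (hM.posSemidef θ).1]
  · intro j hj
    simp only [sub_mul, Finset.sum_sub_distrib, sub_eq_add_neg ((_ : ℕ) : ℤ)]
    rw [sum_moment_mul_coeff hiW h.natDegree_right, sum_moment_mul_coeff hiM h.natDegree_right,
      h.integral_zpow_smul_bsDensity hμ hj, ← h.innerR_X_pow hj, hM.innerR_eq, sub_eq_zero]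
    congr 1 with θ : 1
    have : evalT (X ^ j : (Mat p)[X]) θ = expi θ ^ j • 1 := by
      rw [← mul_one (X ^ j), evalT_X_pow_mul, evalT_one]
    rw [this, Matrix.conjTranspose_smul, Matrix.conjTranspose_one, Matrix.smul_mul,
      Matrix.smul_mul, Matrix.one_mul, star_pow, star_expi, zpow_neg, zpow_natCast, inv_pow]

theorem integral_bsDensity (hμ : μ.Nontrivial) (h : μ.IsOrthonormalPair N P b)
    {q r : (Mat p)[X]} (hq : q.natDegree ≤ N) (hr : r.natDegree ≤ N) :
    ∫ θ, evalT r θ * bsDensity P θ * (evalT q θ)ᴴ ∂lam0 = μ.innerL q r := by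
  obtain ⟨τ, M, hM⟩ := μ.exists_isDensity
  have hiM : ∀ i j, Integrable (fun θ => M θ i j) τ := fun i j =>
    have := hM.finite
    Integrable.of_bound (hM.measurable i j).aestronglyMeasurable 1
      (ae_of_all _ fun θ => hM.norm_le θ i j)
  have hiW : ∀ i j, Integrable (fun θ => bsDensity P θ i j) lam0 := fun i j =>
    Continuous.integrable_torus (Continuous.matrix_apply (h.continuous_bsDensity hμ) i j) _
  rw [hM.innerL_eq, integral_evalT_mul_mul hiW hq hr, integral_evalT_mul_mul hiM hq hr]
  refine Finset.sum_congr rfl fun j hj => Finset.sum_congr rfl fun k hk => ?_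
  rw [h.moment_bsDensity hμ hM]
  have := Finset.mem_range.mp hj
  have := Finset.mem_range.mp hk
  rw [abs_le]
  omega

end MatrixMeasure.IsOrthonormalPair

end MatrixOPUC

end

/-! ## The upper bound for the entropy integral -/

noncomputable section

namespace MatrixOPUC

variable {p : ℕ} {μ : MatrixMeasure p} {τ : Measure Torus} {M : Torus → Mat p}

open scoped Matrix.Norms.L2Operator in
-- The trace of `F` is real, hence `cos θ tr F = Re tr (e^{iθ} F)`.
theorem integral_weight_mul_trace (g : ℝ) {F : Torus → Mat p}
    (hF : ∀ i j, Integrable (fun θ => F θ i j) τ) (hF0 : ∀ θ, (F θ).PosSemidef) {A B : Mat p}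
    (hA : ∫ θ, F θ ∂τ = A) (hB : ∫ θ, expi θ • F θ ∂τ = B) :
    Integrable (fun θ => weight g θ * (F θ).trace.re) τ ∧
    ∫ θ, weight g θ * (F θ).trace.re ∂τ = A.trace.re - g * B.trace.re := by
  have h1 := integrable_matrix hF
  have h2 : Integrable (fun θ => expi θ • F θ) τ := by
    simpa using integrable_zpow_smul hF 1
  have htr : ∀ {G : Torus → Mat p}, Integrable G τ → Integrable (fun θ => (G θ).trace) τ :=
    fun hG => integrable_finsetSum _ fun i _ => Integrable.matrix_apply hG i i
  have h3 : ∀ θ, weight g θ * (F θ).trace.re = (F θ).trace.re - g * (expi θ • F θ).trace.re := by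
    intro θ
    have him : (F θ).trace.im = 0 := ((Complex.nonneg_iff.mp (hF0 θ).trace_nonneg).2).symm
    rw [Matrix.trace_smul, smul_eq_mul, Complex.mul_re, him, weight, cosT]
    ring
  have i1 : Integrable (fun θ => (F θ).trace.re) τ := (htr h1).re
  have i2 : Integrable (fun θ => (expi θ • F θ).trace.re) τ := (htr h2).re
  simp only [h3]
  refine ⟨i1.sub (i2.const_mul g), ?_⟩
  rw [integral_sub i1 (i2.const_mul g), integral_const_mul, ← hA, ← hB,
    integral_matrix_trace h1, integral_matrix_trace h2]
  have e1 := integral_re (htr h1)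
  have e2 := integral_re (htr h2)
  simp only [RCLike.re_eq_complex_re] at e1 e2
  rw [e1, e2]

namespace MatrixMeasure.IsDensity

theorem integrable_apply (hM : μ.IsDensity τ M) (i j : Fin p) :
    Integrable (fun θ => M θ i j) τ :=
  have := hM.finite
  Integrable.of_bound (hM.measurable i j).aestronglyMeasurable 1
    (ae_of_all _ fun θ => hM.norm_le θ i j)

theorem density_ae_eq (hM : μ.IsDensity τ M) (σ : Measure Torus) [IsFiniteMeasure σ] :
    ∀ᵐ θ ∂σ, μ.density σ θ = ((τ.rnDeriv σ θ).toReal : ℂ) • M θ := by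
  have := hM.finite
  have h1 : ∀ i j, ∀ᵐ θ ∂σ, (μ.entry i j).rnDeriv σ θ = (τ.rnDeriv σ θ).toReal * M θ i j :=
    fun i j => complexMeasure_rnDeriv_withDensity (hM.integrable_apply i j) (hM.eq_withDensity i j)
  filter_upwards [ae_all_iff.mpr fun i => ae_all_iff.mpr (h1 i)] with θ hθ
  ext i j
  exact hθ i j

theorem integral_weight_innerR (hM : μ.IsDensity τ M) (g : ℝ) (q : (Mat p)[X]) :
    Integrable (fun θ => weight g θ * ((evalT q θ)ᴴ * M θ * evalT q θ).trace.re) τ ∧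
    ∫ θ, weight g θ * ((evalT q θ)ᴴ * M θ * evalT q θ).trace.re ∂τ
      = (μ.innerR q q).trace.re - g * (μ.innerR q (X * q)).trace.re := by
  refine integral_weight_mul_trace g (fun i j => ?_) (fun θ => ?_) ?_ ?_
  · exact integrable_mul_mul hM.integrable_apply (continuous_evalT q).matrix_conjTranspose
      (continuous_evalT q) i j
  · exact (hM.posSemidef θ).conjTranspose_mul_mul_same _
  · exact (hM.innerR_eq q q).symm
  · rw [hM.innerR_eq]
    simp only [evalT_X_mul, Matrix.mul_smul]

theorem integral_weight_innerL (hM : μ.IsDensity τ M) (g : ℝ) (q : (Mat p)[X]) :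
    Integrable (fun θ => weight g θ * (evalT q θ * M θ * (evalT q θ)ᴴ).trace.re) τ ∧
    ∫ θ, weight g θ * (evalT q θ * M θ * (evalT q θ)ᴴ).trace.re ∂τ
      = (μ.innerL q q).trace.re - g * (μ.innerL q (X * q)).trace.re := by
  refine integral_weight_mul_trace g (fun i j => ?_) (fun θ => ?_) ?_ ?_
  · exact integrable_mul_mul hM.integrable_apply (continuous_evalT q)
      (continuous_evalT q).matrix_conjTranspose i j
  · exact (hM.posSemidef θ).mul_mul_conjTranspose_same _
  · exact (hM.innerL_eq q q).symm
  · rw [hM.innerL_eq]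
    simp only [evalT_X_mul, Matrix.smul_mul]

end MatrixMeasure.IsDensity

theorem MatrixMeasure.posSemidef_density (μ : MatrixMeasure p) (σ : Measure Torus)
    [IsFiniteMeasure σ] : ∀ᵐ θ ∂σ, (μ.density σ θ).PosSemidef := by
  obtain ⟨τ, M, hM⟩ := μ.exists_isDensity
  filter_upwards [hM.density_ae_eq σ] with θ hθ
  rw [hθ]
  exact (hM.posSemidef θ).smul (Complex.zero_le_real.mpr ENNReal.toReal_nonneg)

theorem MatrixMeasure.measurable_density (μ : MatrixMeasure p) (σ : Measure Torus)
    (i j : Fin p) : Measurable fun θ => μ.density σ θ i j :=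
  measurable_complex_rnDeriv _ _

/-- This is `log_det_le_trace_sub` for `A† w A`, whose determinant is `|det A|² det w`. -/
theorem log_det_conjTranspose_mul_mul {w A : Mat p} (hw : w.PosSemidef) (hdet : 0 < w.det.re)
    (hA : A.det ≠ 0) :
    Real.log w.det.re ≤ (Aᴴ * w * A).trace.re - p - Real.log (Complex.normSq A.det) := by
  have hwd : w.PosDef := by
    rw [hw.posDef_iff_det_ne_zero]
    intro h0
    rw [h0] at hdet
    exact lt_irrefl _ hdet
  have hpd : (Aᴴ * w * A).PosDef := by
    rw [(hw.conjTranspose_mul_mul_same A).posDef_iff_det_ne_zero, Matrix.det_mul, Matrix.det_mul,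
      Matrix.det_conjTranspose]
    exact mul_ne_zero (mul_ne_zero (star_ne_zero.mpr hA) hwd.det_pos.ne') hA
  have h1 := PosDef.log_det_le_trace_sub hpd
  have h2 : (Aᴴ * w * A).det.re = Complex.normSq A.det * w.det.re := by
    have : (Aᴴ * w * A).det = (Complex.normSq A.det : ℂ) * w.det := by
      rw [Matrix.det_mul, Matrix.det_mul, Matrix.det_conjTranspose,
        Complex.normSq_eq_conj_mul_self]
      simp only [starRingEnd_apply]
      ring
    rw [this, Complex.re_ofReal_mul]
  rw [h2, Real.log_mul (Complex.normSq_pos.mpr hA).ne' hdet.ne', Fintype.card_fin] at h1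
  linarith

theorem TSum_succ (α : ℕ → Mat p) (N : ℕ) :
    TSum α (N + 1) = TSum α N - (α N * (α (N + 1))ᴴ).trace.re := by
  unfold TSum
  rw [Finset.sum_range_succ]
  simp only [Matrix.trace_sub, Matrix.trace_add, Complex.sub_re, Complex.add_re]
  ring

/-- Dropping the singular part lowers the integral of a nonnegative function. This is how `μ_s`
leaves the bound of the entropy integral by the partial sums. -/
theorem MatrixMeasure.IsDensity.integral_rnDeriv_mul_le (hM : μ.IsDensity τ M) {f : Torus → ℝ}
    (hf : Integrable f τ) (hf0 : ∀ θ, 0 ≤ f θ) :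
    Integrable (fun θ => (τ.rnDeriv lam0 θ).toReal * f θ) lam0 ∧
    ∫ θ, (τ.rnDeriv lam0 θ).toReal * f θ ∂lam0 ≤ ∫ θ, f θ ∂τ := by
  have := hM.finite
  refine ⟨integrable_rnDeriv_mul hf, ?_⟩
  have h1 := setIntegral_eq_singularPart_add (σ := lam0) hf MeasurableSet.univ
  simp only [Measure.restrict_univ, smul_eq_mul] at h1
  rw [h1]
  have : 0 ≤ ∫ θ, f θ ∂(τ.singularPart lam0) := integral_nonneg hf0
  linarith

/-- The upper bound for the entropy integral by the partial sums. -/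
theorem IsSzegoSystem.integral_log_det_le (hμ : μ.Nontrivial) {α : ℕ → Mat p}
    {a b : ℕ → (Mat p)[X]} (h : IsSzegoSystem μ α a b) {g : ℝ} (hg : |g| ≤ 1)
    (hpos : ∀ᵐ θ ∂lam0, 0 < (μ.density lam0 θ).det.re)
    (hint : Integrable (fun θ => weight g θ * Real.log (μ.density lam0 θ).det.re) lam0) (N : ℕ) :
    ∫ θ, weight g θ * Real.log (μ.density lam0 θ).det.re ∂lam0
      ≤ logDetSum α (N + 1) - g * TSum α (N + 1) := by
  obtain ⟨τ, M, hM⟩ := μ.exists_isDensity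
  set P := a (N + 1) with hP
  have hpair := h.pair (N + 1)
  have hdet : ∀ θ, (evalT P θ).det ≠ 0 := fun θ => (hpair.isUnit_det_evalT hμ θ).ne_zero
  obtain ⟨i1, e1⟩ := hM.integral_weight_innerR g P
  obtain ⟨i2, e2⟩ := hM.integral_rnDeriv_mul_le i1 fun θ => mul_nonneg (weight_nonneg hg θ)
    (PosSemidef.trace_re_nonneg ((hM.posSemidef θ).conjTranspose_mul_mul_same _))
  have hlogc : Continuous fun θ => Real.log (Complex.normSq (evalT P θ).det) :=
    (Complex.continuous_normSq.comp (continuous_evalT P).matrix_det).log fun θ =>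
      (Complex.normSq_pos.mpr (hdet θ)).ne'
  have i3 : Integrable (fun θ => weight g θ * Real.log (Complex.normSq (evalT P θ).det)) lam0 :=
    Continuous.integrable_torus ((continuous_weight g).mul hlogc) _
  have i4 : Integrable (fun θ => weight g θ * p) lam0 :=
    (Continuous.integrable_torus (continuous_weight g) _).mul_const _
  have hle : ∀ᵐ θ ∂lam0, weight g θ * Real.log (μ.density lam0 θ).det.re
      ≤ (τ.rnDeriv lam0 θ).toReal * (weight g θ * ((evalT P θ)ᴴ * M θ * evalT P θ).trace.re)
        - weight g θ * p - weight g θ * Real.log (Complex.normSq (evalT P θ).det) := by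
    filter_upwards [hpos, hM.density_ae_eq lam0, μ.posSemidef_density lam0] with θ h1 h2 h3
    have h4 := mul_le_mul_of_nonneg_left (log_det_conjTranspose_mul_mul h3 h1 (hdet θ))
      (weight_nonneg hg θ)
    refine h4.trans (le_of_eq ?_)
    rw [h2, Matrix.mul_smul, Matrix.smul_mul, Matrix.trace_smul, smul_eq_mul,
      Complex.re_ofReal_mul]
    ring
  have h5 := integral_mono_ae hint ((i2.sub i4).sub i3) hle
  rw [integral_sub' (i2.sub i4) i3, integral_sub' i2 i4, integral_mul_const, integral_weight, one_mul,
    hP, h.integral_weight_mul_log_det hμ g N] at h5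
  -- The norm contributes `p`, which cancels the constant, and `-g Re tr ⟨⟨P, zP⟩⟩_R = g Re tr (α_N
  -- α_{N+1}†)` turns `T_N` into `T_{N+1}`.
  rw [hP, hpair.norm_right, h.innerR_X_mul_self, Matrix.trace_one, Matrix.trace_neg] at e1
  simp only [Fintype.card_fin, Complex.natCast_re, Complex.neg_re] at e1
  rw [hP, e1] at e2
  rw [TSum_succ]
  linarith

end MatrixOPUC

end

/-! ## The variational bound and trigonometric approximation -/

noncomputable section

namespace MatrixOPUC

variable {p : ℕ} {μ : MatrixMeasure p} {τ : Measure Torus} {M : Torus → Mat p}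

theorem posDef_add_smul_one {A : Mat p} (hA : A.PosSemidef) {δ : ℝ} (hδ : 0 < δ) :
    (A + (δ : ℂ) • 1).PosDef :=
  Matrix.PosDef.posSemidef_add hA (Matrix.PosDef.one.smul (by exact_mod_cast hδ))

theorem continuous_log_det {F : Torus → Mat p} (hF : Continuous F) (h : ∀ θ, (F θ).PosDef) :
    Continuous fun θ => Real.log (F θ).det.re :=
  (Complex.continuous_re.comp hF.matrix_det).log fun θ => (PosDef.det_re_pos (h θ)).ne'

/-- The variational upper bound for the partial sums. -/
theorem IsSzegoSystem.logDetSum_sub_le (hμ : μ.Nontrivial) {α : ℕ → Mat p}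
    {a b : ℕ → (Mat p)[X]} (h : IsSzegoSystem μ α a b) {g : ℝ} (hg : |g| ≤ 1)
    (hM : μ.IsDensity τ M) {N : ℕ} {q : (Mat p)[X]} (hq : q.natDegree ≤ N) {δ : ℝ} (hδ : 0 < δ) :
    logDetSum α (N + 1) - g * TSum α N
      ≤ ∫ θ, weight g θ * (evalT q θ * M θ * (evalT q θ)ᴴ).trace.re ∂τ
        + δ * ∫ θ, weight g θ * (M θ).trace.re ∂τ - p
        - ∫ θ, weight g θ * Real.log ((evalT q θ)ᴴ * evalT q θ + (δ : ℂ) • 1).det.re ∂lam0 := by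
  set P := a (N + 1) with hP
  have hpair := h.pair (N + 1)
  have hdet : ∀ θ, (evalT P θ).det ≠ 0 := fun θ => (hpair.isUnit_det_evalT hμ θ).ne_zero
  have hWc := hpair.continuous_bsDensity hμ
  have hWpd : ∀ θ, (bsDensity P θ).PosDef := fun θ => by
    rw [(posSemidef_bsDensity P θ).posDef_iff_det_ne_zero, bsDensity, Matrix.det_mul,
      Matrix.det_conjTranspose, Matrix.det_nonsing_inv, Ring.inverse_eq_inv']
    exact mul_ne_zero (star_ne_zero.mpr (inv_ne_zero (hdet θ))) (inv_ne_zero (hdet θ))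
  have hlogW : ∀ θ, Real.log (bsDensity P θ).det.re
      = -Real.log (Complex.normSq (evalT P θ).det) := fun θ => by
    rw [bsDensity, Matrix.det_mul, Matrix.det_conjTranspose, Matrix.det_nonsing_inv,
      Ring.inverse_eq_inv', ← Real.log_inv, ← Complex.normSq_inv]
    congr 1
    have := Complex.normSq_eq_conj_mul_self (z := (evalT P θ).det⁻¹)
    rw [starRingEnd_apply] at this
    rw [← this, Complex.ofReal_re]
  -- The weight contains `e^{iθ}`, so `X r` is tested besides `r`; agreement of moments up to order
  -- `N + 1` therefore allows degree `N` for `r`.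
  have hbs : ∀ r : (Mat p)[X], r.natDegree ≤ N →
      Integrable (fun θ => weight g θ * (evalT r θ * bsDensity P θ * (evalT r θ)ᴴ).trace.re) lam0 ∧
      ∫ θ, weight g θ * (evalT r θ * bsDensity P θ * (evalT r θ)ᴴ).trace.re ∂lam0
        = ∫ θ, weight g θ * (evalT r θ * M θ * (evalT r θ)ᴴ).trace.re ∂τ := by
    intro r hr
    have hXr : (X * r).natDegree ≤ N + 1 :=
      natDegree_mul_le.trans (by have := natDegree_X_le (R := Mat p); omega)
    rw [(hM.integral_weight_innerL g r).2]
    refine integral_weight_mul_trace g (fun i j => ?_) (fun θ => ?_) ?_ ?_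
    · exact Continuous.integrable_torus (Continuous.matrix_apply
        (((continuous_evalT r).mul hWc).mul (continuous_evalT r).matrix_conjTranspose) i j) _
    · exact (posSemidef_bsDensity P θ).mul_mul_conjTranspose_same _
    · exact hpair.integral_bsDensity hμ (hr.trans (Nat.le_succ N)) (hr.trans (Nat.le_succ N))
    · rw [← hpair.integral_bsDensity hμ (hr.trans (Nat.le_succ N)) hXr]
      simp only [evalT_X_mul, Matrix.smul_mul, ← hP]
  obtain ⟨i1, e1⟩ := hbs q hq
  obtain ⟨i2, e2⟩ := hbs 1 (by simp)
  simp only [evalT_one, Matrix.one_mul, Matrix.conjTranspose_one, Matrix.mul_one] at i2 e2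
  -- The summand `δ` keeps the trial density positive definite where `q` is singular.
  have hfpd : ∀ θ, ((evalT q θ)ᴴ * evalT q θ + (δ : ℂ) • 1).PosDef := fun θ =>
    posDef_add_smul_one (Matrix.posSemidef_conjTranspose_mul_self _) hδ
  have i3 : Integrable (fun θ => weight g θ *
      Real.log ((evalT q θ)ᴴ * evalT q θ + (δ : ℂ) • 1).det.re) lam0 :=
    Continuous.integrable_torus ((continuous_weight g).mul (continuous_log_det
      (((continuous_evalT q).matrix_conjTranspose.mul (continuous_evalT q)).add continuous_const)
      hfpd)) _
  have i4 : Integrable (fun θ => weight g θ * p) lam0 :=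
    (Continuous.integrable_torus (continuous_weight g) _).mul_const _
  have i5 : Integrable (fun θ => weight g θ * Real.log (bsDensity P θ).det.re) lam0 :=
    Continuous.integrable_torus ((continuous_weight g).mul (continuous_log_det hWc hWpd)) _
  have hle : ∀ θ, weight g θ * Real.log (bsDensity P θ).det.re
      ≤ weight g θ * (evalT q θ * bsDensity P θ * (evalT q θ)ᴴ).trace.re
        + δ * (weight g θ * (bsDensity P θ).trace.re) - weight g θ * p
        - weight g θ * Real.log ((evalT q θ)ᴴ * evalT q θ + (δ : ℂ) • 1).det.re := by
    intro θ
    have h1 := PosDef.log_det_add_log_det_le (hfpd θ) (hWpd θ)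
    rw [add_mul, Matrix.trace_add, Matrix.smul_mul, Matrix.one_mul, Matrix.trace_smul,
      Matrix.mul_assoc, Matrix.trace_mul_comm, Complex.add_re, smul_eq_mul, Complex.re_ofReal_mul,
      Fintype.card_fin] at h1
    have h2 := mul_le_mul_of_nonneg_left h1 (weight_nonneg hg θ)
    linarith
  have h5 := integral_mono i5 (((i1.add (i2.const_mul δ)).sub i4).sub i3) hle
  rw [integral_sub' ((i1.add (i2.const_mul δ)).sub i4) i3, integral_sub' (i1.add (i2.const_mul δ)) i4,
    integral_add' i1 (i2.const_mul δ), integral_const_mul, integral_mul_const, integral_weight,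
    one_mul, e1, e2] at h5
  simp only [hlogW, mul_neg, integral_neg] at h5
  rw [hP, h.integral_weight_mul_log_det hμ g N, neg_neg] at h5
  exact h5

/-! ### Mean-square approximation by trigonometric matrix polynomials. -/

section Approximation

/-- Negative frequencies are cleared by a power of `z`. Allowing every larger power lets finitely
many functions share one. -/
theorem exists_polynomial_of_mem_span_fourier {f : C(Torus, ℂ)}
    (hf : f ∈ Submodule.span ℂ (Set.range (@fourier (2 * π)))) :
    ∃ K : ℕ, ∀ K' ≥ K, ∃ r : ℂ[X], ∀ θ, expi θ ^ K' * f θ = r.eval (expi θ) := by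
  induction hf using Submodule.span_induction with
  | mem f hf =>
    obtain ⟨n, rfl⟩ := hf
    refine ⟨n.natAbs, fun K' hK' => ⟨X ^ (K' + n).toNat, fun θ => ?_⟩⟩
    have h1 : fourier n θ = expi θ ^ n := by
      rw [fourier_apply, AddCircle.toCircle_zsmul]
      simp [expi]
    rw [h1, eval_pow, eval_X, ← zpow_natCast, ← zpow_natCast, ← zpow_add₀ (expi_ne_zero θ)]
    congr 1
    omega
  | zero => exact ⟨0, fun K' _ => ⟨0, fun θ => by simp⟩⟩
  | add f g _ _ hf hg =>
    obtain ⟨K, hK⟩ := hf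
    obtain ⟨L, hL⟩ := hg
    refine ⟨max K L, fun K' hK' => ?_⟩
    obtain ⟨r, hr⟩ := hK K' (le_of_max_le_left hK')
    obtain ⟨s, hs⟩ := hL K' (le_of_max_le_right hK')
    exact ⟨r + s, fun θ => by rw [eval_add, ← hr, ← hs, ContinuousMap.add_apply, mul_add]⟩
  | smul c f _ hf =>
    obtain ⟨K, hK⟩ := hf
    refine ⟨K, fun K' hK' => ?_⟩
    obtain ⟨r, hr⟩ := hK K' hK'
    exact ⟨C c * r, fun θ => by
      rw [eval_mul, eval_C, ← hr, ContinuousMap.smul_apply, smul_eq_mul]; ring⟩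

/-- Bounded continuous functions are dense in `L²`, and trigonometric polynomials are uniformly
dense among the continuous ones. -/
theorem exists_mem_span_fourier_integral_le {ν : Measure Torus} [IsFiniteMeasure ν]
    {u : Torus → ℂ} (hu : MemLp u 2 ν) {κ : ℝ} (hκ : 0 < κ) :
    ∃ f ∈ Submodule.span ℂ (Set.range (@fourier (2 * π))),
      ∫ θ, ‖f θ - u θ‖ ^ 2 ∂ν ≤ κ := by
  obtain ⟨g, hg, hg2⟩ := (show MemLp u (ENNReal.ofReal 2) ν by simpa using hu)
    |>.exists_boundedContinuous_integral_rpow_sub_le two_pos (show 0 < κ / 4 by positivity)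
  set V := ν.real Set.univ with hV
  have hV0 : 0 ≤ V := measureReal_nonneg
  -- The squared error is at most twice the sum of two squared errors: one integrates to at most `κ
  -- / 4`, the other is uniformly at most `s²`, with `s` chosen so that `2 V s² ≤ κ / 2`.
  set s := Real.sqrt (κ / (4 * (V + 1))) with hs
  have hs0 : 0 < s := Real.sqrt_pos.mpr (by positivity)
  have hs2 : s ^ 2 = κ / (4 * (V + 1)) := Real.sq_sqrt (by positivity)
  have hmem : g.toContinuousMap ∈ (Submodule.span ℂ (Set.range (@fourier (2 * π)))).topologicalClosure := by
    rw [span_fourier_closure_eq_top]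
    trivial
  obtain ⟨f, hf, hfg⟩ := Metric.mem_closure_iff.mp hmem s hs0
  refine ⟨f, hf, ?_⟩
  have hpt : ∀ θ, ‖f θ - u θ‖ ^ 2 ≤ 2 * ‖u θ - g θ‖ ^ (2 : ℝ) + 2 * s ^ 2 := by
    intro θ
    rw [Real.rpow_two]
    have h1 : ‖f θ - g θ‖ ≤ s := by
      rw [← dist_eq_norm, dist_comm]
      exact (ContinuousMap.dist_apply_le_dist θ).trans hfg.le
    have h2 : ‖f θ - u θ‖ ≤ ‖u θ - g θ‖ + s := by
      have : f θ - u θ = (f θ - g θ) - (u θ - g θ) := by ring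
      rw [this]
      linarith [norm_sub_le (f θ - g θ) (u θ - g θ)]
    nlinarith [norm_nonneg (f θ - u θ), norm_nonneg (u θ - g θ), sq_nonneg (‖u θ - g θ‖ - s)]
  have hi : Integrable (fun θ => ‖u θ - g θ‖ ^ (2 : ℝ)) ν := by
    have h3 : MemLp (fun θ => u θ - g θ) 2 ν := hu.sub (by simpa using hg2)
    have := h3.integrable_norm_rpow (by simp) (by simp)
    simpa using this
  calc ∫ θ, ‖f θ - u θ‖ ^ 2 ∂ν
      ≤ ∫ θ, (2 * ‖u θ - g θ‖ ^ (2 : ℝ) + 2 * s ^ 2) ∂ν :=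
        integral_mono_of_nonneg (ae_of_all _ fun θ => sq_nonneg _)
          ((hi.const_mul 2).add (integrable_const _)) (ae_of_all _ hpt)
    _ = 2 * ∫ θ, ‖u θ - g θ‖ ^ (2 : ℝ) ∂ν + V * (2 * s ^ 2) := by
        rw [integral_add (hi.const_mul 2) (integrable_const _), integral_const_mul,
          integral_const, smul_eq_mul]
    _ ≤ κ := by
        have h4 : V * (2 * s ^ 2) ≤ κ / 2 := by
          rw [hs2]
          have : V * (2 * (κ / (4 * (V + 1)))) = κ / 2 * (V / (V + 1)) := by
            field_simp
            ring
          rw [this]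
          exact mul_le_of_le_one_right (by positivity) ((div_le_one (by positivity)).mpr (by linarith))
        linarith

theorem evalT_matPolyEquiv (R : Matrix (Fin p) (Fin p) ℂ[X]) (θ : Torus) (i j : Fin p) :
    evalT (matPolyEquiv R) θ i j = (R i j).eval (expi θ) :=
  matPolyEquiv_eval R (expi θ) i j

/-- Approximation of a square integrable matrix function by matrix polynomials, up to a unimodular
factor. -/
theorem exists_evalT_approx {ν : Measure Torus} [IsFiniteMeasure ν] {G : Torus → Mat p}
    (hG : ∀ i j, MemLp (fun θ => G θ i j) 2 ν) {κ : ℝ} (hκ : 0 < κ) :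
    ∃ (q : (Mat p)[X]) (K : ℕ), ∀ i j,
      ∫ θ, ‖(expi θ ^ K)⁻¹ * evalT q θ i j - G θ i j‖ ^ 2 ∂ν ≤ κ := by
  choose f hf hfG using fun i j => exists_mem_span_fourier_integral_le (hG i j) hκ
  choose K hK using fun i j => exists_polynomial_of_mem_span_fourier (hf i j)
  set L := ∑ i, ∑ j, K i j with hL
  have hKL : ∀ i j, L ≥ K i j := fun i j =>
    (Finset.single_le_sum (f := fun j => K i j) (fun _ _ => Nat.zero_le _)
      (Finset.mem_univ j)).trans
    (Finset.single_le_sum (f := fun i => ∑ j, K i j) (fun _ _ => Nat.zero_le _)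
      (Finset.mem_univ i))
  choose r hr using fun i j => hK i j L (hKL i j)
  refine ⟨matPolyEquiv (Matrix.of r), L, fun i j => ?_⟩
  refine le_of_eq_of_le ?_ (hfG i j)
  congr 1 with θ : 1
  rw [evalT_matPolyEquiv, Matrix.of_apply, ← hr, inv_mul_cancel_left₀
    (pow_ne_zero _ (expi_ne_zero θ))]

end Approximation

end MatrixOPUC

end

/-! ## Regularized densities -/

noncomputable section

namespace MatrixOPUC

variable {p : ℕ} {μ : MatrixMeasure p} {τ : Measure Torus} {M : Torus → Mat p}

theorem measurable_det {A : Torus → Mat p} (hA : ∀ i j, Measurable fun θ => A θ i j) :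
    Measurable fun θ => (A θ).det := by
  simp only [Matrix.det_apply]
  exact Finset.measurable_sum _ fun σ _ =>
    (Finset.measurable_prod _ fun i _ => hA _ _).const_smul _

theorem measurable_inv_apply {A : Torus → Mat p} (hA : ∀ i j, Measurable fun θ => A θ i j)
    (i j : Fin p) : Measurable fun θ => (A θ)⁻¹ i j := by
  simp only [Matrix.inv_def, Ring.inverse_eq_inv', Matrix.smul_apply, smul_eq_mul,
    Matrix.adjugate_apply]
  refine (measurable_det hA).inv.mul (measurable_det fun k l => ?_)
  simp only [Matrix.updateRow_apply]
  split_ifs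
  · exact measurable_const
  · exact hA k l

open scoped Matrix.Norms.L2Operator in
-- The square root is continuous on positive semidefinite matrices.
theorem measurable_sqrt_apply {A : Torus → Mat p} (hA : ∀ i j, Measurable fun θ => A θ i j)
    (hpsd : ∀ θ, (A θ).PosSemidef) (i j : Fin p) : Measurable fun θ => CFC.sqrt (A θ) i j := by
  let _ : MeasurableSpace (Mat p) := borel _
  have _ : BorelSpace (Mat p) := ⟨rfl⟩
  have hAm : Measurable A := by
    have : A = fun θ => ∑ i, ∑ j, A θ i j • Matrix.single i j (1 : ℂ) := by
      funext θ
      conv_lhs => rw [Matrix.matrix_eq_sum_single (A θ)]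
      simp [Matrix.smul_single]
    rw [this]
    exact Finset.measurable_sum _ fun i _ => Finset.measurable_sum _ fun j _ =>
      (continuous_id.smul continuous_const : Continuous fun c : ℂ =>
        c • (Matrix.single i j (1 : ℂ) : Mat p)).measurable.comp (hA i j)
  have hc : Continuous fun a : {a : Mat p // 0 ≤ a} => CFC.sqrt (a : Mat p) i j :=
    (continuous_apply_apply i j).comp (continuousOn_iff_continuous_domRestrict.mp
      (CFC.continuousOn_sqrt (A := Mat p)))
  exact hc.measurable.comp
    (hAm.subtype_mk (h := fun θ => Matrix.nonneg_iff_posSemidef.mpr (hpsd θ)))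

/-! ### Pointwise matrix estimates. -/

section Pointwise

theorem trace_mul_mul_conjTranspose (Q A : Mat p) :
    (Q * A * Qᴴ).trace = ∑ i, ∑ l, ∑ k, A k l * (star (Q i l) * Q i k) := by
  simp only [Matrix.trace, Matrix.diag, Matrix.mul_apply, Matrix.conjTranspose_apply,
    Finset.sum_mul]
  refine Finset.sum_congr rfl fun i _ => Finset.sum_congr rfl fun l _ =>
    Finset.sum_congr rfl fun k _ => ?_
  ring

theorem trace_mul_mul_conjTranspose_le {Q G A : Mat p} {c E : ℝ} (hA : ∀ k l, ‖A k l‖ ≤ c)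
    (hE : ∀ i j k l, ‖star (Q i j) * Q k l - star (G i j) * G k l‖ ≤ E) :
    (Q * A * Qᴴ).trace.re ≤ (G * A * Gᴴ).trace.re + p ^ 3 * (c * E) := by
  have h1 : (Q * A * Qᴴ).trace - (G * A * Gᴴ).trace
      = ∑ i, ∑ l, ∑ k, A k l * (star (Q i l) * Q i k - star (G i l) * G i k) := by
    simp only [trace_mul_mul_conjTranspose, mul_sub, Finset.sum_sub_distrib]
  have h2 : ‖(Q * A * Qᴴ).trace - (G * A * Gᴴ).trace‖ ≤ p ^ 3 * (c * E) := by
    rw [h1]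
    have h3 : ∀ i l k, ‖A k l * (star (Q i l) * Q i k - star (G i l) * G i k)‖ ≤ c * E :=
      fun i l k => by
        rw [norm_mul]
        exact mul_le_mul (hA k l) (hE _ _ _ _) (norm_nonneg _) ((norm_nonneg _).trans (hA k l))
    refine (norm_sum_le_of_le _ fun i _ => norm_sum_le_of_le _ fun l _ =>
      norm_sum_le_of_le _ fun k _ => h3 i l k).trans (le_of_eq ?_)
    simp
    ring
  have h4 := (Complex.re_le_norm _).trans h2
  rw [Complex.sub_re] at h4
  linarith

theorem add_smul_one_inv_posDef {B : Mat p} (hB : B.PosSemidef) {δ : ℝ} (hδ : 0 < δ) :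
    ((B + (δ : ℂ) • 1)⁻¹).PosDef := (posDef_add_smul_one hB hδ).inv

/-- Take the trace of `(B + δ) (B + δ)⁻¹ = 1`. -/
theorem trace_inv_add {B : Mat p} (hB : B.PosSemidef) {δ : ℝ} (hδ : 0 < δ) :
    (B * (B + (δ : ℂ) • 1)⁻¹).trace.re + δ * (B + (δ : ℂ) • 1)⁻¹.trace.re = p := by
  have hu := (Matrix.isUnit_iff_isUnit_det _).mp (posDef_add_smul_one hB hδ).isUnit
  have h1 := congrArg (fun A : Mat p => A.trace.re) (Matrix.mul_nonsing_inv _ hu)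
  simpa [add_mul, Matrix.trace_add, Matrix.trace_smul] using h1

theorem trace_inv_add_le {B : Mat p} (hB : B.PosSemidef) {δ : ℝ} (hδ : 0 < δ) :
    (B + (δ : ℂ) • 1)⁻¹.trace.re ≤ p / δ := by
  have h1 := trace_inv_add hB hδ
  have h2 := PosSemidef.trace_mul_re_nonneg hB (add_smul_one_inv_posDef hB hδ).posSemidef
  rw [le_div_iff₀ hδ]
  linarith

theorem log_det_inv {A : Mat p} (hA : A.PosDef) : Real.log A⁻¹.det.re = -Real.log A.det.re := by
  rw [Matrix.det_nonsing_inv, Ring.inverse_eq_inv', ← PosSemidef.ofReal_det_re hA.posSemidef,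
    ← Complex.ofReal_inv, Complex.ofReal_re, Complex.ofReal_re, Real.log_inv]

/-- By `log_det_add_log_det_le` the difference of the two sides is at most `tr (A (A + δ)⁻¹) - p =
-δ tr (A + δ)⁻¹ ≤ 0`. -/
theorem log_det_le_log_det_add {A : Mat p} (hA : A.PosDef) {δ : ℝ} (hδ : 0 < δ) :
    Real.log A.det.re ≤ Real.log (A + (δ : ℂ) • 1).det.re := by
  have hF := posDef_add_smul_one hA.posSemidef hδ
  have h1 := PosDef.log_det_add_log_det_le hA hF.inv
  have h2 := trace_inv_add hA.posSemidef hδ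
  have h3 := PosSemidef.trace_re_nonneg hF.inv.posSemidef
  rw [log_det_inv hF, Fintype.card_fin] at h1
  nlinarith

/-- With `f = Q† Q + δ` and `F = G† G + δ` one has `log det F - log det f ≤ tr (F f⁻¹) - p = tr ((G†
G - Q† Q) f⁻¹)`, where the entries of `f⁻¹` are at most `p / δ`. Monotonicity gives `log det F ≥
-log det (B + ε)`. -/
theorem neg_log_det_le {B Q G : Mat p} (hB : B.PosSemidef) {ε δ E : ℝ} (hε : 0 < ε) (hδ : 0 < δ)
    (hG : Gᴴ * G = (B + (ε : ℂ) • 1)⁻¹)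
    (hE : ∀ i j k l, ‖star (Q i j) * Q k l - star (G i j) * G k l‖ ≤ E) :
    -Real.log (Qᴴ * Q + (δ : ℂ) • 1).det.re
      ≤ Real.log (B + (ε : ℂ) • 1).det.re + p ^ 3 * (p / δ * E) := by
  have hA := add_smul_one_inv_posDef hB hε
  have hQ := Matrix.posSemidef_conjTranspose_mul_self Q
  have hf := posDef_add_smul_one hQ hδ
  have hF := posDef_add_smul_one hA.posSemidef hδ
  have h1 := log_det_le_log_det_add hA hδ
  rw [log_det_inv (posDef_add_smul_one hB hε)] at h1
  have h2 := PosDef.log_det_add_log_det_le hF hf.inv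
  rw [log_det_inv hf, Fintype.card_fin, ← hG] at h2
  have h3 := trace_inv_add hQ hδ
  have h4 : ((Gᴴ * G + (δ : ℂ) • 1) * (Qᴴ * Q + (δ : ℂ) • 1)⁻¹).trace.re
      = (G * (Qᴴ * Q + (δ : ℂ) • 1)⁻¹ * Gᴴ).trace.re
        + δ * (Qᴴ * Q + (δ : ℂ) • 1)⁻¹.trace.re := by
    rw [add_mul, Matrix.trace_add, Matrix.smul_mul, Matrix.one_mul, Matrix.trace_smul,
      Matrix.mul_assoc, Matrix.trace_mul_comm, Complex.add_re, smul_eq_mul, Complex.re_ofReal_mul]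
  have h5 : (Qᴴ * Q * (Qᴴ * Q + (δ : ℂ) • 1)⁻¹).trace.re
      = (Q * (Qᴴ * Q + (δ : ℂ) • 1)⁻¹ * Qᴴ).trace.re := by
    rw [Matrix.mul_assoc, Matrix.trace_mul_comm]
  have h6 := trace_mul_mul_conjTranspose_le (Q := G) (G := Q) (A := (Qᴴ * Q + (δ : ℂ) • 1)⁻¹)
    (c := p / δ) (E := E)
    (fun k l => (PosSemidef.norm_apply_le_trace hf.inv.posSemidef k l).trans
      (trace_inv_add_le hQ hδ)) (fun i j k l => by rw [norm_sub_rev]; exact hE i j k l)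
  rw [← hG] at h1
  linarith

/-- Apply `log_det_le_trace_sub` to `B + ε` for the upper bound and to its inverse for the lower
one. It makes the regularized entropy integrable. -/
theorem abs_log_det_add_le {B : Mat p} (hB : B.PosSemidef) {ε : ℝ} (hε : 0 < ε) :
    |Real.log (B + (ε : ℂ) • 1).det.re| ≤ B.trace.re + p * ε + p / ε := by
  have hf := posDef_add_smul_one hB hε
  have h1 := PosDef.log_det_le_trace_sub hf
  have h2 := PosDef.log_det_le_trace_sub hf.inv
  rw [log_det_inv hf, Fintype.card_fin] at h2
  have h3 := trace_inv_add_le hB hε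
  have h4 := PosSemidef.trace_re_nonneg hB
  have hp : (0 : ℝ) ≤ p := Nat.cast_nonneg p
  have hpe : (0 : ℝ) ≤ p / ε := by positivity
  have hpe' : (0 : ℝ) ≤ p * ε := by positivity
  have h5 : (B + (ε : ℂ) • 1).trace.re = B.trace.re + p * ε := by
    simp [Matrix.trace_add, Matrix.trace_smul, mul_comm]
  rw [h5, Fintype.card_fin] at h1
  rw [abs_le]
  constructor <;> linarith

end Pointwise

/-- The error of a product has terms linear in the errors of the factors; `t ≤ s / 2 + t² / (2s)`
trades them for squares plus a small constant, so that mean-square approximation suffices. -/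
theorem norm_star_mul_sub_le {x y u v : ℂ} {c s : ℝ} (hu : ‖u‖ ≤ c) (hv : ‖v‖ ≤ c) (hs : 0 < s) :
    ‖star x * y - star u * v‖
      ≤ (1 / 2 + c / (2 * s)) * (‖x - u‖ ^ 2 + ‖y - v‖ ^ 2) + c * s := by
  have hc : 0 ≤ c := (norm_nonneg u).trans hu
  have h1 : star x * y - star u * v
      = star (x - u) * (y - v) + star (x - u) * v + star u * (y - v) := by
    rw [star_sub]; ring
  have h2 : ‖star x * y - star u * v‖ ≤ ‖x - u‖ * ‖y - v‖ + ‖x - u‖ * c + c * ‖y - v‖ := by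
    rw [h1]
    refine (norm_add₃_le).trans ?_
    simp only [norm_mul, norm_star]
    gcongr
  have hamgm : ∀ t : ℝ, t ≤ s / 2 + t ^ 2 / (2 * s) := fun t => by
    have : s / 2 + t ^ 2 / (2 * s) - t = (s - t) ^ 2 / (2 * s) := by field_simp; ring
    have h : 0 ≤ (s - t) ^ 2 / (2 * s) := by positivity
    linarith
  have h3 := mul_le_mul_of_nonneg_left (hamgm ‖x - u‖) hc
  have h4 := mul_le_mul_of_nonneg_left (hamgm ‖y - v‖) hc
  have h5 : ‖x - u‖ * ‖y - v‖ ≤ (‖x - u‖ ^ 2 + ‖y - v‖ ^ 2) / 2 := by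
    nlinarith [sq_nonneg (‖x - u‖ - ‖y - v‖)]
  have h6 : (1 / 2 + c / (2 * s)) * (‖x - u‖ ^ 2 + ‖y - v‖ ^ 2) + c * s
      = (‖x - u‖ ^ 2 + ‖y - v‖ ^ 2) / 2 + c * (s / 2 + ‖x - u‖ ^ 2 / (2 * s))
        + c * (s / 2 + ‖y - v‖ ^ 2 / (2 * s)) := by
    field_simp
    ring
  rw [h6]
  linarith

/-- Approximation of the products of the entries of a bounded matrix function by those of a
matrix polynomial. -/
theorem exists_evalT_product_approx {ν : Measure Torus} [IsFiniteMeasure ν] {G : Torus → Mat p}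
    (hG : ∀ i j, Measurable fun θ => G θ i j) {c : ℝ} (hc : ∀ θ i j, ‖G θ i j‖ ≤ c)
    {κ : ℝ} (hκ : 0 < κ) :
    ∃ (q : (Mat p)[X]) (E : Torus → ℝ), Integrable E ν ∧ ∫ θ, E θ ∂ν ≤ κ ∧ (∀ θ, 0 ≤ E θ) ∧
      ∀ θ i j k l, ‖star (evalT q θ i j) * evalT q θ k l - star (G θ i j) * G θ k l‖ ≤ E θ := by
  set c' := |c| with hc'
  have hcc : ∀ θ i j, ‖G θ i j‖ ≤ c' := fun θ i j => (hc θ i j).trans (le_abs_self c)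
  have hc0 : 0 ≤ c' := abs_nonneg c
  set V := ν.real Set.univ with hV
  have hV0 : 0 ≤ V := measureReal_nonneg
  -- With squared error at most `s²` in each entry and `s ≤ 1`, the integral of `E` is at most `s
  -- (p² (1 + c') + c' V)`. The number `B` exceeds the bracket, and `s ≤ κ / B`.
  set B : ℝ := p ^ 2 * (1 + c') + c' * V + 1 with hB
  have hB0 : 0 < B := by positivity
  set s := min 1 (κ / B) with hs
  have hs0 : 0 < s := lt_min one_pos (by positivity)
  have hs1 : s ≤ 1 := min_le_left _ _
  have hsB : s * B ≤ κ := by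
    rw [← le_div_iff₀ hB0]
    exact min_le_right _ _
  have hmem : ∀ i j, MemLp (fun θ => G θ i j) 2 ν := fun i j =>
    MemLp.of_bound (hG i j).aestronglyMeasurable c (ae_of_all _ fun θ => hc θ i j)
  obtain ⟨q, K, hq⟩ := exists_evalT_approx hmem (sq_pos_of_pos hs0)
  have hcont : ∀ i j, Continuous fun θ => (expi θ ^ K)⁻¹ * evalT q θ i j := fun i j =>
    ((continuous_expi.pow K).inv₀ fun θ => pow_ne_zero _ (expi_ne_zero θ)).mul
      (Continuous.matrix_apply (continuous_evalT q) i j)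
  have hint : ∀ i j, Integrable (fun θ => ‖(expi θ ^ K)⁻¹ * evalT q θ i j - G θ i j‖ ^ 2) ν := by
    intro i j
    have h1 : MemLp (fun θ => (expi θ ^ K)⁻¹ * evalT q θ i j) 2 ν := by
      obtain ⟨d, hd⟩ := isCompact_univ.exists_bound_of_continuousOn (hcont i j).continuousOn
      exact MemLp.of_bound (hcont i j).aestronglyMeasurable d
        (ae_of_all _ fun θ => hd θ (Set.mem_univ θ))
    have := (h1.sub (hmem i j)).integrable_norm_rpow (by simp) (by simp)
    simpa using this
  set e : Torus → ℝ := fun θ => ∑ i, ∑ j, ‖(expi θ ^ K)⁻¹ * evalT q θ i j - G θ i j‖ ^ 2 with he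
  have hei : Integrable e ν :=
    integrable_finsetSum _ fun i _ => integrable_finsetSum _ fun j _ => hint i j
  have hele : ∀ θ i j, ‖(expi θ ^ K)⁻¹ * evalT q θ i j - G θ i j‖ ^ 2 ≤ e θ := fun θ i j =>
    (Finset.single_le_sum (f := fun j => ‖(expi θ ^ K)⁻¹ * evalT q θ i j - G θ i j‖ ^ 2)
      (fun _ _ => sq_nonneg _) (Finset.mem_univ j)).trans
    (Finset.single_le_sum
      (f := fun i => ∑ j, ‖(expi θ ^ K)⁻¹ * evalT q θ i j - G θ i j‖ ^ 2)
      (fun _ _ => Finset.sum_nonneg fun _ _ => sq_nonneg _) (Finset.mem_univ i))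
  have he0 : ∀ θ, 0 ≤ e θ := fun θ =>
    Finset.sum_nonneg fun _ _ => Finset.sum_nonneg fun _ _ => sq_nonneg _
  have heint : ∫ θ, e θ ∂ν ≤ p ^ 2 * s ^ 2 := by
    simp only [he]
    rw [integral_finsetSum _ fun i _ => integrable_finsetSum _ fun j _ => hint i j]
    simp_rw [integral_finsetSum _ fun j _ => hint _ j]
    refine (Finset.sum_le_sum fun i _ => Finset.sum_le_sum fun j _ => hq i j).trans (le_of_eq ?_)
    simp
    ring
  have hei2 : Integrable (fun θ => e θ + e θ) ν := hei.add hei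
  refine ⟨q, fun θ => (1 / 2 + c' / (2 * s)) * (e θ + e θ) + c' * s,
    (hei2.const_mul _).add (integrable_const _), ?_, ?_, ?_⟩
  · rw [integral_add (hei2.const_mul _) (integrable_const _), integral_const_mul,
      integral_add hei hei, integral_const, smul_eq_mul]
    have h1 : (1 / 2 + c' / (2 * s)) * (∫ θ, e θ ∂ν + ∫ θ, e θ ∂ν)
        = (1 + c' / s) * ∫ θ, e θ ∂ν := by
      field_simp
      ring
    have h2 : (1 + c' / s) * ∫ θ, e θ ∂ν ≤ (1 + c' / s) * (p ^ 2 * s ^ 2) :=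
      mul_le_mul_of_nonneg_left heint (by positivity)
    have h3 : (1 + c' / s) * (p ^ 2 * s ^ 2) = s * (p ^ 2 * (s + c')) := by
      field_simp
    have h4 : s * (p ^ 2 * (s + c')) ≤ s * (p ^ 2 * (1 + c')) := by gcongr
    rw [h1]
    have h5 : s * B = s * (p ^ 2 * (1 + c')) + V * (c' * s) + s := by rw [hB]; ring
    change _ + V * (c' * s) ≤ κ
    linarith
  · intro θ
    have := he0 θ
    positivity
  · intro θ i j k l
    have hz := pow_ne_zero K (expi_ne_zero θ)
    -- The factor `z^{-K}` is unimodular and cancels in products of this form.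
    have h1 : star (evalT q θ i j) * evalT q θ k l
        = star ((expi θ ^ K)⁻¹ * evalT q θ i j) * ((expi θ ^ K)⁻¹ * evalT q θ k l) := by
      rw [star_mul', star_inv₀, star_pow, star_expi, inv_pow, inv_inv]
      field_simp
    rw [h1]
    refine (norm_star_mul_sub_le (hcc θ i j) (hcc θ k l) hs0).trans ?_
    exact add_le_add (mul_le_mul_of_nonneg_left (add_le_add (hele θ i j) (hele θ k l))
      (by positivity)) le_rfl

end MatrixOPUC

end

/-! ## The asymptotic bound for the partial sums -/

noncomputable section

namespace MatrixOPUC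

variable {p : ℕ} {μ : MatrixMeasure p} {τ : Measure Torus} {M : Torus → Mat p}

theorem MatrixMeasure.integrable_density (μ : MatrixMeasure p) (σ : Measure Torus)
    [IsFiniteMeasure σ] (i j : Fin p) : Integrable (fun θ => μ.density σ θ i j) σ :=
  ComplexMeasure.integrable_rnDeriv _ _

theorem MatrixMeasure.integrable_trace_density (μ : MatrixMeasure p) (σ : Measure Torus)
    [IsFiniteMeasure σ] : Integrable (fun θ => (μ.density σ θ).trace.re) σ :=
  (integrable_finsetSum _ fun i _ => μ.integrable_density σ i i).re

theorem measurable_log_det_add {A : Torus → Mat p} (hA : ∀ i j, Measurable fun θ => A θ i j)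
    (B : Mat p) : Measurable fun θ => Real.log (A θ + B).det.re :=
  Real.measurable_log.comp (Complex.measurable_re.comp
    (measurable_det fun i j => (hA i j).add_const _))

theorem MatrixMeasure.integrable_weight_log_det_density_add (μ : MatrixMeasure p) {g : ℝ}
    (hg : |g| ≤ 1) {ε : ℝ} (hε : 0 < ε) :
    Integrable (fun θ => weight g θ * Real.log (μ.density lam0 θ + (ε : ℂ) • 1).det.re) lam0 := by
  have h1 : Integrable (fun θ => Real.log (μ.density lam0 θ + (ε : ℂ) • 1).det.re) lam0 := by
    refine Integrable.mono' (g := fun θ => (μ.density lam0 θ).trace.re + p * ε + p / ε)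
      (((μ.integrable_trace_density lam0).add (integrable_const _)).add (integrable_const _))
      (measurable_log_det_add (μ.measurable_density lam0) _).aestronglyMeasurable ?_
    filter_upwards [μ.posSemidef_density lam0] with θ hθ
    exact abs_log_det_add_le hθ hε
  refine h1.bdd_mul (c := 2) (continuous_weight g).aestronglyMeasurable (ae_of_all _ fun θ => ?_)
  rw [Real.norm_eq_abs, abs_of_nonneg (weight_nonneg hg θ)]
  exact weight_le hg θ

theorem norm_apply_sq_le_trace (G : Mat p) (i j : Fin p) : ‖G i j‖ ^ 2 ≤ (Gᴴ * G).trace.re := by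
  have h1 : (Gᴴ * G).trace.re = ∑ j, ∑ i, ‖G i j‖ ^ 2 := by
    simp only [Matrix.trace, Matrix.diag, Matrix.mul_apply, Matrix.conjTranspose_apply,
      Complex.re_sum]
    refine Finset.sum_congr rfl fun j _ => Finset.sum_congr rfl fun i _ => ?_
    rw [← Complex.normSq_eq_norm_sq, ← Complex.ofReal_re (Complex.normSq _),
      Complex.normSq_eq_conj_mul_self]
    rfl
  rw [h1]
  exact (Finset.single_le_sum (f := fun i => ‖G i j‖ ^ 2)
      (fun _ _ => sq_nonneg _) (Finset.mem_univ i)).trans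
    (Finset.single_le_sum (f := fun j => ∑ i, ‖G i j‖ ^ 2)
      (fun _ _ => Finset.sum_nonneg fun _ _ => sq_nonneg _) (Finset.mem_univ j))

theorem weight_mul_integral_le {g : ℝ} (hg : |g| ≤ 1) {σ ν : Measure Torus} (hσν : σ ≤ ν)
    {E : Torus → ℝ} (hE : Integrable E ν) (hE0 : ∀ θ, 0 ≤ E θ) :
    Integrable (fun θ => weight g θ * E θ) σ ∧
    ∫ θ, weight g θ * E θ ∂σ ≤ 2 * ∫ θ, E θ ∂ν := by
  have h1 : Integrable E σ := hE.mono_measure hσν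
  have h2 : Integrable (fun θ => weight g θ * E θ) σ := by
    refine h1.bdd_mul (c := 2) (continuous_weight g).aestronglyMeasurable
      (ae_of_all _ fun θ => ?_)
    rw [Real.norm_eq_abs, abs_of_nonneg (weight_nonneg hg θ)]
    exact weight_le hg θ
  refine ⟨h2, ?_⟩
  calc ∫ θ, weight g θ * E θ ∂σ ≤ ∫ θ, 2 * E θ ∂σ :=
        integral_mono h2 (h1.const_mul 2) fun θ =>
          mul_le_mul_of_nonneg_right (weight_le hg θ) (hE0 θ)
    _ = 2 * ∫ θ, E θ ∂σ := integral_const_mul _ _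
    _ ≤ 2 * ∫ θ, E θ ∂ν := by
        have := integral_mono_measure hσν (ae_of_all _ hE0) hE
        linarith

/-- The partial sums are asymptotically bounded by the regularized entropy integral. -/
theorem IsSzegoSystem.eventually_le (hμ : μ.Nontrivial) {α : ℕ → Mat p}
    {a b : ℕ → (Mat p)[X]} (h : IsSzegoSystem μ α a b) {g : ℝ} (hg : |g| ≤ 1) {ε η : ℝ}
    (hε : 0 < ε) (hη : 0 < η) :
    ∀ᶠ N in atTop, logDetSum α (N + 1) - g * TSum α N
      ≤ ∫ θ, weight g θ * Real.log (μ.density lam0 θ + (ε : ℂ) • 1).det.re ∂lam0 + η := by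
  obtain ⟨τ, M, hM⟩ := μ.exists_isDensity
  have := hM.finite
  -- `Z` has full Lebesgue measure and is null for the singular part of `τ`.
  obtain ⟨Z, hZ, hZ1, hZ2⟩ := Measure.mutuallySingular_singularPart τ lam0
  set w : Torus → Mat p := fun θ => ((τ.rnDeriv lam0 θ).toReal : ℂ) • M θ with hw
  have hwpsd : ∀ θ, (w θ).PosSemidef := fun θ =>
    (hM.posSemidef θ).smul (Complex.zero_le_real.mpr ENNReal.toReal_nonneg)
  have hwm : ∀ i j, Measurable fun θ => w θ i j := fun i j =>
    (Complex.measurable_ofReal.comp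
      (Measure.measurable_rnDeriv τ lam0).ennreal_toReal).mul (hM.measurable i j)
  set A : Torus → Mat p := fun θ => (w θ + (ε : ℂ) • 1)⁻¹ with hA
  have hApd : ∀ θ, (A θ).PosDef := fun θ => add_smul_one_inv_posDef (hwpsd θ) hε
  have hAm : ∀ i j, Measurable fun θ => A θ i j :=
    measurable_inv_apply fun i j => (hwm i j).add_const _
  set S : Torus → Mat p := fun θ => CFC.sqrt (A θ) with hS
  have hSm : ∀ i j, Measurable fun θ => S θ i j :=
    measurable_sqrt_apply hAm fun θ => (hApd θ).posSemidef
  have hSS : ∀ θ, S θ * S θ = A θ := fun θ =>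
    CFC.sqrt_mul_sqrt_self _ (Matrix.nonneg_iff_posSemidef.mpr (hApd θ).posSemidef)
  have hSH : ∀ θ, (S θ)ᴴ = S θ := fun θ =>
    (Matrix.nonneg_iff_posSemidef.mp (CFC.sqrt_nonneg (A θ))).1.eq
  -- The target of the approximation: `G† G` is `(w + ε)⁻¹` on `Z`, where `log det` then reproduces
  -- the regularized entropy, and `0` off `Z`, so the singular part costs nothing.
  set G : Torus → Mat p := Z.indicator S with hG
  have hGm : ∀ i j, Measurable fun θ => G θ i j := by
    intro i j
    have : (fun θ => G θ i j) = Z.indicator fun θ => S θ i j := by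
      funext θ
      by_cases hθ : θ ∈ Z <;> simp [hG, hθ]
    rw [this]
    exact (hSm i j).indicator hZ
  have hGb : ∀ θ i j, ‖G θ i j‖ ≤ Real.sqrt (p / ε) := by
    intro θ i j
    refine Real.le_sqrt_of_sq_le ?_
    by_cases hθ : θ ∈ Z
    · simp only [hG, Set.indicator_of_mem hθ]
      refine (norm_apply_sq_le_trace _ i j).trans ?_
      rw [hSH, hSS]
      exact trace_inv_add_le (hwpsd θ) hε
    · simp only [hG, Set.indicator_of_notMem hθ, Matrix.zero_apply, norm_zero,
        ne_eq, OfNat.ofNat_ne_zero, not_false_eq_true, zero_pow]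
      positivity
  set TM := ∫ θ, weight g θ * (M θ).trace.re ∂τ with hTM
  have hTM0 : 0 ≤ TM := integral_nonneg fun θ =>
    mul_nonneg (weight_nonneg hg θ) (PosSemidef.trace_re_nonneg (hM.posSemidef θ))
  -- The term `δ TM` of the variational bound receives half of `η`; the other half is for the
  -- approximation error.
  set δ := η / 2 / (TM + 1) with hδ
  have hδ0 : 0 < δ := by positivity
  have hδη : δ * TM ≤ η / 2 := by
    rw [hδ, div_mul_eq_mul_div, div_le_iff₀ (by positivity)]
    nlinarith
  -- The quadratic term contributes `2 p³ ∫ E` and the logarithm `2 p³ (p / δ) ∫ E`, the factor `2`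
  -- bounding the weight.
  set B : ℝ := 2 * p ^ 3 * (1 + p / δ) + 1 with hB
  have hB0 : 0 < B := by positivity
  -- The error must be small for both measures: the quadratic term is integrated against `τ`, the
  -- logarithm against `λ₀`.
  obtain ⟨q, E, hEi, hEκ, hE0, hE⟩ := exists_evalT_product_approx (ν := τ + lam0) hGm hGb
    (κ := η / 2 / B) (by positivity)
  have hEB : (∫ θ, E θ ∂(τ + lam0)) * B ≤ η / 2 := by
    rwa [le_div_iff₀ hB0] at hEκ
  obtain ⟨iτ, eτ⟩ := weight_mul_integral_le hg (Measure.le_add_right le_rfl : τ ≤ τ + lam0) hEi hE0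
  obtain ⟨i0, e0⟩ := weight_mul_integral_le hg (Measure.le_add_left le_rfl : lam0 ≤ τ + lam0) hEi hE0
  have hGG : ∀ θ ∈ Z, (G θ)ᴴ * G θ = A θ := fun θ hθ => by
    simp only [hG, Set.indicator_of_mem hθ, hSH, hSS]
  -- On `Z` only the absolutely continuous part counts, and there the integrand is the weight times
  -- `tr ((w + ε)⁻¹ w) ≤ p`.
  have hsing : Integrable (fun θ => Z.indicator (fun θ => weight g θ * (A θ * M θ).trace.re) θ) τ ∧
      ∫ θ, Z.indicator (fun θ => weight g θ * (A θ * M θ).trace.re) θ ∂τ ≤ p := by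
    have hAb : ∀ θ i j, ‖A θ i j‖ ≤ p / ε := fun θ i j =>
      (PosSemidef.norm_apply_le_trace (hApd θ).posSemidef i j).trans (trace_inv_add_le (hwpsd θ) hε)
    have i1 : Integrable (fun θ => (A θ * M θ).trace) τ := by
      simp only [Matrix.trace, Matrix.diag, Matrix.mul_apply]
      exact integrable_finsetSum _ fun i _ => integrable_finsetSum _ fun k _ =>
        (hM.integrable_apply k i).bdd_mul (c := p / ε) (hAm i k).aestronglyMeasurable
          (ae_of_all _ fun θ => hAb θ i k)
    have hnn : ∀ θ, 0 ≤ weight g θ * (A θ * M θ).trace.re := fun θ =>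
      mul_nonneg (weight_nonneg hg θ)
        (PosSemidef.trace_mul_re_nonneg (hApd θ).posSemidef (hM.posSemidef θ))
    have i2 : Integrable (fun θ => weight g θ * (A θ * M θ).trace.re) τ := by
      refine i1.re.bdd_mul (c := 2) (continuous_weight g).aestronglyMeasurable
        (ae_of_all _ fun θ => ?_)
      rw [Real.norm_eq_abs, abs_of_nonneg (weight_nonneg hg θ)]
      exact weight_le hg θ
    refine ⟨i2.indicator hZ, ?_⟩
    have i3 : Integrable
        (fun θ => (τ.rnDeriv lam0 θ).toReal * (weight g θ * (A θ * M θ).trace.re)) lam0 :=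
      integrable_rnDeriv_mul i2
    rw [integral_indicator hZ, setIntegral_eq_singularPart_add (σ := lam0) i2 hZ,
      Measure.restrict_eq_zero.mpr hZ1, integral_zero_measure, zero_add]
    simp only [smul_eq_mul]
    refine (setIntegral_le_integral i3 (ae_of_all _ fun θ =>
      mul_nonneg ENNReal.toReal_nonneg (hnn θ))).trans ?_
    have i4 : Integrable (fun θ => weight g θ * p) lam0 :=
      (Continuous.integrable_torus (continuous_weight g) _).mul_const _
    have h1 : ∫ θ, weight g θ * p ∂lam0 = p := by
      rw [integral_mul_const, integral_weight, one_mul]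
    rw [← h1]
    refine integral_mono i3 i4 fun θ => ?_
    have h2 := trace_inv_add (hwpsd θ) hε
    have h3 := PosSemidef.trace_re_nonneg (hApd θ).posSemidef
    have h4 : (w θ * A θ).trace.re = (τ.rnDeriv lam0 θ).toReal * (A θ * M θ).trace.re := by
      rw [Matrix.trace_mul_comm, hw, Matrix.mul_smul, Matrix.trace_smul, smul_eq_mul,
        Complex.re_ofReal_mul]
    have h5 : (w θ * A θ).trace.re ≤ p := by
      change (w θ * A θ).trace.re + ε * (A θ).trace.re = p at h2
      nlinarith
    rw [h4] at h5
    have h6 := mul_le_mul_of_nonneg_left h5 (weight_nonneg hg θ)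
    change (τ.rnDeriv lam0 θ).toReal * (weight g θ * (A θ * M θ).trace.re) ≤ weight g θ * p
    linarith
  have hquad : ∫ θ, weight g θ * (evalT q θ * M θ * (evalT q θ)ᴴ).trace.re ∂τ
      ≤ p + 2 * p ^ 3 * ∫ θ, E θ ∂(τ + lam0) := by
    have hpt : ∀ θ, weight g θ * (evalT q θ * M θ * (evalT q θ)ᴴ).trace.re
        ≤ Z.indicator (fun θ => weight g θ * (A θ * M θ).trace.re) θ
          + p ^ 3 * (weight g θ * E θ) := by
      intro θ
      have h1 := mul_le_mul_of_nonneg_left (trace_mul_mul_conjTranspose_le (hM.norm_le θ) (hE θ))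
        (weight_nonneg hg θ)
      have h2 : weight g θ * (G θ * M θ * (G θ)ᴴ).trace.re
          = Z.indicator (fun θ => weight g θ * (A θ * M θ).trace.re) θ := by
        by_cases hθ : θ ∈ Z
        · rw [Set.indicator_of_mem hθ, ← hGG θ hθ, Matrix.trace_mul_comm, ← Matrix.mul_assoc]
        · simp [hG, Set.indicator_of_notMem hθ]
      rw [mul_add, h2] at h1
      linarith
    have h3 := integral_mono (hM.integral_weight_innerL g q).1
      (hsing.1.add (iτ.const_mul (p ^ 3))) hpt
    rw [integral_add' hsing.1 (iτ.const_mul _), integral_const_mul] at h3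
    have h4 := mul_le_mul_of_nonneg_left eτ (show (0 : ℝ) ≤ p ^ 3 by positivity)
    linarith [hsing.2]
  have hlog : -∫ θ, weight g θ * Real.log ((evalT q θ)ᴴ * evalT q θ + (δ : ℂ) • 1).det.re ∂lam0
      ≤ ∫ θ, weight g θ * Real.log (μ.density lam0 θ + (ε : ℂ) • 1).det.re ∂lam0
        + 2 * p ^ 3 * (p / δ) * ∫ θ, E θ ∂(τ + lam0) := by
    have hpt : ∀ᵐ θ ∂lam0,
        -(weight g θ * Real.log ((evalT q θ)ᴴ * evalT q θ + (δ : ℂ) • 1).det.re)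
        ≤ weight g θ * Real.log (μ.density lam0 θ + (ε : ℂ) • 1).det.re
          + p ^ 3 * (p / δ) * (weight g θ * E θ) := by
      have hZae : ∀ᵐ θ ∂lam0, θ ∈ Z := mem_ae_iff.mpr hZ2
      filter_upwards [hZae, hM.density_ae_eq lam0] with θ hθ hd
      have h1 := mul_le_mul_of_nonneg_left (neg_log_det_le (hwpsd θ) hε hδ0 (hGG θ hθ) (hE θ))
        (weight_nonneg hg θ)
      rw [hd]
      rw [mul_neg, mul_add] at h1
      refine h1.trans (le_of_eq ?_)
      simp only [hw]
      ring
    have i1 : Integrable (fun θ => weight g θ *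
        Real.log ((evalT q θ)ᴴ * evalT q θ + (δ : ℂ) • 1).det.re) lam0 :=
      Continuous.integrable_torus ((continuous_weight g).mul (continuous_log_det
        (((continuous_evalT q).matrix_conjTranspose.mul (continuous_evalT q)).add continuous_const)
        fun θ => posDef_add_smul_one (Matrix.posSemidef_conjTranspose_mul_self _) hδ0)) _
    have i2 := μ.integrable_weight_log_det_density_add hg hε
    have h3 := integral_mono_ae i1.neg (i2.add (i0.const_mul (p ^ 3 * (p / δ)))) hpt
    rw [integral_add' i2 (i0.const_mul _), integral_const_mul, integral_neg'] at h3
    have h4 := mul_le_mul_of_nonneg_left e0 (show (0 : ℝ) ≤ p ^ 3 * (p / δ) by positivity)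
    linarith
  filter_upwards [eventually_ge_atTop q.natDegree] with N hN
  have hmain := h.logDetSum_sub_le hμ hg hM hN hδ0
  have hE1 : 0 ≤ ∫ θ, E θ ∂(τ + lam0) := integral_nonneg hE0
  rw [hB] at hEB
  nlinarith

end MatrixOPUC

end

/-! ## Convergence of the partial sums -/

noncomputable section

namespace MatrixOPUC

variable {p : ℕ} {μ : MatrixMeasure p}

instance : NullSingletonClass lam0 :=
  inferInstanceAs (NullSingletonClass (AddCircle.haarAddCircle (T := 2 * π)))

/-- The weight vanishes only where `g cos θ = 1`, which for `|g| ≤ 1` forces `e^{iθ} = g`: at most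
one point. -/
theorem weight_pos_ae {g : ℝ} (hg : |g| ≤ 1) : ∀ᵐ θ ∂lam0, 0 < weight g θ := by
  have hsub : {θ : Torus | ¬ 0 < weight g θ}.Subsingleton := by
    have h1 : ∀ θ, ¬ 0 < weight g θ → expi θ = g := by
      intro θ hθ
      have h2 : g * cosT θ = 1 := by
        have := le_antisymm (not_lt.mp hθ) (weight_nonneg hg θ)
        unfold weight at this
        linarith
      have h3 := norm_expi θ
      have h4 : cosT θ ^ 2 + (expi θ).im ^ 2 = 1 := by
        have := Complex.sq_norm (expi θ)
        rw [h3, Complex.normSq_apply] at this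
        unfold cosT
        linarith
      have h5 := abs_le.mp hg
      have h6 := abs_le.mp (abs_cosT_le θ)
      have h7 : cosT θ = g := by nlinarith [sq_nonneg (g - cosT θ)]
      have h8 : (expi θ).im = 0 := by
        rw [h7] at h4 h2
        nlinarith
      exact Complex.ext h7 (by simpa using h8)
    intro θ hθ θ' hθ'
    have h2 : expi θ = expi θ' := (h1 θ hθ).trans (h1 θ' hθ').symm
    exact AddCircle.injective_toCircle Real.two_pi_pos.ne' (Subtype.ext h2)
  exact hsub.measure_zero lam0

/-! ### Removing the regularization. -/

section Regularization

theorem tendsto_log_det_add {A : Mat p} (h : 0 < A.det.re) :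
    Tendsto (fun n : ℕ => Real.log (A + ((1 / (n + 1 : ℝ) : ℝ) : ℂ) • 1).det.re) atTop
      (𝓝 (Real.log A.det.re)) := by
  have hc : Continuous fun c : ℝ => (A + (c : ℂ) • 1).det.re :=
    Complex.continuous_re.comp (Continuous.matrix_det
      (continuous_const.add (Complex.continuous_ofReal.smul continuous_const)))
  have h1 := (hc.tendsto 0).comp (tendsto_one_div_add_atTop_nhds_zero_nat (𝕜 := ℝ))
  simp only [Complex.ofReal_zero, zero_smul, add_zero] at h1
  exact h1.log h.ne'

theorem tendsto_log_det_add_atBot {A : Mat p} (hA : A.PosSemidef) (h : A.det.re = 0) :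
    Tendsto (fun n : ℕ => Real.log (A + ((1 / (n + 1 : ℝ) : ℝ) : ℂ) • 1).det.re) atTop atBot := by
  have hc : Continuous fun c : ℝ => (A + (c : ℂ) • 1).det.re :=
    Complex.continuous_re.comp (Continuous.matrix_det
      (continuous_const.add (Complex.continuous_ofReal.smul continuous_const)))
  have h1 := (hc.tendsto 0).comp (tendsto_one_div_add_atTop_nhds_zero_nat (𝕜 := ℝ))
  simp only [Complex.ofReal_zero, zero_smul, add_zero, h] at h1
  refine Real.tendsto_log_nhdsGT_zero.comp (tendsto_nhdsWithin_iff.mpr ⟨h1, ?_⟩)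
  exact Eventually.of_forall fun n => PosDef.det_re_pos (posDef_add_smul_one hA (by positivity))

theorem log_det_add_le_log_det_add_one {A : Mat p} (hA : A.PosSemidef) (n : ℕ) :
    Real.log (A + ((1 / (n + 1 : ℝ) : ℝ) : ℂ) • 1).det.re
      ≤ Real.log (A + ((1 : ℝ) : ℂ) • 1).det.re := by
  have h0 : 0 < (1 / (n + 1 : ℝ) : ℝ) := by positivity
  have h1 : (1 / (n + 1 : ℝ) : ℝ) ≤ 1 := by
    rw [div_le_one (by positivity)]
    linarith [(Nat.cast_nonneg n : (0 : ℝ) ≤ n)]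
  rcases h1.eq_or_lt with h | h
  · rw [h]
  · have h2 := log_det_le_log_det_add (posDef_add_smul_one hA h0) (sub_pos.mpr h)
    have h3 : A + ((1 / (n + 1 : ℝ) : ℝ) : ℂ) • 1 + ((1 - 1 / (n + 1 : ℝ) : ℝ) : ℂ) • 1
        = A + ((1 : ℝ) : ℂ) • 1 := by
      rw [add_assoc, ← add_smul, ← Complex.ofReal_add, add_sub_cancel]
    rwa [h3] at h2

/-- The integrability condition under which the entropy integral of `μ` is finite. -/
def MatrixMeasure.HasFiniteEntropy (μ : MatrixMeasure p) (g : ℝ) : Prop :=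
  (∀ᵐ θ ∂lam0, 0 < (μ.density lam0 θ).det.re) ∧
    Integrable (fun θ => weight g θ * Real.log (μ.density lam0 θ).det.re) lam0

theorem posDef_of_det_re_pos {A : Mat p} (hA : A.PosSemidef) (h : 0 < A.det.re) : A.PosDef := by
  rw [hA.posDef_iff_det_ne_zero]
  intro h0
  rw [h0] at h
  exact lt_irrefl _ h

/-- Dominated convergence: the integrands lie between the weight times `log det w` and the weight
times `log det (w + 1)`, both integrable. -/
theorem MatrixMeasure.HasFiniteEntropy.tendsto {g : ℝ} (hg : |g| ≤ 1)
    (h : μ.HasFiniteEntropy g) :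
    Tendsto (fun n : ℕ => ∫ θ, weight g θ * Real.log
        (μ.density lam0 θ + ((1 / (n + 1 : ℝ) : ℝ) : ℂ) • 1).det.re ∂lam0) atTop
      (𝓝 (∫ θ, weight g θ * Real.log (μ.density lam0 θ).det.re ∂lam0)) := by
  have i1 := μ.integrable_weight_log_det_density_add hg one_pos
  refine tendsto_integral_of_dominated_convergence
    (fun θ => |weight g θ * Real.log (μ.density lam0 θ).det.re|
      + |weight g θ * Real.log (μ.density lam0 θ + ((1 : ℝ) : ℂ) • 1).det.re|)
    (fun n => (μ.integrable_weight_log_det_density_add hg (by positivity)).aestronglyMeasurable)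
    (h.2.abs.add i1.abs) (fun n => ?_) ?_
  · filter_upwards [h.1, μ.posSemidef_density lam0] with θ h1 h2
    have h3 := log_det_le_log_det_add (posDef_of_det_re_pos h2 h1)
      (show 0 < (1 / (n + 1 : ℝ) : ℝ) by positivity)
    have h4 := log_det_add_le_log_det_add_one h2 n
    have h5 := mul_le_mul_of_nonneg_left h3 (weight_nonneg hg θ)
    have h6 := mul_le_mul_of_nonneg_left h4 (weight_nonneg hg θ)
    rw [Real.norm_eq_abs, abs_le]
    constructor
    · linarith [neg_abs_le (weight g θ * Real.log (μ.density lam0 θ).det.re),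
        abs_nonneg (weight g θ * Real.log (μ.density lam0 θ + ((1 : ℝ) : ℂ) • 1).det.re)]
    · linarith [le_abs_self (weight g θ * Real.log (μ.density lam0 θ + ((1 : ℝ) : ℂ) • 1).det.re),
        abs_nonneg (weight g θ * Real.log (μ.density lam0 θ).det.re)]
  · filter_upwards [h.1] with θ h1
    exact (tendsto_log_det_add h1).const_mul _

/-- Fatou's lemma for the almost everywhere nonnegative functions `u - v n`, whose integrals are
bounded by hypothesis. They tend to infinity almost everywhere on `det w = 0`, so this set is null,
and their limit is integrable. -/
theorem MatrixMeasure.hasFiniteEntropy_of_le {g : ℝ} (hg : |g| ≤ 1) {c : ℝ}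
    (h : ∀ ε : ℝ, 0 < ε →
      c ≤ ∫ θ, weight g θ * Real.log (μ.density lam0 θ + (ε : ℂ) • 1).det.re ∂lam0) :
    μ.HasFiniteEntropy g := by
  set D : Torus → Mat p := μ.density lam0 with hD
  set u : Torus → ℝ := fun θ => weight g θ * Real.log (D θ + ((1 : ℝ) : ℂ) • 1).det.re with hu
  have i1 : Integrable u lam0 := μ.integrable_weight_log_det_density_add hg one_pos
  set v : ℕ → Torus → ℝ := fun n θ =>
    weight g θ * Real.log (D θ + ((1 / (n + 1 : ℝ) : ℝ) : ℂ) • 1).det.re with hv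
  have i2 : ∀ n, Integrable (v n) lam0 := fun n =>
    μ.integrable_weight_log_det_density_add hg (by positivity)
  have hvu : ∀ n, ∀ᵐ θ ∂lam0, v n θ ≤ u θ := by
    intro n
    filter_upwards [μ.posSemidef_density lam0] with θ h2
    exact mul_le_mul_of_nonneg_left (log_det_add_le_log_det_add_one h2 n) (weight_nonneg hg θ)
  have hvm : ∀ n, Measurable (v n) := fun n => (continuous_weight g).measurable.mul
    (measurable_log_det_add (μ.measurable_density lam0) _)
  have hum : Measurable u := (continuous_weight g).measurable.mul
    (measurable_log_det_add (μ.measurable_density lam0) _)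
  have hbound : ∀ n, ∫⁻ θ, ENNReal.ofReal (u θ - v n θ) ∂lam0
      ≤ ENNReal.ofReal (∫ θ, u θ ∂lam0 - c) := by
    intro n
    have i3 : Integrable (fun θ => u θ - v n θ) lam0 := i1.sub (i2 n)
    rw [← ofReal_integral_eq_lintegral_ofReal i3
      ((hvu n).mono fun θ hθ => sub_nonneg.mpr hθ), integral_sub i1 (i2 n)]
    exact ENNReal.ofReal_le_ofReal (sub_le_sub_left (h _ (by positivity)) _)
  have hfatou : ∫⁻ θ, liminf (fun n => ENNReal.ofReal (u θ - v n θ)) atTop ∂lam0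
      ≤ ENNReal.ofReal (∫ θ, u θ ∂lam0 - c) :=
    (lintegral_liminf_le fun n => (hum.sub (hvm n)).ennreal_ofReal).trans
      (liminf_le_of_le (by isBoundedDefault) fun b hb => by
        obtain ⟨n, hn⟩ := hb.exists
        exact hn.trans (hbound n))
  have hfin := ae_lt_top (Measurable.liminf fun n => (hum.sub (hvm n)).ennreal_ofReal)
    (hfatou.trans_lt ENNReal.ofReal_lt_top).ne
  have hpos : ∀ᵐ θ ∂lam0, 0 < (D θ).det.re := by
    filter_upwards [hfin, μ.posSemidef_density lam0, weight_pos_ae hg] with θ h1 h2 h3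
    refine lt_of_le_of_ne (PosSemidef.det_re_nonneg h2) fun h0 => h1.ne ?_
    have h4 : Tendsto (fun n => ENNReal.ofReal (u θ - v n θ)) atTop (𝓝 ⊤) := by
      refine ENNReal.tendsto_ofReal_nhds_top.mpr ?_
      have h5 := (tendsto_log_det_add_atBot h2 h0.symm).const_mul_atBot h3
      exact (tendsto_atTop_add_const_left _ (u θ) (tendsto_neg_atBot_atTop.comp h5)).congr
        fun n => (sub_eq_add_neg _ _).symm
    exact h4.liminf_eq
  refine ⟨hpos, ?_⟩
  have hlim : ∀ᵐ θ ∂lam0, liminf (fun n => ENNReal.ofReal (u θ - v n θ)) atTop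
      = ENNReal.ofReal (u θ - weight g θ * Real.log (D θ).det.re) := by
    filter_upwards [hpos] with θ h1
    exact (ENNReal.tendsto_ofReal (((tendsto_log_det_add h1).const_mul _).const_sub _)).liminf_eq
  have hlm : Measurable fun θ => weight g θ * Real.log (D θ).det.re :=
    (continuous_weight g).measurable.mul (by
      simpa using measurable_log_det_add (μ.measurable_density lam0) 0)
  rw [lintegral_congr_ae hlim] at hfatou
  have hnn : ∀ᵐ θ ∂lam0, 0 ≤ u θ - weight g θ * Real.log (D θ).det.re := by
    filter_upwards [hpos, μ.posSemidef_density lam0] with θ h1 h2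
    have h3 := log_det_le_log_det_add (posDef_of_det_re_pos h2 h1) one_pos
    exact sub_nonneg.mpr (mul_le_mul_of_nonneg_left h3 (weight_nonneg hg θ))
  have i3 : Integrable (fun θ => u θ - weight g θ * Real.log (D θ).det.re) lam0 :=
    ⟨(hum.sub hlm).aestronglyMeasurable, by
      rw [hasFiniteIntegral_iff_ofReal hnn]
      exact hfatou.trans_lt ENNReal.ofReal_lt_top⟩
  have i4 := i1.sub i3
  refine i4.congr (ae_of_all _ fun θ => ?_)
  exact sub_sub_cancel _ _

end Regularization

/-! ### Decay of the coefficients and convergence of the partial sums. -/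

section Coefficients

/-- Expand `tr ((A ± B) (A ± B)†) ≥ 0`. -/
theorem abs_trace_mul_conjTranspose_le (A B : Mat p) :
    |(A * Bᴴ).trace.re| ≤ ((A * Aᴴ).trace.re + (B * Bᴴ).trace.re) / 2 := by
  have h0 : (B * Aᴴ).trace.re = (A * Bᴴ).trace.re := by
    have h := Matrix.trace_conjTranspose (A * Bᴴ)
    rw [Matrix.conjTranspose_mul, Matrix.conjTranspose_conjTranspose] at h
    rw [h]
    exact Complex.conj_re _
  have h1 := PosSemidef.trace_re_nonneg (Matrix.posSemidef_self_mul_conjTranspose (A + B))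
  have h2 := PosSemidef.trace_re_nonneg (Matrix.posSemidef_self_mul_conjTranspose (A - B))
  simp only [Matrix.conjTranspose_add, Matrix.conjTranspose_sub, add_mul, mul_add, sub_mul, mul_sub,
    Matrix.trace_add, Matrix.trace_sub, Complex.add_re, Complex.sub_re, h0] at h1 h2
  rw [abs_le]
  constructor <;> linarith

namespace IsSzegoSystem

variable {α : ℕ → Mat p} {a b : ℕ → (Mat p)[X]}

theorem trace_nonneg (α : ℕ → Mat p) (k : ℕ) : 0 ≤ (α k * (α k)ᴴ).trace.re :=
  PosSemidef.trace_re_nonneg (Matrix.posSemidef_self_mul_conjTranspose _)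

theorem trace_le (h : IsSzegoSystem μ α a b) (k : ℕ) : (α k * (α k)ᴴ).trace.re ≤ p := by
  have := PosSemidef.trace_re_nonneg (h.posDef_right k).posSemidef
  rw [Matrix.trace_sub, Matrix.trace_one, Complex.sub_re, Fintype.card_fin,
    Complex.natCast_re] at this
  linarith

/-- With `x_k = tr α_k α_k†`, each logarithm is at most `-x_k - x_k² / (2p)`, while `|g| ≤ 1` bounds
each cross term by `(x_k + x_{k+1}) / 2`. The linear terms cancel up to the boundary, and the
squares remain. -/
theorem sub_le_sub_sum_sq (h : IsSzegoSystem μ α a b) {g : ℝ} (hg : |g| ≤ 1) (N : ℕ) :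
    logDetSum α N - g * TSum α N
      ≤ p - ∑ k ∈ Finset.range N, (α k * (α k)ᴴ).trace.re ^ 2 / (2 * p) := by
  set x : ℕ → ℝ := fun k => (α k * (α k)ᴴ).trace.re with hx
  have hg' : ∀ t s : ℝ, |t| ≤ s → -(g * t) ≤ s ∧ g * t ≤ s := fun t s hts => by
    have h1 : |g * t| ≤ s := by
      rw [abs_mul]
      exact (mul_le_of_le_one_left (abs_nonneg t) hg).trans hts
    have h2 := abs_le.mp h1
    constructor <;> linarith
  -- The bound that keeps the boundary terms `p / 2 + x_N / 2` is the one that propagates by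
  -- induction.
  suffices hsuff : logDetSum α N - g * TSum α N
      ≤ p / 2 + x N / 2 - ∑ k ∈ Finset.range N, x k ^ 2 / (2 * p) by
    have := h.trace_le N
    change x N ≤ p at this
    linarith
  induction N with
  | zero =>
    have h1 := abs_trace_mul_conjTranspose_le (α 0) 1
    rw [Matrix.conjTranspose_one, mul_one, mul_one, Matrix.trace_one, Fintype.card_fin,
      Complex.natCast_re] at h1
    have h2 := (hg' _ _ h1).1
    simp only [logDetSum, TSum, Finset.range_zero, Finset.sum_empty, sub_zero, zero_sub]
    change _ ≤ (x 0 + p) / 2 at h2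
    linarith
  | succ k ih =>
    have h1 := (hg' _ _ (abs_trace_mul_conjTranspose_le (α k) (α (k + 1)))).2
    have h2 := PosDef.log_det_le_of_le_one (h.posDef_right k)
      (by rw [sub_sub_cancel]; exact Matrix.posSemidef_self_mul_conjTranspose _)
    rw [sub_sub_cancel, Fintype.card_fin] at h2
    rw [TSum_succ, logDetSum, Finset.sum_range_succ, Finset.sum_range_succ]
    rw [logDetSum] at ih
    change _ ≤ (x k + x (k + 1)) / 2 at h1
    change _ ≤ -x k - x k ^ 2 / (2 * p) at h2
    linarith

/-- Partial sums bounded below make the squares in `sub_le_sub_sum_sq` summable. -/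
theorem tendsto_trace (hp : 1 ≤ p) (h : IsSzegoSystem μ α a b) {g : ℝ} (hg : |g| ≤ 1) {c : ℝ}
    (hc : ∀ N, c ≤ logDetSum α (N + 1) - g * TSum α (N + 1)) :
    Tendsto (fun k => (α k * (α k)ᴴ).trace.re) atTop (𝓝 0) := by
  have hp0 : (0 : ℝ) < p := by exact_mod_cast hp
  have hnn : ∀ k, 0 ≤ (α k * (α k)ᴴ).trace.re ^ 2 / (2 * p) := fun k => by positivity
  have hs : Summable fun k => (α k * (α k)ᴴ).trace.re ^ 2 / (2 * p) := by
    refine summable_of_sum_range_le (c := p - c) hnn fun N => ?_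
    have h1 := h.sub_le_sub_sum_sq hg (N + 1)
    have h2 := hc N
    rw [Finset.sum_range_succ] at h1
    linarith [hnn N]
  have h1 := (hs.tendsto_atTop_zero.mul_const (2 * (p : ℝ))).sqrt
  simp only [zero_mul, Real.sqrt_zero] at h1
  refine h1.congr fun k => ?_
  rw [div_mul_cancel₀ _ (by positivity), Real.sqrt_sq (trace_nonneg α k)]

theorem sub_eq (α : ℕ → Mat p) (g : ℝ) (N : ℕ) :
    logDetSum α (N + 1) - g * TSum α (N + 1)
      = logDetSum α (N + 1) - g * TSum α N + g * (α N * (α (N + 1))ᴴ).trace.re := by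
  rw [TSum_succ]
  ring

theorem tendsto_of_hasFiniteEntropy (hp : 1 ≤ p) (hμ : μ.Nontrivial) (h : IsSzegoSystem μ α a b)
    {g : ℝ} (hg : |g| ≤ 1) (hfin : μ.HasFiniteEntropy g) :
    Tendsto (fun N => logDetSum α N - g * TSum α N) atTop
      (𝓝 (∫ θ, weight g θ * Real.log (μ.density lam0 θ).det.re ∂lam0)) := by
  rw [← tendsto_add_atTop_iff_nat 1]
  have hlow := h.integral_log_det_le hμ hg hfin.1 hfin.2
  have hx := h.tendsto_trace hp hg hlow
  have hx1 := (tendsto_add_atTop_iff_nat 1).mpr hx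
  have hz : Tendsto (fun N => g * (α N * (α (N + 1))ᴴ).trace.re) atTop (𝓝 0) := by
    refine squeeze_zero_norm (a := fun N => ((α N * (α N)ᴴ).trace.re
      + (α (N + 1) * (α (N + 1))ᴴ).trace.re) / 2) (fun N => ?_) ?_
    · rw [Real.norm_eq_abs, abs_mul]
      exact (mul_le_of_le_one_left (abs_nonneg _) hg).trans (abs_trace_mul_conjTranspose_le _ _)
    · simpa using (hx.add hx1).div_const 2
  rw [tendsto_order]
  refine ⟨fun c hc => Eventually.of_forall fun N => hc.trans_le (hlow N), fun c hc => ?_⟩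
  set S := ∫ θ, weight g θ * Real.log (μ.density lam0 θ).det.re ∂lam0
  -- One third each for the regularization, the approximation and the correction `g Re tr (α_N
  -- α_{N+1}†)`.
  have h3 : 0 < (c - S) / 3 := by linarith
  obtain ⟨n, hn⟩ := ((hfin.tendsto hg).eventually (gt_mem_nhds
    (show S < S + (c - S) / 3 by linarith))).exists
  filter_upwards [h.eventually_le hμ hg (ε := 1 / (n + 1 : ℝ)) (by positivity) h3,
    hz.eventually (gt_mem_nhds h3)] with N hN1 hN2
  rw [sub_eq]
  linarith

/-- The regularized integrals are unbounded below by `hasFiniteEntropy_of_le`. Decay of the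
coefficients is not needed: the correction is at most `p`, and `c - p - 1` leaves room for it and
for `η = 1`. -/
theorem tendsto_atBot_of_not_hasFiniteEntropy (hμ : μ.Nontrivial)
    (h : IsSzegoSystem μ α a b) {g : ℝ} (hg : |g| ≤ 1) (hfin : ¬ μ.HasFiniteEntropy g) :
    Tendsto (fun N => logDetSum α N - g * TSum α N) atTop atBot := by
  rw [← tendsto_add_atTop_iff_nat 1, tendsto_atBot]
  intro c
  have h1 : ∃ ε : ℝ, 0 < ε ∧
      ∫ θ, weight g θ * Real.log (μ.density lam0 θ + (ε : ℂ) • 1).det.re ∂lam0 < c - p - 1 := by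
    by_contra hcon
    push Not at hcon
    exact hfin (MatrixMeasure.hasFiniteEntropy_of_le hg hcon)
  obtain ⟨ε, hε, hεc⟩ := h1
  filter_upwards [h.eventually_le hμ hg hε one_pos] with N hN
  have h2 : |g * (α N * (α (N + 1))ᴴ).trace.re| ≤ p := by
    rw [abs_mul]
    refine (mul_le_of_le_one_left (abs_nonneg _) hg).trans
      ((abs_trace_mul_conjTranspose_le _ _).trans ?_)
    linarith [h.trace_le N, h.trace_le (N + 1)]
  rw [sub_eq]
  linarith [(abs_le.mp h2).2]

end IsSzegoSystem

end Coefficients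

end MatrixOPUC

end

/-! ## Extended-real entropy integrals -/

noncomputable section

namespace MatrixOPUC

variable {p : ℕ}

section ExtendedIntegral

theorem eintegral_congr_ae {σ : Measure Torus} {F G : Torus → EReal} (h : F =ᵐ[σ] G) :
    eintegral σ F = eintegral σ G := by
  unfold eintegral
  congr 2
  · exact lintegral_congr_ae (h.mono fun θ hθ => by simp only [hθ])
  · exact lintegral_congr_ae (h.mono fun θ hθ => by simp only [hθ])

theorem eintegral_coe {σ : Measure Torus} {f : Torus → ℝ} (hf : Integrable f σ) :
    eintegral σ (fun θ => (f θ : EReal)) = ((∫ θ, f θ ∂σ : ℝ) : EReal) := by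
  have hlt : ∀ {h : Torus → ℝ}, Integrable h σ → ∫⁻ θ, ENNReal.ofReal (h θ) ∂σ ≠ ⊤ := fun hh =>
    hh.lintegral_lt_top.ne
  unfold eintegral
  simp only [← EReal.coe_neg, EReal.real_coe_toENNReal]
  rw [integral_eq_lintegral_pos_part_sub_lintegral_neg_part hf, EReal.coe_sub,
    EReal.coe_ennreal_toReal (hlt hf),
    EReal.coe_ennreal_toReal (x := ∫⁻ θ, ENNReal.ofReal (-f θ) ∂σ) (hlt hf.neg)]

theorem eintegral_eq_bot {σ : Measure Torus} {F : Torus → EReal}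
    (h : ∫⁻ θ, (-F θ).toENNReal ∂σ = ⊤) :
    eintegral σ F = ⊥ := by
  unfold eintegral
  rw [h, EReal.coe_ennreal_top]
  exact EReal.sub_top _

/-- Multiplication by a nonnegative weight commutes with taking positive and negative parts. -/
theorem eintegral_lamg {g : ℝ} (hg : |g| ≤ 1) (F : Torus → EReal) :
    eintegral (lamg g) F = eintegral lam0 fun θ => ((weight g θ : ℝ) : EReal) * F θ := by
  have hw : Measurable fun θ => ENNReal.ofReal (weight g θ) :=
    (continuous_weight g).measurable.ennreal_ofReal
  have hx : ∀ θ, (0 : EReal) ≤ ((weight g θ : ℝ) : EReal) := fun θ => by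
    exact_mod_cast weight_nonneg hg θ
  have key : ∀ H : Torus → EReal, ∫⁻ θ, (H θ).toENNReal ∂(lamg g)
      = ∫⁻ θ, (((weight g θ : ℝ) : EReal) * H θ).toENNReal ∂lam0 := fun H => by
    rw [lamg]
    change ∫⁻ θ, (H θ).toENNReal ∂(lam0.withDensity fun θ => ENNReal.ofReal (weight g θ)) = _
    rw [lintegral_withDensity_eq_lintegral_mul_non_measurable _ hw
      (ae_of_all _ fun θ => ENNReal.ofReal_lt_top)]
    refine lintegral_congr fun θ => ?_
    rw [EReal.toENNReal_mul (hx θ), EReal.real_coe_toENNReal]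
    rfl
  unfold eintegral
  rw [key, key]
  simp only [mul_neg]

variable {ρ D u : Torus → ℝ} {σ : Measure Torus}

theorem eintegral_mul_log_eq (hpos : ∀ᵐ θ ∂σ, 0 < D θ)
    (hint : Integrable (fun θ => ρ θ * Real.log (D θ)) σ) :
    eintegral σ (fun θ => ((ρ θ : ℝ) : EReal) * ENNReal.log (ENNReal.ofReal (D θ)))
      = ((∫ θ, ρ θ * Real.log (D θ) ∂σ : ℝ) : EReal) := by
  rw [← eintegral_coe hint]
  refine eintegral_congr_ae (hpos.mono fun θ hθ => ?_)
  simp only [ENNReal.log_ofReal_of_pos hθ, EReal.coe_mul]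

/-- The positive part is dominated by `u`. If the negative part were integrable as well, `D` would
be positive almost everywhere, because `ρ log 0 = -∞` for `ρ > 0`, and `ρ log D` would be
integrable, contradicting `hnot`. -/
theorem eintegral_mul_log_eq_bot (hρm : Measurable ρ) (hρ : ∀ᵐ θ ∂σ, 0 < ρ θ) (hD : Measurable D)
    (hD0 : ∀ᵐ θ ∂σ, 0 ≤ D θ) (hu : Integrable u σ)
    (hle : ∀ᵐ θ ∂σ, 0 < D θ → ρ θ * Real.log (D θ) ≤ u θ)
    (hnot : ¬ ((∀ᵐ θ ∂σ, 0 < D θ) ∧ Integrable (fun θ => ρ θ * Real.log (D θ)) σ)) :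
    eintegral σ (fun θ => ((ρ θ : ℝ) : EReal) * ENNReal.log (ENNReal.ofReal (D θ))) = ⊥ := by
  set F : Torus → EReal := fun θ => ((ρ θ : ℝ) : EReal) * ENNReal.log (ENNReal.ofReal (D θ)) with hF
  have hFpos : ∀ θ, 0 < D θ → F θ = ((ρ θ * Real.log (D θ) : ℝ) : EReal) := fun θ hθ => by
    simp only [hF, ENNReal.log_ofReal_of_pos hθ, EReal.coe_mul]
  have hFbot : ∀ θ, 0 < ρ θ → D θ = 0 → F θ = ⊥ := fun θ h1 h2 => by
    simp only [hF, h2, ENNReal.ofReal_zero, ENNReal.log_zero]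
    exact EReal.coe_mul_bot_of_pos h1
  have h1 : ∫⁻ θ, (F θ).toENNReal ∂σ ≠ ⊤ := by
    refine ne_top_of_le_ne_top hu.lintegral_lt_top.ne (lintegral_mono_ae ?_)
    filter_upwards [hρ, hD0, hle] with θ h1 h2 h3
    rcases h2.eq_or_lt with h4 | h4
    · rw [hFbot θ h1 h4.symm]
      simp
    · rw [hFpos θ h4, EReal.real_coe_toENNReal]
      exact ENNReal.ofReal_le_ofReal (h3 h4)
  refine eintegral_eq_bot ?_
  by_contra h2
  have hFm : Measurable F := (measurable_coe_real_ereal.comp hρm).mul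
    (ENNReal.measurable_log.comp hD.ennreal_ofReal)
  have hae := ae_lt_top hFm.neg.ereal_toENNReal h2
  have hpos : ∀ᵐ θ ∂σ, 0 < D θ := by
    filter_upwards [hae, hρ, hD0] with θ h3 h4 h5
    refine lt_of_le_of_ne h5 fun h6 => ?_
    rw [Pi.neg_apply, hFbot θ h4 h6.symm] at h3
    simp at h3
  refine hnot ⟨hpos, ?_⟩
  have hm : Measurable fun θ => ρ θ * Real.log (D θ) := hρm.mul (Real.measurable_log.comp hD)
  have e1 : ∫⁻ θ, ENNReal.ofReal (ρ θ * Real.log (D θ)) ∂σ ≠ ⊤ := by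
    refine ne_of_eq_of_ne (lintegral_congr_ae (hpos.mono fun θ hθ => ?_)) h1
    simp only [hFpos θ hθ, EReal.real_coe_toENNReal]
  have e2 : ∫⁻ θ, ENNReal.ofReal (-(ρ θ * Real.log (D θ))) ∂σ ≠ ⊤ := by
    refine ne_of_eq_of_ne (lintegral_congr_ae (hpos.mono fun θ hθ => ?_)) h2
    simp only [hFpos θ hθ, ← EReal.coe_neg, EReal.real_coe_toENNReal]
  refine ⟨hm.aestronglyMeasurable, ?_⟩
  have h3 : ∀ t : ℝ, ‖t‖ₑ = ENNReal.ofReal t + ENNReal.ofReal (-t) := fun t => by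
    rw [Real.enorm_eq_ofReal_abs]
    rcases le_total 0 t with ht | ht
    · rw [abs_of_nonneg ht, ENNReal.ofReal_of_nonpos (neg_nonpos.mpr ht), add_zero]
    · rw [abs_of_nonpos ht, ENNReal.ofReal_of_nonpos ht, zero_add]
  unfold HasFiniteIntegral
  simp only [h3]
  rw [lintegral_add_left hm.ennreal_ofReal]
  exact ENNReal.add_lt_top.mpr ⟨lt_top_iff_ne_top.mpr e1, lt_top_iff_ne_top.mpr e2⟩

end ExtendedIntegral

/-! ### Entropy relative to the weighted measure. -/

section Entropy

variable (μ : MatrixMeasure p) {g : ℝ}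

theorem measurable_det_density (σ : Measure Torus) :
    Measurable fun θ => (μ.density σ θ).det.re :=
  Complex.measurable_re.comp (measurable_det (μ.measurable_density σ))

/-- The integral `∫ (1 - g cos θ) log (1 - g cos θ) dλ₀`. -/
def weightEntropy (g : ℝ) : ℝ := ∫ θ, weight g θ * Real.log (weight g θ) ∂lam0

theorem integrable_weight_mul_log_weight (g : ℝ) :
    Integrable (fun θ => weight g θ * Real.log (weight g θ)) lam0 :=
  Continuous.integrable_torus (Real.continuous_mul_log.comp (continuous_weight g)) _

instance (g : ℝ) : IsFiniteMeasure (lamg g) :=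
  isFiniteMeasure_withDensity_ofReal
    (Continuous.integrable_torus (continuous_weight g) lam0).2

theorem lam0_absolutelyContinuous_lamg (hg : |g| ≤ 1) : lam0 ≪ lamg g := by
  refine withDensity_absolutelyContinuous' (continuous_weight g).measurable.ennreal_ofReal.aemeasurable ?_
  filter_upwards [weight_pos_ae hg] with θ hθ
  exact (ENNReal.ofReal_pos.mpr hθ).ne'

/-- The weight is positive almost everywhere, so `λ₀` is absolutely continuous with respect to `λ_g`
and the densities differ by the factor `dλ₀ / dλ_g`. -/
theorem density_lamg_ae_eq (hg : |g| ≤ 1) :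
    ∀ᵐ θ ∂lam0, μ.density (lamg g) θ = ((weight g θ)⁻¹ : ℂ) • μ.density lam0 θ := by
  obtain ⟨τ, M, hM⟩ := μ.exists_isDensity
  have := hM.finite
  have hr := Measure.rnDeriv_withDensity_right τ lam0 (f := fun θ => ENNReal.ofReal (weight g θ))
    (continuous_weight g).measurable.ennreal_ofReal.aemeasurable
    (by
      filter_upwards [weight_pos_ae hg] with θ hθ
      exact (ENNReal.ofReal_pos.mpr hθ).ne')
    (ae_of_all _ fun θ => ENNReal.ofReal_ne_top)
  filter_upwards [hM.density_ae_eq lam0,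
    (lam0_absolutelyContinuous_lamg hg).ae_le (hM.density_ae_eq (lamg g)), hr,
    weight_pos_ae hg] with θ h1 h2 h3 h4
  change τ.rnDeriv (lamg g) θ = _ at h3
  rw [h1, h2, h3, smul_smul, ENNReal.toReal_mul, ENNReal.toReal_inv,
    ENNReal.toReal_ofReal h4.le]
  push_cast
  rfl

/-- The determinant is homogeneous of degree `p`. This yields the constant `p ∫ (1 - g cos θ) log (1
- g cos θ) dλ₀` separating the two forms of the theorem. -/
theorem log_det_density_lamg (hg : |g| ≤ 1) :
    ∀ᵐ θ ∂lam0, (0 < (μ.density (lamg g) θ).det.re ↔ 0 < (μ.density lam0 θ).det.re) ∧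
      (0 < (μ.density lam0 θ).det.re → weight g θ * Real.log (μ.density (lamg g) θ).det.re
        = weight g θ * Real.log (μ.density lam0 θ).det.re
          - p * (weight g θ * Real.log (weight g θ))) := by
  filter_upwards [density_lamg_ae_eq μ hg, weight_pos_ae hg] with θ h1 h2
  have h3 : (μ.density (lamg g) θ).det.re = (weight g θ)⁻¹ ^ p * (μ.density lam0 θ).det.re := by
    rw [h1, Matrix.det_smul, Fintype.card_fin, ← Complex.ofReal_inv, ← Complex.ofReal_pow,
      Complex.re_ofReal_mul]
  have h4 : 0 < (weight g θ)⁻¹ ^ p := by positivity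
  rw [h3]
  refine ⟨mul_pos_iff_of_pos_left h4, fun h5 => ?_⟩
  rw [Real.log_mul h4.ne' h5.ne', Real.log_pow, Real.log_inv]
  ring

theorem weight_mul_log_det_le (hg : |g| ≤ 1) :
    ∀ᵐ θ ∂lam0, 0 < (μ.density lam0 θ).det.re →
      weight g θ * Real.log (μ.density lam0 θ).det.re
        ≤ weight g θ * Real.log (μ.density lam0 θ + ((1 : ℝ) : ℂ) • 1).det.re := by
  filter_upwards [μ.posSemidef_density lam0] with θ h1 h2
  exact mul_le_mul_of_nonneg_left
    (log_det_le_log_det_add (posDef_of_det_re_pos h1 h2) one_pos) (weight_nonneg hg θ)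

theorem eintegral_weight_mul_logDet_of_hasFiniteEntropy (h : μ.HasFiniteEntropy g) :
    eintegral lam0 (fun θ => ((weight g θ : ℝ) : EReal) * logDet (μ.density lam0 θ))
      = ((∫ θ, weight g θ * Real.log (μ.density lam0 θ).det.re ∂lam0 : ℝ) : EReal) :=
  eintegral_mul_log_eq h.1 h.2

theorem eintegral_weight_mul_logDet_of_not_hasFiniteEntropy (hg : |g| ≤ 1)
    (h : ¬ μ.HasFiniteEntropy g) :
    eintegral lam0 (fun θ => ((weight g θ : ℝ) : EReal) * logDet (μ.density lam0 θ)) = ⊥ :=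
  eintegral_mul_log_eq_bot (continuous_weight g).measurable (weight_pos_ae hg)
    (measurable_det_density μ lam0)
    ((μ.posSemidef_density lam0).mono fun _ hθ => PosSemidef.det_re_nonneg hθ)
    (μ.integrable_weight_log_det_density_add hg one_pos) (weight_mul_log_det_le μ hg) h

theorem relEntropy_of_hasFiniteEntropy (hg : |g| ≤ 1) (h : μ.HasFiniteEntropy g) :
    relEntropy (lamg g) μ = ((p * weightEntropy g
      - ∫ θ, weight g θ * Real.log (μ.density lam0 θ).det.re ∂lam0 : ℝ) : EReal) := by
  have hlog := log_det_density_lamg μ hg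
  have heq : (fun θ => weight g θ * Real.log (μ.density (lamg g) θ).det.re) =ᵐ[lam0]
      fun θ => weight g θ * Real.log (μ.density lam0 θ).det.re
        - p * (weight g θ * Real.log (weight g θ)) := by
    filter_upwards [hlog, h.1] with θ h1 h2
    exact h1.2 h2
  have i1 := (integrable_weight_mul_log_weight g).const_mul (p : ℝ)
  unfold relEntropy
  rw [eintegral_lamg hg]
  simp only [logDet]
  rw [eintegral_mul_log_eq (by filter_upwards [hlog, h.1] with θ h1 h2 using h1.1.mpr h2)
    ((h.2.sub i1).congr heq.symm), integral_congr_ae heq, integral_sub h.2 i1, integral_const_mul,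
    ← EReal.coe_neg, weightEntropy]
  congr 1
  ring

theorem relEntropy_of_not_hasFiniteEntropy (hg : |g| ≤ 1) (h : ¬ μ.HasFiniteEntropy g) :
    relEntropy (lamg g) μ = ⊤ := by
  have hlog := log_det_density_lamg μ hg
  have i1 := (integrable_weight_mul_log_weight g).const_mul (p : ℝ)
  unfold relEntropy
  rw [eintegral_lamg hg]
  simp only [logDet]
  rw [eintegral_mul_log_eq_bot (u := fun θ =>
      weight g θ * Real.log (μ.density lam0 θ + ((1 : ℝ) : ℂ) • 1).det.re
        - p * (weight g θ * Real.log (weight g θ)))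
    (continuous_weight g).measurable (weight_pos_ae hg)
    (measurable_det_density μ (lamg g)) ?_
    ((μ.integrable_weight_log_det_density_add hg one_pos).sub i1) ?_ ?_, EReal.neg_bot]
  · filter_upwards [(lam0_absolutelyContinuous_lamg hg).ae_le (μ.posSemidef_density (lamg g))]
      with θ hθ
    exact PosSemidef.det_re_nonneg hθ
  · filter_upwards [hlog, weight_mul_log_det_le μ hg] with θ h1 h2 h3
    rw [h1.2 (h1.1.mp h3)]
    linarith [h2 (h1.1.mp h3)]
  · rintro ⟨h1, h2⟩
    have hpos : ∀ᵐ θ ∂lam0, 0 < (μ.density lam0 θ).det.re := by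
      filter_upwards [hlog, h1] with θ h3 h4 using h3.1.mp h4
    refine h ⟨hpos, (h2.add i1).congr ?_⟩
    filter_upwards [hlog, hpos] with θ h3 h4
    rw [Pi.add_apply, h3.2 h4, sub_add_cancel]

theorem quasiScalar_density_ae_eq :
    ∀ᵐ θ ∂lam0, (quasiScalar p lam0).density lam0 θ = 1 := by
  have h : (quasiScalar p lam0).IsDensity lam0 fun _ => 1 := by
    refine ⟨inferInstance, fun i j => measurable_const, fun _ => Matrix.PosSemidef.one,
      fun θ i j => ?_, fun i j => ?_⟩
    · rw [Matrix.one_apply]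
      split_ifs <;> simp
    · ext A hA
      rw [withDensityᵥ_apply (integrable_const _) hA]
      by_cases hij : i = j
      · subst hij
        apply Complex.ext <;>
          simp [quasiScalar, SignedMeasure.toComplexMeasure_apply, Measure.toSignedMeasure_apply,
            hA]
      · simp [quasiScalar, hij]
  filter_upwards [h.density_ae_eq lam0, Measure.rnDeriv_self lam0] with θ h1 h2
  rw [h1, h2]
  simp

theorem relEntropyRef_eq (p : ℕ) (hg : |g| ≤ 1) :
    relEntropyRef p g = ((p * weightEntropy g : ℝ) : EReal) := by
  have hzero : (fun θ => weight g θ * Real.log ((quasiScalar p lam0).density lam0 θ).det.re)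
      =ᵐ[lam0] fun _ => 0 := by
    filter_upwards [quasiScalar_density_ae_eq (p := p)] with θ h1
    rw [h1]
    simp
  have hfin : (quasiScalar p lam0).HasFiniteEntropy g := by
    refine ⟨?_, (integrable_zero _ _ _).congr hzero.symm⟩
    filter_upwards [quasiScalar_density_ae_eq (p := p)] with θ h1
    rw [h1]
    simp
  rw [relEntropyRef, relEntropy_of_hasFiniteEntropy _ hg hfin, integral_congr_ae hzero]
  simp

theorem lamg_real_univ (hg : |g| ≤ 1) : (lamg g).real Set.univ = 1 := by
  rw [measureReal_def, lamg, withDensity_apply _ MeasurableSet.univ, Measure.restrict_univ]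
  change (∫⁻ θ, ENNReal.ofReal (weight g θ) ∂lam0).toReal = 1
  rw [← integral_eq_lintegral_of_nonneg_ae (ae_of_all _ (weight_nonneg hg))
    (continuous_weight g).aestronglyMeasurable, integral_weight]

/-- The correction by total masses in `klDiv` vanishes, both masses being `1`; nonnegativity removes
the truncation by `ENNReal.ofReal`. -/
theorem coe_klDiv_lamg (hg : |g| ≤ 1) :
    (InformationTheory.klDiv (lamg g) lam0 : EReal) = ((weightEntropy g : ℝ) : EReal) := by
  have hac : lamg g ≪ lam0 := withDensity_absolutelyContinuous _ _
  have hllr : llr (lamg g) lam0 =ᵐ[lamg g] fun θ => Real.log (weight g θ) := by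
    filter_upwards [hac.ae_le (Measure.rnDeriv_withDensity lam0
      (continuous_weight g).measurable.ennreal_ofReal)] with θ hθ
    change (lamg g).rnDeriv lam0 θ = _ at hθ
    rw [llr, hθ, ENNReal.toReal_ofReal (weight_nonneg hg θ)]
  have hwm := (continuous_weight g).measurable.ennreal_ofReal
  have hlt : ∀ᵐ θ ∂lam0, ENNReal.ofReal (weight g θ) < ⊤ :=
    ae_of_all _ fun θ => ENNReal.ofReal_lt_top
  have hint' : Integrable (fun θ => Real.log (weight g θ)) (lamg g) := by
    change Integrable _ (lam0.withDensity fun θ => ENNReal.ofReal (weight g θ))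
    rw [integrable_withDensity_iff_integrable_smul' hwm hlt]
    simpa only [ENNReal.toReal_ofReal (weight_nonneg hg _), smul_eq_mul] using
      integrable_weight_mul_log_weight g
  have hval : ∫ θ, Real.log (weight g θ) ∂(lamg g) = weightEntropy g := by
    change ∫ θ, _ ∂(lam0.withDensity fun θ => ENNReal.ofReal (weight g θ)) = _
    rw [integral_withDensity_eq_integral_toReal_smul hwm hlt]
    simp only [ENNReal.toReal_ofReal (weight_nonneg hg _), smul_eq_mul, weightEntropy]
  have hint : Integrable (llr (lamg g) lam0) (lamg g) := hint'.congr hllr.symm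
  have hnn := InformationTheory.integral_llr_add_sub_measure_univ_nonneg hac hint
  rw [InformationTheory.klDiv_of_ac_of_integrable hac hint]
  rw [integral_congr_ae hllr, hval, lamg_real_univ hg, probReal_univ, add_sub_cancel_right] at hnn ⊢
  rw [EReal.coe_ennreal_ofReal, max_eq_left hnn]

/-- Integrate `log det h ≤ tr h - p` against `λ_g`, with `h` the density of `μ` relative to `λ_g`;
the trace mass of the absolutely continuous part is at most `tr μ(𝕋) = p`. -/
theorem relEntropy_nonneg (hg : |g| ≤ 1) : 0 ≤ relEntropy (lamg g) μ := by
  by_cases h : μ.HasFiniteEntropy g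
  · rw [relEntropy_of_hasFiniteEntropy μ hg h]
    obtain ⟨τ, M, hM⟩ := μ.exists_isDensity
    -- Weight parameter `0` and the constant polynomial `1` give the total trace mass `p`.
    obtain ⟨i1, e1⟩ := hM.integral_weight_innerR 0 1
    simp only [evalT_one, Matrix.conjTranspose_one, Matrix.mul_one, zero_mul,
      sub_zero, μ.innerR_one_one, weight, one_mul, Matrix.trace_one, Fintype.card_fin,
      Complex.natCast_re] at i1 e1
    obtain ⟨i2, e2⟩ := hM.integral_rnDeriv_mul_le i1 fun θ =>
      PosSemidef.trace_re_nonneg (hM.posSemidef θ)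
    rw [e1] at e2
    have i3 := (integrable_weight_mul_log_weight g).const_mul (p : ℝ)
    have i4 : Integrable (fun θ => weight g θ * p) lam0 :=
      (Continuous.integrable_torus (continuous_weight g) _).mul_const _
    have hle : ∀ᵐ θ ∂lam0, weight g θ * Real.log (μ.density lam0 θ).det.re
          - p * (weight g θ * Real.log (weight g θ))
        ≤ (τ.rnDeriv lam0 θ).toReal * (M θ).trace.re - weight g θ * p := by
      filter_upwards [log_det_density_lamg μ hg, h.1, weight_pos_ae hg, density_lamg_ae_eq μ hg,
        hM.density_ae_eq lam0, (lam0_absolutelyContinuous_lamg hg).ae_le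
          (μ.posSemidef_density (lamg g))] with θ h1 h2 h3 h4 h5 h6
      rw [← h1.2 h2]
      have h7 := PosDef.log_det_le_trace_sub (posDef_of_det_re_pos h6 (h1.1.mpr h2))
      rw [Fintype.card_fin] at h7
      refine (mul_le_mul_of_nonneg_left h7 h3.le).trans (le_of_eq ?_)
      rw [mul_sub, h4, h5, Matrix.trace_smul, Matrix.trace_smul, smul_eq_mul, smul_eq_mul,
        ← Complex.ofReal_inv, Complex.re_ofReal_mul, Complex.re_ofReal_mul,
        mul_inv_cancel_left₀ h3.ne']
    have h8 := integral_mono_ae (h.2.sub i3) (i2.sub i4) hle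
    rw [integral_sub' h.2 i3, integral_sub' i2 i4, integral_const_mul, integral_mul_const,
      integral_weight, one_mul] at h8
    have h9 : ∫ θ, weight g θ * Real.log (weight g θ) ∂lam0 = weightEntropy g := rfl
    rw [h9] at h8
    rw [← EReal.coe_zero, EReal.coe_le_coe_iff]
    linarith
  · rw [relEntropy_of_not_hasFiniteEntropy μ hg h]
    exact le_top

end Entropy

end MatrixOPUC

end

/-! ### The sum rule. -/

open MatrixOPUC in
theorem theorem2p2 {p : ℕ} (hp : 1 ≤ p) (g : ℝ) (hg : |g| ≤ 1)
    (μ : MatrixOPUC.MatrixMeasure p) (hμ : μ.Nontrivial) :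
    Tendsto
      (fun N : ℕ =>
        ((MatrixOPUC.logDetSum (MatrixOPUC.verblunsky μ) N
          - g * MatrixOPUC.TSum (MatrixOPUC.verblunsky μ) N : ℝ) : EReal))
      atTop
      (𝓝 (MatrixOPUC.eintegral MatrixOPUC.lam0 fun θ =>
        ((1 - g * MatrixOPUC.cosT θ : ℝ) : EReal)
          * MatrixOPUC.logDet (μ.density MatrixOPUC.lam0 θ))) ∧
    Tendsto
      (fun N : ℕ =>
        MatrixOPUC.relEntropyRef p g
          + ((-MatrixOPUC.logDetSum (MatrixOPUC.verblunsky μ) N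
            + g * MatrixOPUC.TSum (MatrixOPUC.verblunsky μ) N : ℝ) : EReal))
      atTop (𝓝 (MatrixOPUC.relEntropy (MatrixOPUC.lamg g) μ)) ∧
    MatrixOPUC.relEntropyRef p g
      = (p : EReal)
        * (InformationTheory.klDiv (MatrixOPUC.lamg g) MatrixOPUC.lam0 : EReal) ∧
    0 ≤ MatrixOPUC.relEntropy (MatrixOPUC.lamg g) μ := by
  obtain ⟨a, b, h⟩ := hμ.isVerblunsky.exists_isSzegoSystem hμ
  refine ⟨?_, ?_, ?_, relEntropy_nonneg μ hg⟩
  · change Tendsto _ _ (𝓝 (eintegral lam0 fun θ =>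
      ((weight g θ : ℝ) : EReal) * logDet (μ.density lam0 θ)))
    by_cases hfin : μ.HasFiniteEntropy g
    · rw [eintegral_weight_mul_logDet_of_hasFiniteEntropy μ hfin, EReal.tendsto_coe]
      exact h.tendsto_of_hasFiniteEntropy hp hμ hg hfin
    · rw [eintegral_weight_mul_logDet_of_not_hasFiniteEntropy μ hg hfin]
      exact EReal.tendsto_coe_nhds_bot_iff.mpr
        (h.tendsto_atBot_of_not_hasFiniteEntropy hμ hg hfin)
  · simp only [relEntropyRef_eq p hg, ← EReal.coe_add]
    by_cases hfin : μ.HasFiniteEntropy g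
    · rw [relEntropy_of_hasFiniteEntropy μ hg hfin, EReal.tendsto_coe]
      refine ((h.tendsto_of_hasFiniteEntropy hp hμ hg hfin).const_sub _).congr fun N => ?_
      ring
    · rw [relEntropy_of_not_hasFiniteEntropy μ hg hfin]
      refine EReal.tendsto_coe_nhds_top_iff.mpr ?_
      refine (tendsto_atTop_add_const_left _ (p * weightEntropy g) (tendsto_neg_atBot_atTop.comp
        (h.tendsto_atBot_of_not_hasFiniteEntropy hμ hg hfin))).congr fun N => ?_
      simp only [Function.comp_apply]
      ring
  · rw [relEntropyRef_eq p hg, coe_klDiv_lamg hg, EReal.coe_mul]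
    rfl
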